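/- **Setting.** Let $\widehat{\mathcal T}$ be an oriented ideal triangulation, with $n$ tetrahedra, of an oriented $3$-manifold $M$ whose boundary consists of $k$ tori $T_1,\dots,T_k$. For a system $\boldsymbol\alpha=(\alpha_1,\dots,\alpha_k)$ of nontrivial simple closed curves $\alpha_c\subset T_c$ and shape parameters $z_j\in\mathbb C\setminus\{0,1\}$, put $z_j'=\frac1{1-z_j}$ and $z_j''=1-\frac1{z_j}$; opposite edges of the $j$-th tetrahedron carry the same parameter, and $z_j,z_j',z_j''$ occur in counterclockwise order around each ideal vertex. For an edge $e$ let $E_{e,j},E'_{e,j},E''_{e,j}$ be the numbers of edges with parameter $z_j,z_j',z_j''$ incident to $e$; let $C_{c,j},C'_{c,j},C''_{c,j}$ be the numbers of corners with parameter $z_j,z_j',z_j''$ to the left of $\alpha_c$ minus the numbers to its right. The gluing variety $\mathcal V_{\widehat{\mathcal T}}$ is the set of $\mathbf z\in(\mathbb C\setminus\{0,1\})^n$ with $\prod_j z_j^{E_{e,j}}(z_j')^{E'_{e,j}}(z_j'')^{E''_{e,j}}=1$ for every edge $e$. Choose $n-k$ edges such that the exponent vector of every edge equation is an integral combination of the exponent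 vectors of the chosen ones and of those of the relations $z_jz_j'z_j''=-1$. Let $G,G',G''$ be the $n\times n$ matrices formed by the rows $E_e,E'_e,E''_e$ of the chosen edges $e$ and the rows $C_c,C'_c,C''_c$ for $c=1,\dots,k$. A strong combinatorial flattening is a triple $(\mathbf f,\mathbf f',\mathbf f'')$ in $(\mathbb Z^n)^3$ with $f_j+f_j'+f_j''=1$ for all $j$, with $\sum_j(E_{e,j}f_j+E'_{e,j}f'_j+E''_{e,j}f''_j)=2$ for every edge $e$, and with $\sum_j(C_jf_j+C'_jf'_j+C''_jf''_j)=0$ for the left-minus-right corner numbers $C_j,C_j',C_j''$ of every nontrivial simple closed curve on $\partial M$. The $1$-loop invariant, which is defined up to sign, is $$\tau(M,\boldsymbol\alpha,\mathbf z,\widehat{\mathcal T})=\pm\tfrac12\det\big((G-G')\Delta_{\mathbf z''}+(G''-G')\Delta_{\mathbf z}^{-1}\big)\prod_{j=1}^n z_j^{f_j''}(z_j'')^{-f_j},$$ where $\Delta_{\mathbf x}$ denotes the diagonal matrix with diagonal $\mathbf x$. **Filling.** Let $0\le l<k$, and suppose that for $i=1,\dots,l$ the cusp $T_i$ meets exactly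 two tetrahedra $\Delta_1^i\ne\Delta_2^i$, each in exactly one ideal vertex. The two faces opposite to these vertices form a once-punctured torus; let $f_i,g_i,h_i$ be its three edges. Suppose that removing $\Delta_1^i,\Delta_2^i$ for $i=1,\dots,l$ and folding each of these once-punctured tori along $h_i$ (which identifies $f_i$ with $g_i$) gives an ideal triangulation $\widehat{\mathcal T}'$ whose boundary tori are $T_{l+1},\dots,T_k$, and let $M'$ be the underlying manifold. So $M'$ is obtained from $M$ by the Dehn filling which kills the curves on $T_1,\dots,T_l$ that meet $h_i$ twice and each of $f_i,g_i$ once. **Theorem.** Let $\boldsymbol\alpha=(\alpha_1,\dots,\alpha_l,\alpha_{l+1},\dots,\alpha_k)$ be a system of simple closed curves on $\partial M$ such that $\alpha_1,\dots,\alpha_l$ are the curves killed by the filling, and let $\boldsymbol\alpha'=(\alpha_{l+1},\dots,\alpha_k)$. Let $\widehat{\mathbf z}\in\mathcal V_{\widehat{\mathcal T}}$ be a point whose associated representation $\rho:\pi_1(M)\to\mathrm{PSL}(2;\mathbb C)$ is trivial on $\alpha_1,\dots,\alpha_l$ (this holds if $\rho$ is the restriction of a representation of $\pi_1(M')$), and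 suppose that the tuple $\widehat{\mathbf z}'$ obtained from $\widehat{\mathbf z}$ by removing the shape parameters of all $\Delta_1^i,\Delta_2^i$ lies in $\mathcal V_{\widehat{\mathcal T}'}$. For $i=1,\dots,l$ let $\gamma_i\subset T_i$ be a simple closed curve that meets $\alpha_i$ with algebraic intersection number $\pm1$, i.e. is isotopic to the core of the $i$-th filled solid torus, and let $\mathrm H(\gamma_i)\in\mathbb C$ be a logarithm of its holonomy (the product of the shape parameters of the corners to the left of $\gamma_i$ divided by the product of those to its right). Then $$\tau(M',\boldsymbol\alpha',\widehat{\mathbf z}',\widehat{\mathcal T}')\;\prod_{i=1}^l4\sinh^2\frac{\mathrm H(\gamma_i)}2=\pm\,\tau(M,\boldsymbol\alpha,\widehat{\mathbf z},\widehat{\mathcal T}),$$ and consequently, if $\sinh\frac{\mathrm H(\gamma_i)}2\ne0$ for all $i$, $$\tau(M',\boldsymbol\alpha',\widehat{\mathbf z}',\widehat{\mathcal T}')=\pm\,\tau(M,\boldsymbol\alpha,\widehat{\mathbf z},\widehat{\mathcal T})\;\frac1{\prod_{i=1}^l4\sinh^2\frac{\mathrm H(\gamma_i)}2}.$$ Here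 each $\tau$ may be computed with any choice of edges and of strong combinatorial flattening as above. -/

import Mathlib

/-! # Oriented ideal triangulations with torus cusps, the 1-loop invariant, and folding of cusps

The vertices of every tetrahedron are labelled by `0, 1, 2, 3`, positively oriented; face `i` is the
face opposite to vertex `i`. -/

/-- Oriented tetrahedra with their faces glued in pairs by orientation-reversing maps: face `i` of
`t` is glued to face `perm t i i` of `adj t i`, a vertex `v ≠ i` of `t` going to the vertex
`perm t i v`. The gluing maps being odd permutations, the orientations fit together. -/
structure Gluing (Tet : Type*) where
  adj : Tet → Fin 4 → Tet
  perm : Tet → Fin 4 → Equiv.Perm (Fin 4)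
  adj_adj : ∀ t i, adj (adj t i) (perm t i i) = t
  perm_perm : ∀ t i, perm (adj t i) (perm t i i) = (perm t i)⁻¹
  odd : ∀ t i, Equiv.Perm.sign (perm t i) = -1
  /-- no face is glued to itself -/
  free : ∀ t i, adj t i = t → perm t i i ≠ i

/-- An oriented edge of a tetrahedron; also: the corner `head` of the small triangle which
truncates the tetrahedron at its vertex `tail`. -/
structure EdgeEnd (Tet : Type*) where
  tet : Tet
  tail : Fin 4
  head : Fin 4
  ne : tail ≠ head

/-- A curve on the triangulated boundary tori as a cyclic sequence of arcs. The `k`-th arc lies in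
the triangle truncating `tet k` at its vertex `flag k 0`. It enters this triangle through the side
lying on face `flag k 3`, leaves it through the side lying on face `flag k 2`, and so cuts off the
corner `flag k 1`. -/
structure CuspPath (Tet : Type*) where
  len : ℕ
  tet : Fin (len + 1) → Tet
  flag : Fin (len + 1) → Equiv.Perm (Fin 4)

/-- The image of a path under a map of tetrahedra. -/
def CuspPath.map {Tet Tet' : Type*} (f : Tet → Tet') (p : CuspPath Tet) : CuspPath Tet' :=
  ⟨p.len, fun k => f (p.tet k), p.flag⟩

/-- The type of an edge of a tetrahedron: `0` for `01, 23`, `1` for `02, 13`, `2` for `03, 12`;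
these edges carry the shape parameters `z`, `1/(1-z)`, `1-1/z` respectively. -/
def quad (a b : Fin 4) : Fin 3 :=
  if ({a, b} : Finset (Fin 4)) = {0, 1} ∨ ({a, b} : Finset (Fin 4)) = {2, 3} then 0
  else if ({a, b} : Finset (Fin 4)) = {0, 2} ∨ ({a, b} : Finset (Fin 4)) = {1, 3} then 1
  else 2

/-- The three shape parameters `z`, `1/(1-z)`, `1-1/z` of an ideal tetrahedron. -/
noncomputable def shape (z : ℂ) : Fin 3 → ℂ := ![z, 1 / (1 - z), 1 - 1 / z]

/-- The ideal vertices `∞, 0, 1, z` of an ideal tetrahedron, in homogeneous coordinates. -/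
noncomputable def idealVertex (z : ℂ) : Fin 4 → (Fin 2 → ℂ) :=
  ![![1, 0], ![0, 1], ![1, 1], ![z, 1]]

namespace CuspPath

variable {Tet : Type*}

open Classical in
/-- The number of corners of type `q` of the tetrahedron `t` on the left of the path minus the
number of those on its right. -/
noncomputable def row (p : CuspPath Tet) (t : Tet) (q : Fin 3) : ℤ :=
  ∑ k, if p.tet k = t ∧ quad (p.flag k 0) (p.flag k 1) = q
    then ((Equiv.Perm.sign (p.flag k) : ℤˣ) : ℤ) else 0

open Classical in
/-- The algebraic number of times that the path leaves the triangle at vertex `v` of `t` through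
its side on face `j`. -/
noncomputable def crossing (p : CuspPath Tet) (t : Tet) (v j : Fin 4) : ℤ :=
  ∑ k, ((if p.tet k = t ∧ p.flag k 0 = v ∧ p.flag k 2 = j then 1 else 0)
    - (if p.tet k = t ∧ p.flag k 0 = v ∧ p.flag k 3 = j then 1 else 0))

/-- Let `x k ∈ (0,1)` be the position, measured from its left endpoint, at which the path crosses
from arc `k` to arc `k + 1`. Then `p.offset x k s` is the distance, along side `s`, of arc `k` from
the corner which it cuts off. -/
noncomputable def offset (p : CuspPath Tet) (x : Fin (p.len + 1) → ℝ) (k : Fin (p.len + 1))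
    (s : Fin 4) : ℝ :=
  if Equiv.Perm.sign (p.flag k) = 1 then (if s = p.flag k 2 then x k else x (k - 1))
  else 1 - (if s = p.flag k 2 then x k else x (k - 1))

/-- The path is embedded: the crossing points can be placed so that arcs in the same triangle,
drawn as straight segments, are disjoint. -/
def IsSimple (p : CuspPath Tet) : Prop :=
  ∃ x : Fin (p.len + 1) → ℝ, (∀ k, 0 < x k ∧ x k < 1) ∧
    ∀ k k', k ≠ k' → p.tet k = p.tet k' → p.flag k 0 = p.flag k' 0 →
      (p.flag k 1 = p.flag k' 1 →
        (∀ s, s ≠ p.flag k 0 → s ≠ p.flag k 1 → p.offset x k s < p.offset x k' s) ∨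
        (∀ s, s ≠ p.flag k 0 → s ≠ p.flag k 1 → p.offset x k' s < p.offset x k s)) ∧
      (p.flag k 1 ≠ p.flag k' 1 →
        ∀ s, s ≠ p.flag k 0 → s ≠ p.flag k 1 → s ≠ p.flag k' 1 →
          p.offset x k s + p.offset x k' s < 1)

/-- The holonomy (derivative of the holonomy around the fixed point at the cusp) of a curve. -/
noncomputable def holonomy [Fintype Tet] (p : CuspPath Tet) (z : Tet → ℂ) : ℂ :=
  ∏ t, ∏ q, shape (z t) q ^ p.row t q

end CuspPath

namespace Gluing

variable {Tet : Type*} (T : Gluing Tet)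

/-- The cusps: classes of vertices of tetrahedra under the face gluings. -/
def Cusp : Type _ :=
  Quot fun x y : Tet × Fin 4 => ∃ i, i ≠ x.2 ∧ y = (T.adj x.1 i, T.perm x.1 i x.2)

/-- The cusp at the vertex `v` of `t`. -/
def cuspOf (t : Tet) (v : Fin 4) : T.Cusp := Quot.mk _ (t, v)

/-- Two oriented edges of tetrahedra are identified by a face gluing. -/
def EndRel (x y : EdgeEnd Tet) : Prop :=
  ∃ i, i ≠ x.tail ∧ i ≠ x.head ∧ y.tet = T.adj x.tet i ∧
    y.tail = T.perm x.tet i x.tail ∧ y.head = T.perm x.tet i x.head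

/-- Oriented edges of the triangulation; equivalently, the vertices of the triangulated
boundary surface. -/
def LinkVertex : Type _ := Quot T.EndRel

def linkVertexOf (x : EdgeEnd Tet) : T.LinkVertex := Quot.mk _ x

/-- The (unoriented) edges of the triangulation. -/
def Edge : Type _ :=
  Quot fun x y : EdgeEnd Tet =>
    T.EndRel x y ∨ (y.tet = x.tet ∧ y.tail = x.head ∧ y.head = x.tail)

def edgeOf (x : EdgeEnd Tet) : T.Edge := Quot.mk _ x

/-- The glued tetrahedra form an ideal triangulation of an oriented 3-manifold all of whose
boundary components are tori: no edge is identified with its own reverse, and the triangulated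
surface at each cusp (which is closed, oriented and connected) has Euler characteristic
`V - (3/2) F + F = 0`. -/
def IsIdealTriangulation : Prop :=
  (∀ x y : EdgeEnd Tet, y.tet = x.tet → y.tail = x.head → y.head = x.tail →
    T.linkVertexOf x ≠ T.linkVertexOf y) ∧
  ∀ c : T.Cusp,
    2 * {d : T.LinkVertex | ∃ x, T.linkVertexOf x = d ∧ T.cuspOf x.tet x.tail = c}.ncard =
      {x : Tet × Fin 4 | T.cuspOf x.1 x.2 = c}.ncard

open Classical in
/-- The number of edges of type `q` of the tetrahedron `t` which are identified to the edge `e`. -/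
noncomputable def edgeRow (e : T.Edge) (t : Tet) (q : Fin 3) : ℤ :=
  ∑ a : Fin 4, ∑ b : Fin 4,
    if h : a < b then (if quad a b = q ∧ T.edgeOf ⟨t, a, b, h.ne⟩ = e then 1 else 0) else 0

/-- The gluing variety: nondegenerate shape parameters which satisfy all the edge equations. -/
def gluingVariety [Fintype Tet] : Set (Tet → ℂ) :=
  {z | (∀ t, z t ≠ 0 ∧ z t ≠ 1) ∧
    ∀ e : T.Edge, ∏ t, ∏ q, shape (z t) q ^ T.edgeRow e t q = 1}

/-- The path closes up: the side through which an arc leaves its triangle is glued to the side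
through which the next arc enters. -/
def IsCurve (p : CuspPath Tet) : Prop :=
  ∀ k, p.tet (k + 1) = T.adj (p.tet k) (p.flag k 2) ∧
    p.flag (k + 1) 0 = T.perm (p.tet k) (p.flag k 2) (p.flag k 0) ∧
    p.flag (k + 1) 3 = T.perm (p.tet k) (p.flag k 2) (p.flag k 2)

/-- The curve lies on the boundary torus at the cusp `c`. -/
def IsOn (p : CuspPath Tet) (c : T.Cusp) : Prop := ∀ k, T.cuspOf (p.tet k) (p.flag k 0) = c

/-- Crossing numbers of an integral combination, with coefficients `n v`, of the counterclockwise
loops around the vertices `v` of the boundary surface: an oriented side is crossed by the loop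
around its left end point positively, by the one around its right end point negatively. -/
def IsBoundary (x : Tet → Fin 4 → Fin 4 → ℤ) : Prop :=
  ∃ n : T.LinkVertex → ℤ, ∀ (t : Tet) (π : Equiv.Perm (Fin 4)), Equiv.Perm.sign π = 1 →
    x t (π 0) (π 2) =
      n (T.linkVertexOf ⟨t, π 0, π 1, π.injective.ne (by decide)⟩)
        - n (T.linkVertexOf ⟨t, π 0, π 3, π.injective.ne (by decide)⟩)

/-- Two curves on the boundary are homologous. -/
def Homologous (p p' : CuspPath Tet) : Prop :=
  T.IsBoundary fun t v j => p.crossing t v j - p'.crossing t v j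

/-- A nontrivial simple closed curve on the boundary torus at the cusp `c`. On a torus, a simple
closed curve is trivial exactly if it is null-homologous. -/
def IsSimpleClosedCurve (p : CuspPath Tet) (c : T.Cusp) : Prop :=
  T.IsCurve p ∧ T.IsOn p c ∧ p.IsSimple ∧ ¬ T.IsBoundary p.crossing

/-- A system of simple closed curves, one on each boundary torus. -/
def IsCurveSystem (α : T.Cusp → CuspPath Tet) : Prop := ∀ c, T.IsSimpleClosedCurve (α c) c

/-- The holonomy representation given by the shape parameters `z` sends the curve `p` to the
identity of `PSL(2, ℂ)`: the ideal tetrahedra met by `p` can be placed in hyperbolic space, the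
`k`-th one as the image under `D k` of the tetrahedron with vertices `∞, 0, 1, z`, such that
consecutive ones share the face crossed by `p`, and such that the placement closes up. -/
def HolonomyTrivial (z : Tet → ℂ) (p : CuspPath Tet) : Prop :=
  ∃ D : Fin (p.len + 1) → GL (Fin 2) ℂ, ∀ k, ∀ j, j ≠ p.flag k 2 → ∃ c : ℂ, c ≠ 0 ∧
    (D k : Matrix (Fin 2) (Fin 2) ℂ).mulVec (idealVertex (z (p.tet k)) j) =
      c • (D (k + 1) : Matrix (Fin 2) (Fin 2) ℂ).mulVec
        (idealVertex (z (p.tet (k + 1))) (T.perm (p.tet k) (p.flag k 2) j))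

/-- The equation of every edge is a consequence of those of the edges in `S`: its exponent vector
is an integral combination of those of the edges in `S` and of the exponent vectors of the
relations `z z' z'' = -1` in the single tetrahedra. -/
def Generates (S : Set T.Edge) : Prop :=
  ∀ e, T.edgeRow e ∈ Submodule.span ℤ
    (T.edgeRow '' S ∪ {x | ∃ t : Tet, ∀ s q, (s = t → x s q = 1) ∧ (s ≠ t → x s q = 0)})

/-- A strong combinatorial flattening. -/
def IsStrongFlattening [Fintype Tet] (f : Tet → Fin 3 → ℤ) : Prop :=
  (∀ t, f t 0 + f t 1 + f t 2 = 1) ∧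
  (∀ e : T.Edge, ∑ t, ∑ q, T.edgeRow e t q * f t q = 2) ∧
  ∀ p c, T.IsSimpleClosedCurve p c → ∑ t, ∑ q, p.row t q * f t q = 0

/-- The rows of the Neumann-Zagier matrices `G, G', G''` (the entries in column `t` being the
values at `t, 0` and `t, 1` and `t, 2`). -/
noncomputable def nzRow (α : T.Cusp → CuspPath Tet) (S : Set T.Edge) :
    S ⊕ T.Cusp → Tet → Fin 3 → ℤ :=
  Sum.elim (fun e => T.edgeRow e.1) (fun c => (α c).row)

/-- The matrix `(G - G') Δ_{z''} + (G'' - G') Δ_z⁻¹`, whose rows are numbered by `r`. -/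
noncomputable def oneLoopMatrix (α : T.Cusp → CuspPath Tet) (z : Tet → ℂ) (S : Set T.Edge)
    (r : Tet ≃ S ⊕ T.Cusp) : Matrix Tet Tet ℂ :=
  Matrix.of fun i t =>
    ((T.nzRow α S (r i) t 0 : ℂ) - T.nzRow α S (r i) t 1) * shape (z t) 2
      + ((T.nzRow α S (r i) t 2 : ℂ) - T.nzRow α S (r i) t 1) * (z t)⁻¹

/-- `τ` is a value of the 1-loop invariant, which is defined up to sign, for some choice of the
independent edges, of the numbering of the rows and of the strong combinatorial flattening. -/
def IsOneLoopInvariant [Fintype Tet] [DecidableEq Tet] (α : T.Cusp → CuspPath Tet) (z : Tet → ℂ)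
    (τ : ℂ) : Prop :=
  ∃ (S : Set T.Edge) (r : Tet ≃ S ⊕ T.Cusp) (f : Tet → Fin 3 → ℤ),
    T.Generates S ∧ T.IsStrongFlattening f ∧
    (τ = 1 / 2 * (T.oneLoopMatrix α z S r).det *
        ∏ t, (shape (z t) 0 ^ f t 2 * shape (z t) 2 ^ (-f t 0)) ∨
     τ = -(1 / 2 * (T.oneLoopMatrix α z S r).det *
        ∏ t, (shape (z t) 0 ^ f t 2 * shape (z t) 2 ^ (-f t 0))))

/-- Cusps `cusp i` which meet exactly two tetrahedra `tet i 0 ≠ tet i 1`, each of them in exactly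
one ideal vertex `apex i a`, together with the choice of an edge `h` of the once-punctured torus
formed by the two faces opposite to these vertices; `opp i a` is the vertex of `tet i a` for which
`h` is the edge opposite to `opp i a` in the face opposite to `apex i a`. -/
structure NiceCusps (l : ℕ) where
  cusp : Fin l → T.Cusp
  cusp_injective : Function.Injective cusp
  tet : Fin l → Fin 2 → Tet
  apex : Fin l → Fin 2 → Fin 4
  opp : Fin l → Fin 2 → Fin 4
  tet_ne : ∀ i, tet i 0 ≠ tet i 1
  meets : ∀ i t v, T.cuspOf t v = cusp i ↔ ∃ a, t = tet i a ∧ v = apex i a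
  opp_ne : ∀ i a, opp i a ≠ apex i a
  /-- the two tetrahedra share the face spanned by `h` and the cusp -/
  opp_adj : ∀ i, T.adj (tet i 0) (opp i 0) = tet i 1
  opp_opp : ∀ i, T.perm (tet i 0) (opp i 0) (opp i 0) = opp i 1

namespace NiceCusps

variable {T} {l : ℕ} (N : T.NiceCusps l)

/-- `N.Cross t i s σ`: after the tetrahedra `N.tet` have been removed and each once-punctured torus
has been folded along its edge `h`, face `i` of the remaining tetrahedron `t` is glued to a face of
the remaining tetrahedron `s`, by `σ`. The fold identifies the two faces opposite to the cusp,
fixing `h` pointwise and identifying the two vertices `opp`; as a map of labels it is the gluing map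
of the common face of the two removed tetrahedra that contains `h`. -/
inductive Cross : Tet → Fin 4 → Tet → Equiv.Perm (Fin 4) → Prop
  | direct (t : Tet) (i : Fin 4) (h : ∀ j a, T.adj t i ≠ N.tet j a) :
      Cross t i (T.adj t i) (T.perm t i)
  | fold (t : Tet) (i : Fin 4) (j : Fin l) (a : Fin 2) (s : Tet) (σ : Equiv.Perm (Fin 4))
      (h : T.adj t i = N.tet j a) (h' : T.perm t i i = N.apex j a)
      (hs : Cross (T.adj (N.tet j a) (N.opp j a))
        (T.perm (N.tet j a) (N.opp j a) (N.apex j a)) s σ) :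
      Cross t i s (σ * T.perm (N.tet j a) (N.opp j a) * T.perm t i)

/-- The curve on the torus at `N.cusp i` that is killed by the folding. The torus consists of two
triangles, with sides `f, g, h`, and the fold along `h` identifies `f` with `g`. The killed curve is
the other diagonal of the parallelogram with diagonal `h`: it meets `h` twice and each of `f` and
`g` once. (A curve on this torus is determined up to homotopy by its algebraic crossing numbers.) -/
def IsMeridian (i : Fin l) (p : CuspPath Tet) : Prop :=
  ∃ ε : ℤ, (ε = 1 ∨ ε = -1) ∧
    p.crossing (N.tet i 0) (N.apex i 0) (N.opp i 0) = 2 * ε ∧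
    ∀ j, j ≠ N.apex i 0 → j ≠ N.opp i 0 → p.crossing (N.tet i 0) (N.apex i 0) j = -ε

/-- The curves `p, p'` on the torus at `N.cusp i` have algebraic intersection number `±1`, computed
from their crossing numbers with two of the three sides. -/
def IntersectOnce (i : Fin l) (p p' : CuspPath Tet) : Prop :=
  ∀ j j', j ≠ j' → j ≠ N.apex i 0 → j' ≠ N.apex i 0 →
    |p.crossing (N.tet i 0) (N.apex i 0) j * p'.crossing (N.tet i 0) (N.apex i 0) j'
      - p.crossing (N.tet i 0) (N.apex i 0) j' * p'.crossing (N.tet i 0) (N.apex i 0) j| = 1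

/-- `T'` is obtained from `T` by removing the tetrahedra at the cusps `N.cusp i` and folding: `emb`
identifies the tetrahedra of `T'` with the remaining ones, and the cusps of `T'` with the unfilled
ones. -/
structure Filling {Tet' : Type*} (T' : Gluing Tet') where
  emb : Tet' → Tet
  emb_injective : Function.Injective emb
  range_emb : ∀ t, (∃ t', emb t' = t) ↔ ∀ i a, t ≠ N.tet i a
  cross : ∀ t i, N.Cross (emb t) i (emb (T'.adj t i)) (T'.perm t i)
  cuspMap : T'.Cusp → T.Cusp
  cuspMap_cuspOf : ∀ t v, cuspMap (T'.cuspOf t v) = T.cuspOf (emb t) v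
  cuspMap_injective : Function.Injective cuspMap
  range_cuspMap : ∀ c, (∃ c', cuspMap c' = c) ↔ ∀ i, c ≠ N.cusp i

/-- The curve `p'` on the boundary of the filled manifold is the curve `p` on the boundary of the
manifold: both are homologous to a curve that is disjoint from the removed tetrahedra. -/
def Filling.SameCurve {N : T.NiceCusps l} {Tet' : Type*} {T' : Gluing Tet'} (F : N.Filling T')
    (p : CuspPath Tet) (p' : CuspPath Tet') : Prop :=
  ∃ β : CuspPath Tet', T'.IsCurve β ∧ T.IsCurve (β.map F.emb) ∧
    T'.Homologous p' β ∧ T.Homologous p (β.map F.emb)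

end NiceCusps

end Gluing

open Equiv

/-! ## Labels of a tetrahedron -/

/-! Signs are disposed of by comparing squares. At a filled cusp the torus consists of two triangles
and so has a single vertex. Therefore the two removed tetrahedra can be labelled so that `0` is the
apex, the edge `23` is `h`, and equally labelled faces `1, 2, 3` are glued to each other
(`exists_isLabelling`). Let `x`, `y` be the shape parameters of the two tetrahedra at `h`.

Geometry of a filled cusp. With the cusp at infinity the meridian develops as a chain of Euclidean
triangles in the plane. Triviality of its holonomy means that the chain closes up, which forces `x y
= 1` (`shape_mul_eq_one`, via `mul_eq_one_of_developing`). Then a curve meeting the meridian once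
has holonomy `-x` or `-1/x`, so `4 sinh²(H/2) = -(1 + x)²/x` (`holonomy_eq`).

Determinants. Up to sign the determinant depends only on the module spanned by the rows of exponents
modulo the relations `z z' z'' = -1`. Replace the rows of the large triangulation by the following
ones: for each filled cusp, an edge function separating the two edges identified by the fold; lifts
of the rows of the filled triangulation; and the meridians. That these generate the same module is
`rowSum_mem`, which rests on the existence of enough edge functions (`coord_bijective`, a dimension
count from the Euler characteristic) and on the edge equations being in involution
(`pairing_rowSum_dual`). On the two columns at a filled cusp all these rows but one are
proportional, so one column operation makes the matrix block triangular. With `g`, `g'` the matrix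
coefficients at the types that follow that of `h` by two, each cusp contributes `g g' (1 + x)²/x` up
to sign (`det_sq_eq`).

Flattenings. The flattening product is independent of the flattening up to sign. The difference of
two flattenings vanishes on embedded cycles of triangles, hence has a potential on the sides of the
boundary triangles. Twice the difference is therefore dual to a combination of edge equations
(`IsSidePotential.exists_rowSum`), and the sign left over in the square is trivial by a parity count
over the faces (`even_sum_rowSum`). Adding the dual of an edge function, a flattening can be made to
vanish on the types of `h` in the removed tetrahedra (`exists_isStrongFlattening`). Its restriction
to the remaining tetrahedra then satisfies the edge conditions of the filled triangulation
(`pairing_edgeRow_emb`). It also vanishes on embedded cycles of triangles, because these can be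
pushed through the removed pairs to simple closed curves without changing the pairing
(`exists_push`).

The two removed tetrahedra contribute a factor to the flattening product which, since `x y = 1`,
cancels `g g'` up to sign (`flattening_sq_eq`). What remains of the quotient of the invariants at
each cusp is `(1 + x)²/x`, which is `4 sinh²(H/2)` up to sign. -/

theorem quad_comm : ∀ a b : Fin 4, quad a b = quad b a := by decide

theorem quad_opposite : ∀ π : Perm (Fin 4), quad (π 2) (π 3) = quad (π 0) (π 1) := by decide

theorem quad_of_even : ∀ π : Perm (Fin 4), Perm.sign π = 1 →
    quad (π 0) (π 2) = quad (π 0) (π 1) + 1 ∧ quad (π 0) (π 3) = quad (π 0) (π 1) + 2 := by decide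

theorem exists_perm_of_ne : ∀ a b c : Fin 4, (a ≠ b ∧ a ≠ c ∧ b ≠ c) →
    ∃ π : Perm (Fin 4), π 0 = a ∧ π 2 = b ∧ π 3 = c := by decide

theorem exists_even_perm : ∀ a b : Fin 4, a ≠ b →
    ∃ π : Perm (Fin 4), Perm.sign π = 1 ∧ π 0 = a ∧ π 1 = b := by decide

theorem even_perm_ext : ∀ π π' : Perm (Fin 4), (Perm.sign π = 1 ∧ Perm.sign π' = 1 ∧ π 0 = π' 0 ∧
    π 1 = π' 1) → π = π' := by decide

/-- The sums over the pairs of opposite edges. -/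
def oppSum {R : Type*} [Add R] (V : Fin 4 → Fin 4 → R) : Fin 3 → R :=
  ![V 0 1 + V 2 3, V 0 2 + V 1 3, V 0 3 + V 1 2]

set_option synthInstance.maxHeartbeats 400000 in
set_option synthInstance.maxSize 1000 in
theorem oppSum_quad_aux : ∀ π : Perm (Fin 4),
    (quad (π 0) (π 1) = 0 ∧ ((π 0, π 1, π 2, π 3) ∈ [((0 : Fin 4), (1 : Fin 4), (2 : Fin 4), (3 : Fin 4)), (0, 1, 3, 2), (1, 0, 2, 3),
      (1, 0, 3, 2), (2, 3, 0, 1), (2, 3, 1, 0), (3, 2, 0, 1), (3, 2, 1, 0)])) ∨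
    (quad (π 0) (π 1) = 1 ∧ ((π 0, π 1, π 2, π 3) ∈ [((0 : Fin 4), (2 : Fin 4), (1 : Fin 4), (3 : Fin 4)), (0, 2, 3, 1), (2, 0, 1, 3),
      (2, 0, 3, 1), (1, 3, 0, 2), (1, 3, 2, 0), (3, 1, 0, 2), (3, 1, 2, 0)])) ∨
    (quad (π 0) (π 1) = 2 ∧ ((π 0, π 1, π 2, π 3) ∈ [((0 : Fin 4), (3 : Fin 4), (1 : Fin 4), (2 : Fin 4)), (0, 3, 2, 1), (3, 0, 1, 2),
      (3, 0, 2, 1), (1, 2, 0, 3), (1, 2, 3, 0), (2, 1, 0, 3), (2, 1, 3, 0)])) := by decide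

theorem oppSum_quad {R : Type*} [AddCommMonoid R] (V : Fin 4 → Fin 4 → R)
    (hV : ∀ a b, V a b = V b a) (π : Perm (Fin 4)) :
    oppSum V (quad (π 0) (π 1)) = V (π 0) (π 1) + V (π 2) (π 3) := by
  have h1 := hV 1 0
  have h2 := hV 2 0
  have h3 := hV 3 0
  have h4 := hV 2 1
  have h5 := hV 3 1
  have h6 := hV 3 2
  rcases oppSum_quad_aux π with ⟨hq, h⟩ | ⟨hq, h⟩ | ⟨hq, h⟩ <;> rw [hq] <;>
    simp only [List.mem_cons, Prod.mk.injEq, List.not_mem_nil, or_false] at h <;>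
    rcases h with ⟨e0, e1, e2, e3⟩ | ⟨e0, e1, e2, e3⟩ | ⟨e0, e1, e2, e3⟩ | ⟨e0, e1, e2, e3⟩ |
      ⟨e0, e1, e2, e3⟩ | ⟨e0, e1, e2, e3⟩ | ⟨e0, e1, e2, e3⟩ | ⟨e0, e1, e2, e3⟩ <;>
    rw [e0, e1, e2, e3] <;> simp [oppSum, h1, h2, h3, h4, h5, h6, add_comm]

/-! ## Gluings -/

namespace Gluing

variable {Tet : Type*} (T : Gluing Tet)

theorem perm_inv_self (t : Tet) (i v : Fin 4) :
    T.perm (T.adj t i) (T.perm t i i) (T.perm t i v) = v := by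
  rw [T.perm_perm]; simp

theorem ne_perm {t : Tet} {i v : Fin 4} (h : v ≠ i) : T.perm t i v ≠ T.perm t i i :=
  (T.perm t i).injective.ne h

instance [Finite Tet] : Finite (EdgeEnd Tet) :=
  Finite.of_injective (fun x : EdgeEnd Tet => (x.tet, x.tail, x.head)) (by
    rintro ⟨t, a, b, h⟩ ⟨t', a', b', h'⟩ he
    simp only [Prod.mk.injEq] at he
    obtain ⟨rfl, rfl, rfl⟩ := he
    rfl)

instance [Finite Tet] : Finite T.Edge := by unfold Edge; infer_instance
instance [Finite Tet] : Finite T.LinkVertex := by unfold LinkVertex; infer_instance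
instance [Finite Tet] : Finite T.Cusp := by unfold Cusp; infer_instance

theorem cuspOf_adj (t : Tet) {i v : Fin 4} (h : i ≠ v) :
    T.cuspOf (T.adj t i) (T.perm t i v) = T.cuspOf t v :=
  (Quot.sound ⟨i, h, rfl⟩).symm

theorem edgeOf_adj (t : Tet) {i a b : Fin 4} (hab : a ≠ b) (ha : i ≠ a) (hb : i ≠ b) :
    T.edgeOf ⟨T.adj t i, T.perm t i a, T.perm t i b, (T.perm t i).injective.ne hab⟩ =
      T.edgeOf ⟨t, a, b, hab⟩ :=
  Eq.symm (Quot.sound (r := fun x y : EdgeEnd Tet =>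
    T.EndRel x y ∨ (y.tet = x.tet ∧ y.tail = x.head ∧ y.head = x.tail))
    (Or.inl ⟨i, ha, hb, rfl, rfl, rfl⟩))

theorem linkVertexOf_adj (t : Tet) {i a b : Fin 4} (hab : a ≠ b) (ha : i ≠ a) (hb : i ≠ b) :
    T.linkVertexOf ⟨T.adj t i, T.perm t i a, T.perm t i b, (T.perm t i).injective.ne hab⟩ =
      T.linkVertexOf ⟨t, a, b, hab⟩ :=
  (Quot.sound ⟨i, ha, hb, rfl, rfl, rfl⟩).symm

theorem edgeOf_swap (t : Tet) {a b : Fin 4} (hab : a ≠ b) :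
    T.edgeOf ⟨t, a, b, hab⟩ = T.edgeOf ⟨t, b, a, hab.symm⟩ :=
  Quot.sound (Or.inr ⟨rfl, rfl, rfl⟩)

/-- The values of a function of the edges on the edges of the tetrahedra. -/
def edgeVal {R : Type*} [Zero R] (c : T.Edge → R) (t : Tet) (a b : Fin 4) : R :=
  if h : a ≠ b then c (T.edgeOf ⟨t, a, b, h⟩) else 0

section edgeVal
variable {R : Type*} [Zero R] (c : T.Edge → R)

theorem edgeVal_of_ne (t : Tet) {a b : Fin 4} (h : a ≠ b) :
    T.edgeVal c t a b = c (T.edgeOf ⟨t, a, b, h⟩) := dif_pos h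

theorem edgeVal_comm (t : Tet) (a b : Fin 4) : T.edgeVal c t a b = T.edgeVal c t b a := by
  by_cases h : a = b
  · rw [h]
  · rw [edgeVal_of_ne _ _ _ h, edgeVal_of_ne _ _ _ (Ne.symm h), edgeOf_swap]

theorem edgeVal_adj (t : Tet) {i a b : Fin 4} (ha : i ≠ a) (hb : i ≠ b) :
    T.edgeVal c (T.adj t i) (T.perm t i a) (T.perm t i b) = T.edgeVal c t a b := by
  by_cases h : a = b
  · subst h; simp [edgeVal]
  · rw [edgeVal_of_ne _ _ _ h, edgeVal_of_ne _ _ _ ((T.perm t i).injective.ne h),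
      edgeOf_adj _ _ h ha hb]

end edgeVal

/-- A function of the edges of the tetrahedra that is compatible with the face gluings is a function
of the edges of the triangulation. -/
theorem exists_edgeVal_eq {R : Type*} [Zero R] (V : Tet → Fin 4 → Fin 4 → R)
    (hs : ∀ t a b, V t a b = V t b a)
    (ha : ∀ t i a b, i ≠ a → i ≠ b → a ≠ b →
      V (T.adj t i) (T.perm t i a) (T.perm t i b) = V t a b) :
    ∃ c : T.Edge → R, ∀ t a b, a ≠ b → T.edgeVal c t a b = V t a b := by
  have h : ∀ x y : EdgeEnd Tet,
      (T.EndRel x y ∨ (y.tet = x.tet ∧ y.tail = x.head ∧ y.head = x.tail)) →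
      V x.tet x.tail x.head = V y.tet y.tail y.head := by
    rintro ⟨t, a, b, h⟩ ⟨t', a', b', h'⟩ (⟨i, hi, hj, e1, e2, e3⟩ | ⟨e1, e2, e3⟩)
    · simp only at *
      subst e1 e2 e3
      exact (ha t i a b hi hj h).symm
    · simp only at *
      subst e1 e2 e3
      exact hs _ _ _
  let c : T.Edge → R := Quot.lift (fun x => V x.tet x.tail x.head) h
  exact ⟨c, fun t a b h => T.edgeVal_of_ne c t h⟩

theorem edge_induction {P : T.Edge → Prop} (h : ∀ t a b (hab : a ≠ b), P (T.edgeOf ⟨t, a, b, hab⟩)) :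
    ∀ e, P e := by
  intro e
  induction e using Quot.ind with
  | mk x => exact h x.tet x.tail x.head x.ne

/-- The exponents of the product of the edge equations with exponents `c`. -/
def rowSum {R : Type*} [AddCommMonoid R] (c : T.Edge → R) (t : Tet) : Fin 3 → R :=
  oppSum (T.edgeVal c t)

theorem rowSum_quad {R : Type*} [AddCommMonoid R] (c : T.Edge → R) (t : Tet) (π : Perm (Fin 4)) :
    T.rowSum c t (quad (π 0) (π 1)) = T.edgeVal c t (π 0) (π 1) + T.edgeVal c t (π 2) (π 3) :=
  oppSum_quad _ (T.edgeVal_comm c t) π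

/-- The edge rows are the images of the indicator functions under a linear map. All later arguments
about edge equations are therefore phrased for arbitrary functions of the edges. -/
theorem edgeRow_eq [DecidableEq T.Edge] (e : T.Edge) (t : Tet) (q : Fin 3) :
    T.edgeRow e t q = T.rowSum (Pi.single e (1 : ℤ)) t q := by
  have key : ∀ a b : Fin 4, ∀ h : a < b, (if quad a b = q ∧ T.edgeOf ⟨t, a, b, h.ne⟩ = e then (1:ℤ) else 0)
      = if quad a b = q then T.edgeVal (Pi.single e (1 : ℤ)) t a b else 0 := by
    intro a b h
    rw [edgeVal_of_ne _ _ _ h.ne, Pi.single_apply]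
    by_cases h1 : quad a b = q <;> simp [h1]
  unfold edgeRow rowSum oppSum
  have : ∀ a b : Fin 4, (if h : a < b then (if quad a b = q ∧ T.edgeOf ⟨t, a, b, h.ne⟩ = e then (1:ℤ) else 0) else 0)
      = if a < b ∧ quad a b = q then T.edgeVal (Pi.single e (1 : ℤ)) t a b else 0 := by
    intro a b
    by_cases h : a < b
    · rw [dif_pos h, key a b h]; simp [h]
    · simp [h]
  trans ∑ a : Fin 4, ∑ b : Fin 4, if a < b ∧ quad a b = q then T.edgeVal (Pi.single e (1 : ℤ)) t a b else 0
  · refine Finset.sum_congr rfl fun a _ => Finset.sum_congr rfl fun b _ => ?_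
    rw [← this a b]
    by_cases h : a < b
    · rw [dif_pos h, dif_pos h]; congr
    · rw [dif_neg h, dif_neg h]
  · have e1 : quad 0 1 = 0 := by decide
    have e2 : quad 0 2 = 1 := by decide
    have e3 : quad 0 3 = 2 := by decide
    have e4 : quad 1 2 = 2 := by decide
    have e5 : quad 1 3 = 1 := by decide
    have e6 : quad 2 3 = 0 := by decide
    fin_cases q <;> simp [Fin.sum_univ_four, e1, e2, e3, e4, e5, e6]

theorem rowSum_add {R : Type*} [AddCommMonoid R] (c c' : T.Edge → R) :
    T.rowSum (c + c') = T.rowSum c + T.rowSum c' := by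
  have : ∀ t a b, T.edgeVal (c + c') t a b = T.edgeVal c t a b + T.edgeVal c' t a b := by
    intro t a b; unfold edgeVal; split <;> simp
  funext t q
  fin_cases q <;> simp [rowSum, oppSum, this] <;> abel

theorem rowSum_smul {R : Type*} [Ring R] (k : R) (c : T.Edge → R) :
    T.rowSum (k • c) = k • T.rowSum c := by
  have : ∀ t a b, T.edgeVal (k • c) t a b = k * T.edgeVal c t a b := by
    intro t a b; unfold edgeVal; split <;> simp
  funext t q
  fin_cases q <;> simp [rowSum, oppSum, this, mul_add]

/-- `rowSum` as a linear map. -/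
def rowSumHom : (T.Edge → ℤ) →ₗ[ℤ] (Tet → Fin 3 → ℤ) where
  toFun := T.rowSum
  map_add' := T.rowSum_add
  map_smul' := T.rowSum_smul

theorem rowSum_eq_sum [Fintype T.Edge] (c : T.Edge → ℤ) :
    T.rowSum c = ∑ e, c e • T.edgeRow e := by
  classical
  have h : ∀ e, T.edgeRow e = T.rowSumHom (Pi.single e 1) := fun e => by
    funext t q; exact T.edgeRow_eq e t q
  simp only [h, ← map_smul, ← map_sum]
  change T.rowSum c = T.rowSum _
  congr 1
  funext e
  simp [Finset.sum_apply, Pi.single_apply]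

theorem shape_ne_zero {z : ℂ} (h0 : z ≠ 0) (h1 : z ≠ 1) (q : Fin 3) : shape z q ≠ 0 := by
  have : 1 - z ≠ 0 := sub_ne_zero.2 h1.symm
  fin_cases q
  · simpa [shape]
  · simpa [shape]
  · have : 1 - z⁻¹ ≠ 0 := fun h => h1 (by field_simp at h; linear_combination h)
    simpa [shape]

theorem shape_prod {z : ℂ} (h0 : z ≠ 0) (h1 : z ≠ 1) : shape z 0 * shape z 1 * shape z 2 = -1 := by
  have : 1 - z ≠ 0 := sub_ne_zero.2 h1.symm
  simp [shape]; field_simp; ring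

theorem prod_rowSum [Fintype Tet] [Finite T.Edge] {z : Tet → ℂ} (hz : z ∈ T.gluingVariety) (c : T.Edge → ℤ) :
    ∏ t, ∏ q, shape (z t) q ^ T.rowSum c t q = 1 := by
  classical
  have := Fintype.ofFinite T.Edge
  rw [rowSum_eq_sum]
  simp only [Finset.sum_apply, Pi.smul_apply, smul_eq_mul]
  have h : ∀ t q, shape (z t) q ^ (∑ e, c e * T.edgeRow e t q) =
      ∏ e, (shape (z t) q ^ T.edgeRow e t q) ^ c e := by
    intro t q
    have h0 := shape_ne_zero (hz.1 t).1 (hz.1 t).2 q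
    induction (Finset.univ : Finset T.Edge) using Finset.induction_on with
    | empty => simp
    | insert a s ha ih =>
      rw [Finset.sum_insert ha, Finset.prod_insert ha, zpow_add₀ h0, ih, mul_comm (c a), zpow_mul]
  simp only [h]
  rw [Finset.prod_congr rfl fun t _ => Finset.prod_comm, Finset.prod_comm]
  refine Finset.prod_eq_one fun e _ => ?_
  simp only [Finset.prod_zpow, hz.2 e, one_zpow]

end Gluing

/-! ## Corners of paths -/

/-- The pairing of a family of exponents with a family of weights of the edges of the tetrahedra. -/
def pairing {Tet : Type*} [Fintype Tet] (x w : Tet → Fin 3 → ℤ) : ℤ := ∑ t, ∑ q, x t q * w t q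

section pairing
variable {Tet : Type*} [Fintype Tet] (x x' w w' : Tet → Fin 3 → ℤ)

theorem pairing_add_left : pairing (x + x') w = pairing x w + pairing x' w := by
  simp [pairing, add_mul, Finset.sum_add_distrib]

theorem pairing_add_right : pairing x (w + w') = pairing x w + pairing x w' := by
  simp [pairing, mul_add, Finset.sum_add_distrib]

theorem pairing_sub_right : pairing x (w - w') = pairing x w - pairing x w' := by
  simp [pairing, mul_sub, Finset.sum_sub_distrib]

theorem pairing_const (u : Tet → ℤ) :
    pairing (fun t _ => u t) w = ∑ t, u t * (w t 0 + w t 1 + w t 2) := by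
  simp [pairing, Fin.sum_univ_three, mul_add]

theorem pairing_sum_left {ι : Type*} (s : Finset ι) (c : ι → ℤ) (x : ι → Tet → Fin 3 → ℤ) :
    pairing (∑ i ∈ s, c i • x i) w = ∑ i ∈ s, c i * pairing (x i) w := by
  simp only [pairing, Finset.sum_apply, Pi.smul_apply, smul_eq_mul, Finset.sum_mul, Finset.mul_sum]
  rw [Finset.sum_congr rfl fun t _ => Finset.sum_comm, Finset.sum_comm]
  simp only [mul_assoc]

end pairing

namespace CuspPath
variable {Tet : Type*} (p : CuspPath Tet)

theorem flag_ne (k : Fin (p.len + 1)) {i j : Fin 4} (h : i ≠ j) : p.flag k i ≠ p.flag k j :=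
  (p.flag k).injective.ne h

theorem pairing_row [Fintype Tet] (w : Tet → Fin 3 → ℤ) :
    pairing p.row w = ∑ k, ((Perm.sign (p.flag k) : ℤˣ) : ℤ) *
      w (p.tet k) (quad (p.flag k 0) (p.flag k 1)) := by
  classical
  unfold pairing row
  simp only [Finset.sum_mul]
  rw [Finset.sum_congr rfl fun t _ => Finset.sum_comm, Finset.sum_comm]
  refine Finset.sum_congr rfl fun k _ => ?_
  rw [Finset.sum_eq_single (p.tet k) _ (by simp), Finset.sum_eq_single (quad (p.flag k 0) (p.flag k 1)) _ (by simp)]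
  · simp
  · intro q _ hq; simp [hq.symm]
  · intro t _ ht; simp [ht.symm]

open Classical in
/-- The number of times that the path cuts off the corner towards `a` of the triangle at vertex `v`
of `t`, leaving it on its left, minus the number of times that it leaves it on its right. -/
noncomputable def corner (t : Tet) (v a : Fin 4) : ℤ :=
  ∑ k, if p.tet k = t ∧ p.flag k 0 = v ∧ p.flag k 1 = a
    then ((Perm.sign (p.flag k) : ℤˣ) : ℤ) else 0

theorem corner_self (t : Tet) (v : Fin 4) : p.corner t v v = 0 := by
  refine Finset.sum_eq_zero fun k _ => if_neg ?_
  rintro ⟨-, h, h'⟩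
  exact p.flag_ne k (show (0 : Fin 4) ≠ 1 by decide) (h.trans h'.symm)

theorem oppSum_ite : ∀ (q : Fin 3) (π : Perm (Fin 4)) , (if quad (π 0) (π 1) = q then (1 : ℤ) else 0) =
    oppSum (fun a b => (if π 0 = a ∧ π 1 = b then (1:ℤ) else 0) + if π 0 = b ∧ π 1 = a then 1 else 0) q := by
  decide

theorem oppSum_sum {R ι : Type*} [AddCommMonoid R] (s : Finset ι) (V : ι → Fin 4 → Fin 4 → R)
    (q : Fin 3) : oppSum (fun a b => ∑ i ∈ s, V i a b) q = ∑ i ∈ s, oppSum (V i) q := by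
  fin_cases q <;> simp [oppSum, Finset.sum_add_distrib]

theorem row_eq (t : Tet) (q : Fin 3) :
    p.row t q = oppSum (fun a b => p.corner t a b + p.corner t b a) q := by
  classical
  unfold row corner
  simp only [← Finset.sum_add_distrib]
  rw [oppSum_sum]
  refine Finset.sum_congr rfl fun k _ => ?_
  by_cases h : p.tet k = t
  · have := congrArg (((Perm.sign (p.flag k) : ℤˣ) : ℤ) * ·) (oppSum_ite q (p.flag k))
    simp only [h, true_and]
    simp only [mul_ite, mul_one, mul_zero] at this
    rw [this]
    fin_cases q <;> simp [oppSum, mul_add]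
  · have h0 : oppSum (fun _ _ : Fin 4 => (0:ℤ)) q = 0 := by fin_cases q <;> simp [oppSum]
    simp [h, h0]

theorem crossing_aux : ∀ φ : Perm (Fin 4),
    ((if φ 0 = 0 ∧ φ 2 = 2 then (1:ℤ) else 0) - if φ 0 = 0 ∧ φ 3 = 2 then 1 else 0) =
    ((if φ 0 = 0 ∧ φ 1 = 1 then ((Perm.sign φ : ℤˣ) : ℤ) else 0) -
      if φ 0 = 0 ∧ φ 1 = 3 then ((Perm.sign φ : ℤˣ) : ℤ) else 0) := by decide

theorem crossing_eq (t : Tet) {π : Perm (Fin 4)} (hπ : Perm.sign π = 1) :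
    p.crossing t (π 0) (π 2) = p.corner t (π 0) (π 1) - p.corner t (π 0) (π 3) := by
  classical
  unfold crossing corner
  rw [← Finset.sum_sub_distrib]
  refine Finset.sum_congr rfl fun k _ => ?_
  by_cases h : p.tet k = t
  · have h1 := crossing_aux (π⁻¹ * p.flag k)
    have e : ∀ i j, (π⁻¹ * p.flag k) i = j ↔ p.flag k i = π j := fun i j => by
      rw [Perm.mul_apply, Perm.inv_eq_iff_eq]
    have e' : Perm.sign (π⁻¹ * p.flag k) = Perm.sign (p.flag k) := by simp [hπ]
    simp only [e, e'] at h1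
    simpa [h] using h1
  · simp [h]

end CuspPath

/-! ### Null-homologous curves, homology and closed weights -/

namespace Gluing
variable {Tet : Type*} (T : Gluing Tet)

theorem exists_even_of_ne : ∀ v a b : Fin 4, (v ≠ a ∧ v ≠ b ∧ a ≠ b) → ∃ π : Perm (Fin 4),
    Perm.sign π = 1 ∧ π 0 = v ∧ ((π 1 = a ∧ π 3 = b) ∨ (π 1 = b ∧ π 3 = a)) := by decide

theorem succ_ne_self' : ∀ v : Fin 4, v ≠ v + 1 := by decide

/-- Corner numbers whose crossing numbers are those of a boundary are given by an integral
combination of the edge rows and of the relations `z z' z'' = -1`. -/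
theorem exists_rowSum_of_isBoundary (κ : Tet → Fin 4 → Fin 4 → ℤ) (x : Tet → Fin 4 → Fin 4 → ℤ)
    (hx : ∀ t (π : Perm (Fin 4)), Perm.sign π = 1 → x t (π 0) (π 2) = κ t (π 0) (π 1) - κ t (π 0) (π 3))
    (h : T.IsBoundary x) :
    ∃ (c : T.Edge → ℤ) (u : Tet → ℤ), ∀ t q,
      oppSum (fun a b => κ t a b + κ t b a) q = T.rowSum c t q + u t := by
  obtain ⟨n, hn⟩ := h
  let N : Tet → Fin 4 → Fin 4 → ℤ := fun t a b =>
    if h : a ≠ b then n (T.linkVertexOf ⟨t, a, b, h⟩) else 0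
  have hN : ∀ t a b (h : a ≠ b), N t a b = n (T.linkVertexOf ⟨t, a, b, h⟩) := fun t a b h => dif_pos h
  obtain ⟨c, hc⟩ := T.exists_edgeVal_eq (fun t a b => N t a b + N t b a) (fun t a b => add_comm _ _) (by
    intro t i a b ha hb hab
    rw [hN _ _ _ ((T.perm t i).injective.ne hab), hN _ _ _ ((T.perm t i).injective.ne hab.symm),
      hN _ _ _ hab, hN _ _ _ hab.symm, linkVertexOf_adj _ _ hab ha hb, linkVertexOf_adj _ _ hab.symm hb ha])
  -- The crossing numbers determine corner numbers only up to a constant in each triangle. The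
  -- constants of the four triangles of a tetrahedron add up to the same amount for each edge type.
  have key : ∀ t v a b, v ≠ a → v ≠ b → κ t v a - N t v a = κ t v b - N t v b := by
    intro t v a b ha hb
    by_cases hab : a = b
    · rw [hab]
    obtain ⟨π, hπ, rfl, ⟨rfl, rfl⟩ | ⟨rfl, rfl⟩⟩ := exists_even_of_ne v a b ⟨ha, hb, hab⟩
    · have h1 := hx t π hπ
      rw [hn t π hπ, ← hN, ← hN] at h1
      linarith
    · have h1 := hx t π hπ
      rw [hn t π hπ, ← hN, ← hN] at h1
      linarith
  -- The label `v + 1`, taken modulo 4, is merely some corner of the triangle at `v`.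
  refine ⟨c, fun t => ∑ v, (κ t v (v + 1) - N t v (v + 1)), fun t q => ?_⟩
  have h' : ∀ a b, a ≠ b → κ t a b + κ t b a = T.edgeVal c t a b +
      (κ t a (a + 1) - N t a (a + 1)) + (κ t b (b + 1) - N t b (b + 1)) := by
    intro a b hab
    have h1 := key t a b (a + 1) hab (succ_ne_self' a)
    have h2 := key t b a (b + 1) hab.symm (succ_ne_self' b)
    rw [hc t a b hab]
    linarith
  simp only [Fin.sum_univ_four]
  fin_cases q
  · simp only [rowSum, oppSum, Fin.zero_eta, Matrix.cons_val_zero, h' 0 1 (by decide), h' 2 3 (by decide)]; ring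
  · simp only [rowSum, oppSum, Fin.mk_one, Matrix.cons_val_one, Matrix.cons_val_zero, h' 0 2 (by decide), h' 1 3 (by decide)]; ring
  · simp only [rowSum, oppSum, Fin.reduceFinMk, Matrix.cons_val, h' 0 3 (by decide), h' 1 2 (by decide)]; ring

theorem exists_row_eq_of_isBoundary {p : CuspPath Tet} (h : T.IsBoundary p.crossing) :
    ∃ (c : T.Edge → ℤ) (u : Tet → ℤ), ∀ t q, p.row t q = T.rowSum c t q + u t := by
  obtain ⟨c, u, h⟩ := T.exists_rowSum_of_isBoundary p.corner p.crossing
    (fun t π hπ => p.crossing_eq t hπ) h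
  exact ⟨c, u, fun t q => by rw [p.row_eq, h]⟩

theorem Homologous.exists_row_eq {T : Gluing Tet} {p p' : CuspPath Tet} (h : T.Homologous p p') :
    ∃ (c : T.Edge → ℤ) (u : Tet → ℤ), ∀ t q, p.row t q = p'.row t q + T.rowSum c t q + u t := by
  obtain ⟨c, u, h⟩ := T.exists_rowSum_of_isBoundary (fun t a b => p.corner t a b - p'.corner t a b)
    (fun t v j => p.crossing t v j - p'.crossing t v j)
    (fun t π hπ => by rw [p.crossing_eq t hπ, p'.crossing_eq t hπ]; ring) h
  refine ⟨c, u, fun t q => ?_⟩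
  have h' : oppSum (fun a b => p.corner t a b - p'.corner t a b + (p.corner t b a - p'.corner t b a)) q
      = p.row t q - p'.row t q := by
    rw [p.row_eq, p'.row_eq]
    fin_cases q <;> simp [oppSum] <;> ring
  rw [h t q] at h'
  linarith

/-- Weights of the edges of the tetrahedra which sum up to `0` in every triangle and around every
edge: the differences of two combinatorial flattenings. -/
def IsClosedWeight [Fintype Tet] (w : Tet → Fin 3 → ℤ) : Prop :=
  (∀ t, w t 0 + w t 1 + w t 2 = 0) ∧ ∀ e, pairing (T.edgeRow e) w = 0

variable {T}

theorem pairing_rowSum [Fintype Tet] [Fintype T.Edge] (c : T.Edge → ℤ) (w : Tet → Fin 3 → ℤ) :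
    pairing (T.rowSum c) w = ∑ e, c e * pairing (T.edgeRow e) w := by
  rw [rowSum_eq_sum, pairing_sum_left]

theorem IsClosedWeight.pairing_rowSum_eq_zero [Fintype Tet] {w : Tet → Fin 3 → ℤ}
    (hw : T.IsClosedWeight w) (c : T.Edge → ℤ) : pairing (T.rowSum c) w = 0 := by
  have := Fintype.ofFinite T.Edge
  rw [pairing_rowSum]
  exact Finset.sum_eq_zero fun e _ => by rw [hw.2 e, mul_zero]

/-- The row of a null-homologous curve is a combination of edge rows and of rows constant on
tetrahedra, and a closed weight kills both kinds. -/
theorem IsClosedWeight.pairing_eq_zero [Fintype Tet] {w : Tet → Fin 3 → ℤ}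
    (hw : T.IsClosedWeight w) {p : CuspPath Tet} (h : T.IsBoundary p.crossing) :
    pairing p.row w = 0 := by
  obtain ⟨c, u, h⟩ := T.exists_row_eq_of_isBoundary h
  have : p.row = T.rowSum c + fun t _ => u t := by funext t q; exact h t q
  rw [this, pairing_add_left, hw.pairing_rowSum_eq_zero, pairing_const]
  simp [hw.1]

end Gluing

/-! ## Potentials on graphs -/

section Graph
variable {V D : Type*} (src tgt : D → V) (rev : D → D) (w : D → ℤ)

/-- There is a walk from `a` to `b` along which the function `w` of the darts sums up to `s`. -/
inductive WalkSum : V → V → ℤ → Prop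
  | nil (a : V) : WalkSum a a 0
  | snoc {a : V} {s : ℤ} (d : D) (h : WalkSum a (src d) s) : WalkSum a (tgt d) (s + w d)

variable {src tgt rev w}

theorem WalkSum.trans {a b c : V} {s r : ℤ} (h : WalkSum src tgt w a b s)
    (h' : WalkSum src tgt w b c r) : WalkSum src tgt w a c (s + r) := by
  induction h' with
  | nil => simpa
  | snoc d _ ih => rw [← add_assoc]; exact ih.snoc d

theorem WalkSum.symm (h1 : ∀ d, src (rev d) = tgt d) (h2 : ∀ d, tgt (rev d) = src d)
    (h3 : ∀ d, w (rev d) = -w d) {a b : V} {s : ℤ} (h : WalkSum src tgt w a b s) :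
    WalkSum src tgt w b a (-s) := by
  induction h with
  | nil => simpa using WalkSum.nil _
  | @snoc s d _ ih =>
    have : WalkSum src tgt w (tgt d) (src d) (-w d) := by
      have := (WalkSum.nil (src := src) (tgt := tgt) (w := w) (src (rev d))).snoc (rev d)
      rw [h1, h2, h3, zero_add] at this
      exact this
    convert this.trans ih using 1
    ring

theorem WalkSum.exists_seq [Nonempty D] {a b : V} {s : ℤ} (h : WalkSum src tgt w a b s) :
    ∃ (m : ℕ) (v : ℕ → V) (e : ℕ → D), v 0 = a ∧ v m = b ∧
      (∀ k < m, src (e k) = v k ∧ tgt (e k) = v (k + 1)) ∧ s = ∑ k ∈ Finset.range m, w (e k) := by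
  induction h with
  | nil => exact ⟨0, fun _ => a, fun _ => Classical.arbitrary D, rfl, rfl, by simp, by simp⟩
  | @snoc s d _ ih =>
    obtain ⟨m, v, e, h0, hm, h, rfl⟩ := ih
    refine ⟨m + 1, fun k => if k ≤ m then v k else tgt d, fun k => if k < m then e k else d, by simp [h0],
      by simp, ?_, ?_⟩
    · intro k hk
      by_cases hkm : k < m
      · simp [hkm, hkm.le, h k hkm, Nat.succ_le_of_lt hkm]
      · obtain rfl : k = m := by omega
        simp [hm]
    · rw [Finset.sum_range_succ]
      simp only [lt_irrefl, if_false]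
      congr 1
      exact Finset.sum_congr rfl fun k hk => by rw [if_pos (Finset.mem_range.1 hk)]

/-- A cyclic sequence in which two steps lead back to the start has length one or two; the only two
summands cancel, or the single one is its own negative. -/
theorem sum_eq_zero_of_add_two_eq : ∀ (n : ℕ) (f : Fin (n + 1) → ℤ) (k : Fin (n + 1)),
    k + 1 + 1 = k → f (k + 1) = -f k → ∑ k, f k = 0
  | 0, f, k, _, hf => by
    have : k + 1 = k := Subsingleton.elim (α := Fin 1) _ _
    rw [this] at hf
    have h0 : k = 0 := Subsingleton.elim (α := Fin 1) _ _
    rw [h0] at hf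
    have h1 : f 0 = 0 := self_eq_neg.1 hf
    have h2 : ∑ k, f k = f 0 := Fin.sum_univ_one f
    rw [h2, h1]
  | 1, f, k, _, hf => by
    have h2 : ∀ k : Fin 2, (k = 0 ∧ k + 1 = 1) ∨ (k = 1 ∧ k + 1 = 0) := by decide
    rw [Fin.sum_univ_two]
    rcases h2 k with ⟨h, h'⟩ | ⟨h, h'⟩
    · have := hf
      rw [show k + 1 = (1 : Fin 2) from h', show k = (0 : Fin 2) from h] at this
      rw [this]; ring
    · have := hf
      rw [show k + 1 = (0 : Fin 2) from h', show k = (1 : Fin 2) from h] at this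
      rw [this]; ring
  | n + 2, f, k, h, _ => by
    exfalso
    have h := congrArg Fin.val (left_eq_add.1 ((add_assoc k 1 1).symm.trans h).symm)
    simp only [Fin.val_add, Fin.val_one', Fin.val_zero, Nat.add_mod_mod, Nat.mod_add_mod] at h
    rw [Nat.mod_eq_of_lt (by omega)] at h
    omega

/-- Cutting a closed walk at a repeated vertex splits it into two shorter closed walks, so only
walks without repeated vertices matter. Those with a backtracking step have length at most two and
contribute zero. -/
theorem sum_closed_walk_eq_zero (h3 : ∀ d, w (rev d) = -w d) (h2 : ∀ d, tgt (rev d) = src d)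
    (H : ∀ (n : ℕ) (d : Fin (n + 1) → D), (∀ k, tgt (d k) = src (d (k + 1))) →
      Function.Injective (fun k => src (d k)) → (∀ k, d (k + 1) ≠ rev (d k)) → ∑ k, w (d k) = 0)
    (m : ℕ) : ∀ (v : ℕ → V) (e : ℕ → D), v m = v 0 →
      (∀ k < m, src (e k) = v k ∧ tgt (e k) = v (k + 1)) → ∑ k ∈ Finset.range m, w (e k) = 0 := by
  induction m using Nat.strong_induction_on with
  | _ m ih =>
  intro v e hv he
  -- The walk is split into the loop between the times `i` and `j` and the walk that skips this
  -- loop.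
  by_cases hinj : ∃ i j, i < j ∧ j < m ∧ v i = v j
  · obtain ⟨i, j, hij, hj, hvij⟩ := hinj
    obtain ⟨r, rfl⟩ : ∃ r, j = i + r := ⟨j - i, by omega⟩
    obtain ⟨s, rfl⟩ : ∃ s, m = i + r + s := ⟨m - (i + r), by omega⟩
    have h1 := ih r (by omega) (fun k => v (i + k)) (fun k => e (i + k)) (by simp [hvij])
      (fun k hk => by simpa [add_assoc] using he (i + k) (by omega))
    have h2 := ih (i + s) (by omega) (fun k => if k ≤ i then v k else v (k + r))
      (fun k => if k < i then e k else e (k + r)) (by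
        by_cases hs : s = 0
        · omega
        · simp only [if_neg (show ¬ (i + s ≤ i) by omega), Nat.zero_le, if_true]
          rw [← hv]; congr 1; omega) (by
        intro k hk
        by_cases hki : k < i
        · simpa [hki, hki.le, Nat.succ_le_of_lt hki] using he k (by omega)
        · by_cases hki' : k = i
          · subst hki'
            have := he (k + r) (by omega)
            simp only [lt_irrefl, if_false, le_refl, if_true, if_neg (show ¬ (k + 1 ≤ k) by omega)]
            rw [hvij, this.1, this.2]
            exact ⟨rfl, by congr 1; omega⟩
          · have := he (k + r) (by omega)
            simp only [if_neg hki, if_neg (show ¬ (k ≤ i) by omega), if_neg (show ¬ (k + 1 ≤ i) by omega)]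
            rw [this.1, this.2]
            exact ⟨rfl, by congr 1; omega⟩)
    rw [Finset.sum_range_add] at h2 ⊢
    rw [Finset.sum_range_add, h1, add_zero]
    rw [Finset.sum_congr rfl fun k hk => by rw [if_pos (Finset.mem_range.1 hk)]] at h2
    rw [← h2]
    congr 1
    refine Finset.sum_congr rfl fun k _ => ?_
    rw [if_neg (by omega)]
    congr 2; omega
  · cases m with
    | zero => simp
    | succ n =>
      push Not at hinj
      have hval : ∀ k : Fin (n + 1), v ((k + 1 : Fin (n + 1)) : ℕ) = v ((k : ℕ) + 1) := by
        intro k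
        rw [Fin.val_add_one]
        split_ifs with hk
        · rw [hk, Fin.val_last, hv]
        · rfl
      have hsrc : ∀ k : Fin (n + 1), src (e k) = v k := fun k => (he k k.2).1
      have hi : Function.Injective fun k : Fin (n + 1) => src (e k) := by
        intro i j hij
        simp only [hsrc] at hij
        rcases lt_trichotomy i j with h | h | h
        · exact absurd hij (hinj i j h j.2)
        · exact h
        · exact absurd hij.symm (hinj j i h i.2)
      have hcl : ∀ k : Fin (n + 1), tgt (e k) = src (e (k + 1 : Fin (n + 1))) := by
        intro k; rw [(he k k.2).2, hsrc, hval]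
      by_cases hb : ∀ k : Fin (n + 1), e (k + 1 : Fin (n + 1)) ≠ rev (e k)
      · have := H n (fun k => e k) hcl hi hb
        rwa [Fin.sum_univ_eq_sum_range (fun k => w (e k))] at this
      · push Not at hb
        obtain ⟨k, hk⟩ := hb
        have h4 : (k + 1 + 1 : Fin (n + 1)) = k := by
          apply hi
          simp only
          rw [← hcl, hk, h2]
        rw [← Fin.sum_univ_eq_sum_range (fun k => w (e k))]
        have hw : w (e (k + 1 : Fin (n + 1))) = - w (e k) := by rw [hk, h3]
        exact sum_eq_zero_of_add_two_eq n (fun k => w (e k)) k h4 hw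

/-- The potential at a vertex is the sum along any walk from a base point of its component; the
choice of the walk does not matter because closed walks sum up to zero. -/
theorem exists_potential (h0 : ∀ d, src (rev d) = tgt d) (h2 : ∀ d, tgt (rev d) = src d)
    (h3 : ∀ d, w (rev d) = -w d)
    (H : ∀ (n : ℕ) (d : Fin (n + 1) → D), (∀ k, tgt (d k) = src (d (k + 1))) →
      Function.Injective (fun k => src (d k)) → (∀ k, d (k + 1) ≠ rev (d k)) → ∑ k, w (d k) = 0) :
    ∃ X : V → ℤ, ∀ d, X (tgt d) = X (src d) + w d := by
  by_cases hD : Nonempty D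
  swap
  · exact ⟨0, fun d => (hD ⟨d⟩).elim⟩
  have hcl : ∀ a s, WalkSum src tgt w a a s → s = 0 := by
    intro a s h
    obtain ⟨m, v, e, ha, hm, he, rfl⟩ := WalkSum.exists_seq h
    exact sum_closed_walk_eq_zero h3 h2 H m v e (hm.trans ha.symm) he
  let S : Setoid V :=
    { r := fun a b => ∃ s, WalkSum src tgt w a b s
      iseqv :=
        { refl := fun a => Exists.intro 0 (.nil a)
          symm := by
            intro a b h
            obtain ⟨s, h⟩ := h
            exact ⟨-s, h.symm h0 h2 h3⟩
          trans := by
            intro a b c h h'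
            obtain ⟨s, h⟩ := h
            obtain ⟨r, h'⟩ := h'
            exact ⟨s + r, h.trans h'⟩ } }
  have hroot : ∀ b : V, ∃ s, WalkSum src tgt w (Quotient.mk S b).out b s := fun b =>
    Quotient.exact (Quotient.out_eq (Quotient.mk S b))
  choose X hX using hroot
  refine ⟨X, fun d => ?_⟩
  have e : Quotient.mk S (tgt d) = Quotient.mk S (src d) :=
    (Quotient.sound (s := S) (Exists.intro _ ((WalkSum.nil (src d)).snoc d))).symm
  have h := (hX (src d)).snoc d
  have h' := hX (tgt d)
  rw [e] at h'
  have := hcl _ _ (h.trans (h'.symm h0 h2 h3))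
  omega

end Graph

theorem Fin.cyclic_induction {n : ℕ} {P : Fin (n + 1) → Prop} (h0 : P 0) (h : ∀ k, P k → P (k + 1)) :
    ∀ k, P k := by
  intro k
  induction k using Fin.induction with
  | zero => exact h0
  | succ i ih => rw [← Fin.coeSucc_eq_succ]; exact h _ ih

theorem Fin.sum_comp_add_one {n : ℕ} {R : Type*} [AddCommMonoid R] (f : Fin (n + 1) → R) :
    ∑ k, f (k + 1) = ∑ k, f k :=
  Equiv.sum_comp (Equiv.addRight (1 : Fin (n + 1))) f

/-! ### Potentials on the sides of the boundary triangles -/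

namespace Gluing
variable {Tet : Type*} {T : Gluing Tet}

theorem IsCurve.isOn {p : CuspPath Tet} (hp : T.IsCurve p) : T.IsOn p (T.cuspOf (p.tet 0) (p.flag 0 0)) := by
  intro k
  induction k using Fin.cyclic_induction with
  | h0 => rfl
  | h k ih =>
    rw [(hp k).1, (hp k).2.1, cuspOf_adj _ _ (p.flag_ne k (by decide)), ih]

variable (T) in
/-- `Y` is a function of the sides of the triangles (`Y t v j` belonging to the side on face `j` of
the triangle at vertex `v` of `t`), compatible with the face gluings, whose differences are the
weights `w` of the corners. -/
structure IsSidePotential (Y : Tet → Fin 4 → Fin 4 → ℤ) (w : Tet → Fin 3 → ℤ) : Prop where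
  glue : ∀ t j v, v ≠ j → Y (T.adj t j) (T.perm t j v) (T.perm t j j) = Y t v j
  sub : ∀ t (π : Perm (Fin 4)), Perm.sign π = 1 →
    w t (quad (π 0) (π 1)) = Y t (π 0) (π 2) - Y t (π 0) (π 3)

theorem sign_mul_weight {Y : Fin 4 → Fin 4 → ℤ} {w : Fin 3 → ℤ}
    (h : ∀ π : Perm (Fin 4), Perm.sign π = 1 → w (quad (π 0) (π 1)) = Y (π 0) (π 2) - Y (π 0) (π 3))
    (π : Perm (Fin 4)) :
    ((Perm.sign π : ℤˣ) : ℤ) * w (quad (π 0) (π 1)) = Y (π 0) (π 2) - Y (π 0) (π 3) := by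
  rcases Int.units_eq_one_or (Perm.sign π) with hs | hs
  · rw [hs, ← h π hs]; simp
  · have hs' : Perm.sign (π * swap 2 3) = 1 := by
      rw [Perm.sign_mul, hs, Perm.sign_swap (by decide)]; rfl
    have := h _ hs'
    simp only [Perm.mul_apply, show swap (2 : Fin 4) 3 0 = 0 by decide, show swap (2 : Fin 4) 3 1 = 1 by decide,
      swap_apply_left, swap_apply_right] at this
    rw [hs, this]; simp

/-- Each arc contributes the potential of its exit side minus that of its entry side, and the sum
telescopes around the curve. -/
theorem IsSidePotential.pairing_row_eq_zero [Fintype Tet] {Y : Tet → Fin 4 → Fin 4 → ℤ}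
    {w : Tet → Fin 3 → ℤ} (h : T.IsSidePotential Y w) {p : CuspPath Tet} (hp : T.IsCurve p) :
    pairing p.row w = 0 := by
  rw [p.pairing_row]
  simp only [sign_mul_weight (h.sub _)]
  rw [Finset.sum_sub_distrib, sub_eq_zero, ← Fin.sum_comp_add_one fun k => Y (p.tet k) (p.flag k 0) (p.flag k 3)]
  refine Finset.sum_congr rfl fun k _ => ?_
  rw [(hp k).1, (hp k).2.1, (hp k).2.2, h.glue _ _ _ (p.flag_ne k (by decide))]

/-- The values of a potential on the three sides of a triangle of given weights. -/
def sideOfWeight (w : Fin 3 → ℤ) : Fin 3 → ℤ := ![0, -w 2, w 1]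

theorem sideOfWeight_sub {w : Fin 3 → ℤ} (h : w 0 + w 1 + w 2 = 0) (q : Fin 3) :
    w q = sideOfWeight w (q + 1) - sideOfWeight w (q + 2) := by
  fin_cases q <;> (simp [sideOfWeight]; try omega)

/-- A closed weight which vanishes on the curves that are embedded cycles of triangles has a
potential. -/
theorem IsClosedWeight.exists_isSidePotential [Fintype Tet] {w : Tet → Fin 3 → ℤ}
    (hw : T.IsClosedWeight w)
    (hv : ∀ p c, T.IsSimpleClosedCurve p c → Function.Injective (fun k => (p.tet k, p.flag k 0)) →
      pairing p.row w = 0) : ∃ Y, T.IsSidePotential Y w := by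
  let D := {x : Tet × Fin 4 × Fin 4 // x.2.1 ≠ x.2.2}
  -- Inside one triangle a potential exists because the three weights sum up to zero. The mismatch
  -- of these local potentials across the sides is a function on the darts of the dual graph, whose
  -- vertices are the triangles. A potential `X` of the mismatch corrects `y` by a constant in each
  -- triangle.
  let y : Tet → Fin 4 → Fin 4 → ℤ := fun t v j => sideOfWeight (w t) (quad v j)
  have hy : ∀ t (π : Perm (Fin 4)), Perm.sign π = 1 →
      w t (quad (π 0) (π 1)) = y t (π 0) (π 2) - y t (π 0) (π 3) := by
    intro t π hπ
    simp only [y]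
    rw [(quad_of_even π hπ).1, (quad_of_even π hπ).2]
    exact sideOfWeight_sub (hw.1 t) _
  let src : D → Tet × Fin 4 := fun d => (d.1.1, d.1.2.1)
  let rev : D → D := fun d => ⟨(T.adj d.1.1 d.1.2.2, T.perm d.1.1 d.1.2.2 d.1.2.1,
    T.perm d.1.1 d.1.2.2 d.1.2.2), T.ne_perm d.2⟩
  have hrr : ∀ d, rev (rev d) = d := fun d => Subtype.ext (by
    simp only [rev, T.adj_adj, T.perm_inv_self])
  let f : D → ℤ := fun d => y d.1.1 d.1.2.1 d.1.2.2
  obtain ⟨X, hX⟩ := exists_potential (src := src) (tgt := fun d => src (rev d)) (rev := rev)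
    (w := fun d => f d - f (rev d)) (fun d => rfl) (fun d => by simp only [hrr])
    (fun d => by simp only [hrr]; ring) (by
    intro n d hcl hinj hb
    have hne : ∀ k, (d k).1.2.1 ≠ (d k).1.2.2 ∧ (d k).1.2.1 ≠ (rev (d (k - 1))).1.2.2 ∧
        (d k).1.2.2 ≠ (rev (d (k - 1))).1.2.2 := by
      intro k
      have h1 := hcl (k - 1)
      rw [sub_add_cancel] at h1
      have h2 := congrArg Prod.snd h1
      refine ⟨(d k).2, ?_, ?_⟩
      · change (src (d k)).2 ≠ _
        rw [← h2]; exact (rev (d (k - 1))).2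
      · intro h
        have := hb (k - 1)
        rw [sub_add_cancel] at this
        exact this (Subtype.ext (Prod.ext (congrArg Prod.fst h1).symm (Prod.ext h2.symm h)))
    choose φ hφ0 hφ2 hφ3 using fun k => exists_perm_of_ne _ _ _ (hne k)
    let p : CuspPath Tet := ⟨n, fun k => (d k).1.1, φ⟩
    have hp : T.IsCurve p := by
      intro k
      have h1 := hcl k
      refine ⟨?_, ?_, ?_⟩
      · simp only [p, hφ2]; exact (congrArg Prod.fst h1).symm
      · simp only [p, hφ0, hφ2]; exact (congrArg Prod.snd h1).symm
      · simp only [p, hφ2]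
        rw [show φ (k + 1) 3 = _ from hφ3 (k + 1), add_sub_cancel_right]
    have hinj' : Function.Injective (fun k => (p.tet k, p.flag k 0)) := by
      simp only [p, hφ0]; exact hinj
    have hsum : ∑ k, (f (d k) - f (rev (d k))) = pairing p.row w := by
      rw [p.pairing_row]
      simp only [sign_mul_weight (hy _)]
      rw [Finset.sum_sub_distrib, Finset.sum_sub_distrib,
        ← Fin.sum_comp_add_one fun k => y (p.tet k) (p.flag k 0) (p.flag k 3)]
      congr 1
      · exact Finset.sum_congr rfl fun k _ => by simp only [p, f, hφ0, hφ2]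
      · refine Finset.sum_congr rfl fun k _ => ?_
        rw [(hp k).1, (hp k).2.1, (hp k).2.2]
        simp only [p, f, hφ0, hφ2, rev]
    rw [hsum]
    -- A null-homologous cycle is handled by closedness of the weight. Any other is a nontrivial
    -- curve, embedded because it has at most one arc in each triangle, so that midpoints serve as
    -- crossing points.
    by_cases hbd : T.IsBoundary p.crossing
    · exact hw.pairing_eq_zero hbd
    · refine hv p _ ⟨hp, hp.isOn, ⟨fun _ => 1 / 2, fun _ => by norm_num, fun k k' hk h1 h2 => ?_⟩, hbd⟩ hinj'
      exact absurd (hinj' (Prod.ext h1 h2)) hk)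
  refine ⟨fun t v j => X (t, v) + y t v j, ⟨fun t j v h => ?_, fun t π hπ => ?_⟩⟩
  · have := hX ⟨(t, v, j), h⟩
    simp only [src, rev, f] at this
    rw [this]; ring
  · rw [hy t π hπ]; ring

end Gluing

/-! ## Weights of the form `J (rowSum c)` -/

theorem sum_even_perm {R : Type*} [AddCommMonoid R] (F : Fin 4 → Fin 4 → R) (h : ∀ a, F a a = 0) :
    ∑ π : Perm (Fin 4) with Perm.sign π = 1, F (π 0) (π 1) = ∑ a, ∑ b, F a b := by
  rw [← Finset.sum_product', ← Finset.sum_filter_of_ne (p := fun x : Fin 4 × Fin 4 => x.1 ≠ x.2)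
    (fun x _ hx hx' => hx (by rw [hx', h]))]
  · refine Finset.sum_nbij (fun π => (π 0, π 1)) ?_ ?_ ?_ (fun _ _ => rfl)
    · intro π _
      simp
    · intro π hπ π' hπ' he
      simp only [Finset.coe_filter, Finset.mem_univ, true_and, Set.mem_ofPred_eq] at hπ hπ'
      exact even_perm_ext π π' ⟨hπ, hπ', congrArg Prod.fst he, congrArg Prod.snd he⟩
    · rintro ⟨a, b⟩ hab
      simp only [Finset.coe_filter, Finset.mem_product, Finset.mem_univ, true_and, Set.mem_ofPred_eq] at hab
      obtain ⟨π, h1, h2, h3⟩ := exists_even_perm a b hab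
      exact ⟨π, by simpa using h1, by simp [h2, h3]⟩

/-- Even permutations correspond to oriented edges, so every edge is counted twice. This form suits
reindexing by the rotation about an edge. -/
theorem sum_oppSum_mul (V : Fin 4 → Fin 4 → ℤ) (hs : ∀ a b, V a b = V b a) (h0 : ∀ a, V a a = 0) (w : Fin 3 → ℤ) :
    2 * ∑ q, oppSum V q * w q = ∑ π : Perm (Fin 4) with Perm.sign π = 1, V (π 0) (π 1) * w (quad (π 0) (π 1)) := by
  rw [sum_even_perm (fun a b => V a b * w (quad a b)) (fun a => by rw [h0, zero_mul])]
  simp only [Fin.sum_univ_four, Fin.sum_univ_three, h0, hs 1 0, hs 2 0, hs 3 0, hs 2 1, hs 3 1, hs 3 2,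
    quad_comm 1 0, quad_comm 2 0, quad_comm 3 0, quad_comm 2 1, quad_comm 3 1, quad_comm 3 2,
    show quad 0 1 = 0 by decide, show quad 0 2 = 1 by decide, show quad 0 3 = 2 by decide,
    show quad 1 2 = 2 by decide, show quad 1 3 = 1 by decide, show quad 2 3 = 0 by decide, oppSum,
    Matrix.cons_val]
  ring

namespace Gluing
variable {Tet : Type*} {T : Gluing Tet}

variable (T) in
/-- Rotation about an edge: from a tetrahedron with an edge to the next tetrahedron around the edge. -/
def rotate : Tet × Perm (Fin 4) ≃ Tet × Perm (Fin 4) where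
  toFun x := (T.adj x.1 (x.2 2), T.perm x.1 (x.2 2) * x.2 * swap 2 3)
  invFun x := (T.adj x.1 (x.2 3), T.perm x.1 (x.2 3) * x.2 * swap 2 3)
  left_inv := by
    rintro ⟨t, π⟩
    simp only [Perm.mul_apply, swap_apply_right, T.adj_adj, T.perm_perm, Prod.mk.injEq, true_and]
    ext i; simp
  right_inv := by
    rintro ⟨t, π⟩
    simp only [Perm.mul_apply, swap_apply_left, T.adj_adj, T.perm_perm, Prod.mk.injEq, true_and]
    ext i; simp

/-- The differences of the potential telescope around each triangle, and also around each vertex of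
the boundary surface, hence around each edge. -/
theorem IsSidePotential.isClosedWeight [Fintype Tet] {Y : Tet → Fin 4 → Fin 4 → ℤ} {w : Tet → Fin 3 → ℤ}
    (h : T.IsSidePotential Y w) : T.IsClosedWeight w := by
  classical
  refine ⟨fun t => ?_, fun e => ?_⟩
  · have h1 := h.sub t 1 (by simp)
    have h2 := h.sub t (swap 1 2 * swap 2 3) (by decide)
    have h3 := h.sub t (swap 2 3 * swap 1 2) (by decide)
    simp only [Perm.one_apply, Perm.mul_apply, show swap (2 : Fin 4) 3 0 = 0 by decide,
      show swap (1 : Fin 4) 2 0 = 0 by decide, show swap (2 : Fin 4) 3 1 = 1 by decide,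
      show swap (1 : Fin 4) 2 1 = 2 by decide, show swap (2 : Fin 4) 3 2 = 3 by decide,
      show swap (1 : Fin 4) 2 3 = 3 by decide, show swap (2 : Fin 4) 3 3 = 2 by decide,
      show swap (1 : Fin 4) 2 2 = 1 by decide,
      show quad 0 1 = 0 by decide, show quad 0 2 = 1 by decide, show quad 0 3 = 2 by decide] at h1 h2 h3
    omega
  · have hrow : T.edgeRow e = T.rowSum (Pi.single e (1:ℤ)) := by
      funext t q; exact T.edgeRow_eq e t q
    set c : T.Edge → ℤ := Pi.single e 1
    have key : 2 * pairing (T.rowSum c) w = ∑ x : Tet × Perm (Fin 4),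
        if Perm.sign x.2 = 1 then T.edgeVal c x.1 (x.2 0) (x.2 1) *
          (Y x.1 (x.2 0) (x.2 2) - Y x.1 (x.2 0) (x.2 3)) else 0 := by
      rw [Fintype.sum_prod_type, pairing, Finset.mul_sum]
      refine Finset.sum_congr rfl fun t _ => ?_
      rw [← Finset.sum_filter]
      refine (sum_oppSum_mul _ (T.edgeVal_comm c t) (fun a => by simp [edgeVal]) (w t)).trans ?_
      refine Finset.sum_congr rfl fun π hπ => ?_
      rw [← h.sub t π (Finset.mem_filter.1 hπ).2]
    -- Rotation carries the outgoing side at an edge to the incoming side in the next tetrahedron.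
    -- It preserves even permutations, since both the gluing map and the transposition are odd.
    have h2 : ∑ x : Tet × Perm (Fin 4), (if Perm.sign x.2 = 1 then T.edgeVal c x.1 (x.2 0) (x.2 1) *
          Y x.1 (x.2 0) (x.2 2) else 0) = ∑ x : Tet × Perm (Fin 4), (if Perm.sign x.2 = 1 then
          T.edgeVal c x.1 (x.2 0) (x.2 1) * Y x.1 (x.2 0) (x.2 3) else 0) := by
      rw [← Equiv.sum_comp T.rotate (fun x : Tet × Perm (Fin 4) => if Perm.sign x.2 = 1 then
          T.edgeVal c x.1 (x.2 0) (x.2 1) * Y x.1 (x.2 0) (x.2 3) else 0)]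
      refine Finset.sum_congr rfl fun x _ => ?_
      obtain ⟨t, π⟩ := x
      simp only [rotate, Equiv.coe_fn_mk, Perm.sign_mul, T.odd, Perm.mul_apply, swap_apply_right,
        Perm.sign_swap (show (2 : Fin 4) ≠ 3 by decide), show swap (2 : Fin 4) 3 0 = 0 by decide,
        show swap (2 : Fin 4) 3 1 = 1 by decide]
      rw [h.glue t (π 2) (π 0) (π.injective.ne (by decide)),
        edgeVal_adj _ _ _ (π.injective.ne (by decide)) (π.injective.ne (by decide))]
      simp
    have : 2 * pairing (T.rowSum c) w = 0 := by
      rw [key]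
      refine Eq.trans ?_ (sub_eq_zero.2 h2)
      rw [← Finset.sum_sub_distrib]
      refine Finset.sum_congr rfl fun x _ => ?_
      split_ifs <;> ring
    rw [hrow]
    omega

/-- The weights that are symplectically dual to exponents. -/
def dual (C : Fin 3 → ℤ) : Fin 3 → ℤ := fun q => C (q + 2) - C (q + 1)

theorem dual_rowSum_quad (c : T.Edge → ℤ) (t : Tet) {π : Perm (Fin 4)} (hπ : Perm.sign π = 1) :
    dual (T.rowSum c t) (quad (π 0) (π 1)) = T.edgeVal c t (π 0) (π 3) + T.edgeVal c t (π 1) (π 2)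
      - (T.edgeVal c t (π 0) (π 2) + T.edgeVal c t (π 1) (π 3)) := by
  have h1 := T.rowSum_quad c t (π * swap 1 2)
  have h2 := T.rowSum_quad c t (π * swap 1 3)
  simp only [Perm.mul_apply, show swap (1 : Fin 4) 2 0 = 0 by decide, swap_apply_left, swap_apply_right,
    show swap (1 : Fin 4) 2 3 = 3 by decide, show swap (1 : Fin 4) 3 0 = 0 by decide,
    show swap (1 : Fin 4) 3 2 = 2 by decide] at h1 h2
  rw [dual, ← (quad_of_even π hπ).1, ← (quad_of_even π hπ).2, h1, h2, T.edgeVal_comm c t (π 2) (π 1)]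

variable (T) in
/-- A potential of `2 * dual (rowSum c)`. -/
def sideOfEdge (c : T.Edge → ℤ) (t : Tet) (v j : Fin 4) : ℤ :=
  ∑ a, ∑ b, ((if b = j then 0 else T.edgeVal c t v b) -
    if a = j ∨ b = j then 0 else T.edgeVal c t a b)

/-- If `v, a, b` are the vertices of the face opposite to `j`, the potential is twice `c(va) + c(vb)
- c(ab)`. It is built only from that face, so it is compatible with gluing; the sum over all labels
turns this into a reindexing by the gluing permutation. -/
theorem isSidePotential_sideOfEdge (c : T.Edge → ℤ) :
    T.IsSidePotential (T.sideOfEdge c) (fun t q => 2 * dual (T.rowSum c t) q) := by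
  refine ⟨fun t j v hv => ?_, fun t π hπ => ?_⟩
  · unfold sideOfEdge
    rw [← Equiv.sum_comp (T.perm t j)]
    refine Finset.sum_congr rfl fun a _ => ?_
    rw [← Equiv.sum_comp (T.perm t j)]
    refine Finset.sum_congr rfl fun b _ => ?_
    simp only [(T.perm t j).injective.eq_iff]
    by_cases ha : a = j <;> by_cases hb : b = j
    · simp [ha, hb]
    · simp [ha, hb, T.edgeVal_adj c t hv.symm (Ne.symm hb)]
    · simp [ha, hb]
    · simp [ha, hb, T.edgeVal_adj c t hv.symm (Ne.symm hb), T.edgeVal_adj c t (Ne.symm ha) (Ne.symm hb)]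
  · rw [dual_rowSum_quad c t hπ]
    have : ∀ j, T.sideOfEdge c t (π 0) (π j) = ∑ a, ∑ b, ((if b = j then 0 else T.edgeVal c t (π 0) (π b)) -
        if a = j ∨ b = j then 0 else T.edgeVal c t (π a) (π b)) := by
      intro j
      refine (Equiv.sum_comp π _).symm.trans (Finset.sum_congr rfl fun a _ => ?_)
      refine (Equiv.sum_comp π _).symm.trans ?_
      simp only [π.injective.eq_iff]
    have h0 : ∀ a, T.edgeVal c t a a = 0 := fun a => by simp [edgeVal]
    rw [this, this]
    simp [Fin.sum_univ_four, h0, T.edgeVal_comm c t (π 1) (π 0), T.edgeVal_comm c t (π 2) (π 0), T.edgeVal_comm c t (π 3) (π 0),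
      T.edgeVal_comm c t (π 2) (π 1), T.edgeVal_comm c t (π 3) (π 1)]
    ring

theorem two_mul_pairing {Tet : Type*} [Fintype Tet] (x w : Tet → Fin 3 → ℤ) :
    pairing x (fun t q => 2 * w t q) = 2 * pairing x w := by
  simp only [pairing, Finset.mul_sum]
  exact Finset.sum_congr rfl fun _ _ => Finset.sum_congr rfl fun _ _ => by ring

/-- Twice the weight has an integral potential; the factor 2 is cancelled afterwards. -/
theorem isClosedWeight_dual [Fintype Tet] (c : T.Edge → ℤ) :
    T.IsClosedWeight (fun t => dual (T.rowSum c t)) := by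
  refine ⟨fun t => by simp [dual], fun e => ?_⟩
  have := (isSidePotential_sideOfEdge c).isClosedWeight.2 e
  rw [two_mul_pairing] at this
  omega

theorem pairing_row_dual [Fintype Tet] (c : T.Edge → ℤ) {p : CuspPath Tet} (hp : T.IsCurve p) :
    pairing p.row (fun t => dual (T.rowSum c t)) = 0 := by
  have := (isSidePotential_sideOfEdge c).pairing_row_eq_zero hp
  rw [two_mul_pairing] at this
  omega

/-- The edge equations are in involution. -/
theorem pairing_rowSum_dual [Fintype Tet] (c c' : T.Edge → ℤ) :
    pairing (T.rowSum c') (fun t => dual (T.rowSum c t)) = 0 :=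
  (isClosedWeight_dual c).pairing_rowSum_eq_zero c'

/-! ## Independence of the flattening -/

theorem third_aux : ∀ a b : Fin 4, ∃ j, j ≠ a ∧ j ≠ b := by decide

theorem exists_even_of_ne' : ∀ a b j k : Fin 4, (a ≠ b ∧ j ≠ a ∧ j ≠ b ∧ k ≠ a ∧ k ≠ b ∧ j ≠ k) →
    ∃ π : Perm (Fin 4), Perm.sign π = 1 ∧ π 0 = a ∧ π 1 = b ∧ ((π 2 = j ∧ π 3 = k) ∨ (π 2 = k ∧ π 3 = j)) := by
  decide

/-- An edge receives the sum of the potentials of the two sides at its ends on a face containing it.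
Opposite edges of a tetrahedron carry equal weights, so the result does not depend on the face. -/
theorem IsSidePotential.exists_rowSum {Y : Tet → Fin 4 → Fin 4 → ℤ} {w : Tet → Fin 3 → ℤ}
    (h : T.IsSidePotential Y w) : ∃ c : T.Edge → ℤ, ∀ t q, 2 * w t q = dual (T.rowSum c t) q := by
  have hind : ∀ t a b j k, a ≠ b → j ≠ a → j ≠ b → k ≠ a → k ≠ b → Y t a j + Y t b j = Y t a k + Y t b k := by
    intro t a b j k hab hja hjb hka hkb
    by_cases hjk : j = k
    · rw [hjk]
    obtain ⟨π, hπ, h0, h1, h2⟩ := exists_even_of_ne' a b j k ⟨hab, hja, hjb, hka, hkb, hjk⟩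
    have e1 := h.sub t π hπ
    -- The same edge seen from its other end: the weight is the same, and the two sides are
    -- exchanged.
    have e2 := h.sub t (π * (swap 0 1 * swap 2 3)) (by rw [Perm.sign_mul, hπ]; decide)
    simp only [Perm.mul_apply, show swap (2 : Fin 4) 3 0 = 0 by decide, show swap (2 : Fin 4) 3 1 = 1 by decide,
      swap_apply_left, swap_apply_right, show swap (0 : Fin 4) 1 2 = 2 by decide,
      show swap (0 : Fin 4) 1 3 = 3 by decide, quad_comm (π 1) (π 0)] at e2
    rw [h0, h1] at e1 e2
    rcases h2 with ⟨h2, h3⟩ | ⟨h2, h3⟩ <;> rw [h2, h3] at e1 e2 <;> omega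
  choose j hja hjb using third_aux
  obtain ⟨c, hc⟩ := T.exists_edgeVal_eq (fun t a b => if a = b then 0 else Y t a (j a b) + Y t b (j a b)) (by
    intro t a b
    by_cases hab : a = b
    · simp [hab]
    · simp only [hab, Ne.symm hab, if_false]
      rw [hind t a b (j a b) (j b a) hab (hja _ _) (hjb _ _) (hjb _ _) (hja _ _), add_comm]) (by
    intro t i a b ha hb hab
    have hab' := (T.perm t i).injective.ne hab
    simp only [hab, hab', if_false]
    rw [hind _ _ _ (j _ _) (T.perm t i i) hab' (hja _ _) (hjb _ _) ((T.perm t i).injective.ne ha) ((T.perm t i).injective.ne hb),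
      h.glue t i a ha.symm, h.glue t i b hb.symm]
    exact hind t a b _ _ hab ha hb (hja _ _) (hjb _ _))
  have hc' : ∀ t a b k, a ≠ b → k ≠ a → k ≠ b → T.edgeVal c t a b = Y t a k + Y t b k := by
    intro t a b k hab hka hkb
    rw [hc t a b hab, if_neg hab]
    exact hind t a b _ _ hab (hja _ _) (hjb _ _) hka hkb
  refine ⟨c, fun t q => ?_⟩
  obtain ⟨π, hπ, rfl⟩ : ∃ π : Perm (Fin 4), Perm.sign π = 1 ∧ quad (π 0) (π 1) = q := by
    revert q; decide
  have hn : ∀ {i k}, i ≠ k → π i ≠ π k := fun h => π.injective.ne h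
  rw [dual_rowSum_quad c t hπ, h.sub t π hπ,
    hc' t (π 0) (π 3) (π 2) (hn (by decide)) (hn (by decide)) (hn (by decide)),
    hc' t (π 1) (π 2) (π 3) (hn (by decide)) (hn (by decide)) (hn (by decide)),
    hc' t (π 0) (π 2) (π 3) (hn (by decide)) (hn (by decide)) (hn (by decide)),
    hc' t (π 1) (π 3) (π 2) (hn (by decide)) (hn (by decide)) (hn (by decide))]
  have e2 := h.sub t (π * (swap 0 1 * swap 2 3)) (by rw [Perm.sign_mul, hπ]; decide)
  have e1 := h.sub t π hπ
  simp only [Perm.mul_apply, show swap (2 : Fin 4) 3 0 = 0 by decide, show swap (2 : Fin 4) 3 1 = 1 by decide,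
    swap_apply_left, swap_apply_right, show swap (0 : Fin 4) 1 2 = 2 by decide,
    show swap (0 : Fin 4) 1 3 = 3 by decide, quad_comm (π 1) (π 0)] at e2
  omega

/-- The number of the three edges of a face that carry `0` is `0` or `3`, or not. -/
def faceParity (x y z : ZMod 2) : ZMod 2 := x * y + y * z + z * x + x + y + z

theorem faceParity_perm (W : Fin 4 → Fin 4 → ZMod 2) (hs : ∀ a b, W a b = W b a) (ρ : Perm (Fin 4)) (hρ : ρ 0 = 0) :
    faceParity (W (ρ 1) (ρ 2)) (W (ρ 2) (ρ 3)) (W (ρ 3) (ρ 1)) = faceParity (W 1 2) (W 2 3) (W 3 1) := by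
  have : ∀ ρ : Perm (Fin 4), ρ 0 = 0 → (ρ 1, ρ 2, ρ 3) ∈ [((1 : Fin 4), (2 : Fin 4), (3 : Fin 4)), (1, 3, 2), (2, 1, 3),
    (2, 3, 1), (3, 1, 2), (3, 2, 1)] := by decide
  have h := this ρ hρ
  have h4 := hs 2 1
  have h5 := hs 3 1
  have h6 := hs 3 2
  simp only [List.mem_cons, Prod.mk.injEq, List.not_mem_nil, or_false] at h
  rcases h with ⟨e0, e1, e2⟩ | ⟨e0, e1, e2⟩ | ⟨e0, e1, e2⟩ | ⟨e0, e1, e2⟩ | ⟨e0, e1, e2⟩ | ⟨e0, e1, e2⟩ <;>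
    rw [e0, e1, e2, h5] <;> simp only [h4, h6, faceParity] <;> ring

/-- Modulo 2 the hypothesis makes the three sums over opposite edges equal in each tetrahedron, and
this common value is the sum of the face parities of the tetrahedron. Every face is glued to a
different face with the same parity, so the total vanishes. -/
theorem even_sum_rowSum [Fintype Tet] (c : T.Edge → ℤ)
    (h : ∀ t q, Even (dual (T.rowSum c t) q)) : Even (∑ t, T.rowSum c t 1) := by
  let W : Tet → Fin 4 → Fin 4 → ZMod 2 := fun t a b => ((T.edgeVal c t a b : ℤ) : ZMod 2)
  have hs : ∀ t a b, W t a b = W t b a := fun t a b => by simp only [W, T.edgeVal_comm c t a b]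
  let b : Tet × Fin 4 → ZMod 2 := fun x => faceParity (W x.1 (swap 0 x.2 1) (swap 0 x.2 2))
    (W x.1 (swap 0 x.2 2) (swap 0 x.2 3)) (W x.1 (swap 0 x.2 3) (swap 0 x.2 1))
  have hb : ∀ t i, b (T.adj t i, T.perm t i i) = b (t, i) := by
    intro t i
    let ρ : Perm (Fin 4) := swap 0 (T.perm t i i) * T.perm t i * swap 0 i
    have hρ : ρ 0 = 0 := by simp [ρ]
    have h1 := faceParity_perm (fun a b => W (T.adj t i) (swap 0 (T.perm t i i) a) (swap 0 (T.perm t i i) b))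
      (fun a b => hs _ _ _) ρ hρ
    have h2 : ∀ j, swap 0 (T.perm t i i) (ρ j) = T.perm t i (swap 0 i j) := fun j => by simp [ρ]
    have h3 : ∀ j, j ≠ 0 → i ≠ swap 0 i j := fun j hj h => hj (by
      have := congrArg (swap 0 i) h
      simpa using this.symm)
    simp only [h2] at h1
    simp only [b]
    rw [← h1]
    simp only [W, T.edgeVal_adj c t (h3 1 (by decide)) (h3 2 (by decide)),
      T.edgeVal_adj c t (h3 2 (by decide)) (h3 3 (by decide)),
      T.edgeVal_adj c t (h3 3 (by decide)) (h3 1 (by decide))]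
  have hsum : ∑ x, b x = 0 := by
    refine Finset.sum_involution (fun x _ => (T.adj x.1 x.2, T.perm x.1 x.2 x.2)) ?_ ?_ ?_ ?_
    · intro x _
      rw [hb]
      exact CharTwo.add_self_eq_zero _
    · intro x _ _ he
      exact T.free x.1 x.2 (congrArg Prod.fst he) (congrArg Prod.snd he)
    · intro x _; exact Finset.mem_univ _
    · intro x _
      simp only [T.adj_adj, T.perm_inv_self]
  -- After expansion this is a statement about six elements of `ZMod 2`, one for each edge, decided
  -- by enumeration.
  have hloc : ∀ t, ∑ i, b (t, i) = ((T.rowSum c t 1 : ℤ) : ZMod 2) := by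
    intro t
    have h0 : ∀ q, ((dual (T.rowSum c t) q : ℤ) : ZMod 2) = 0 := fun q =>
      (ZMod.intCast_zmod_eq_zero_iff_dvd _ _).2 (even_iff_two_dvd.1 (h t q))
    have h1 := h0 0
    have h2 := h0 2
    simp only [dual, rowSum, oppSum, zero_add, Fin.isValue, Matrix.cons_val, Int.cast_sub, Int.cast_add,
      show (2 + 2 : Fin 3) = 1 by decide, show (2 + 1 : Fin 3) = 0 by decide] at h1 h2 ⊢
    simp only [Fin.sum_univ_four, b, show swap (0 : Fin 4) 0 = 1 from swap_self _, Perm.one_apply,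
      show swap (0 : Fin 4) 1 1 = 0 by decide, show swap (0 : Fin 4) 1 2 = 2 by decide, show swap (0 : Fin 4) 1 3 = 3 by decide,
      show swap (0 : Fin 4) 2 1 = 1 by decide, show swap (0 : Fin 4) 2 2 = 0 by decide, show swap (0 : Fin 4) 2 3 = 3 by decide,
      show swap (0 : Fin 4) 3 1 = 1 by decide, show swap (0 : Fin 4) 3 2 = 2 by decide, show swap (0 : Fin 4) 3 3 = 0 by decide,
      hs t 1 0, hs t 2 0, hs t 3 0, hs t 3 1]
    change W t 0 3 + W t 1 2 - (W t 0 2 + W t 1 3) = 0 at h1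
    change W t 0 2 + W t 1 3 - (W t 0 1 + W t 2 3) = 0 at h2
    change _ = W t 0 2 + W t 1 3
    generalize W t 0 1 = x1 at *
    generalize W t 0 2 = x2 at *
    generalize W t 0 3 = x3 at *
    generalize W t 1 2 = x4 at *
    generalize W t 1 3 = x5 at *
    generalize W t 2 3 = x6 at *
    clear hsum hb b hs W h h0
    revert x1 x2 x3 x4 x5 x6
    decide
  rw [even_iff_two_dvd]
  refine (ZMod.intCast_zmod_eq_zero_iff_dvd _ 2).1 ?_
  rw [Int.cast_sum, ← hsum, Fintype.sum_prod_type]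
  exact Finset.sum_congr rfl fun t _ => (hloc t).symm

/-- The contribution of a flattening to the 1-loop invariant. -/
noncomputable def flatteningProd [Fintype Tet] (z : Tet → ℂ) (f : Tet → Fin 3 → ℤ) : ℂ :=
  ∏ t, (shape (z t) 0 ^ f t 2 * shape (z t) 2 ^ (-f t 0))

/-- With `2 w` dual to an edge function `c`, the square of the product is the value of the edge
equations with exponents `-c`, which is 1, times a power of `-1` coming from `z z' z'' = -1`. Its
exponent is even. -/
theorem IsClosedWeight.flatteningProd_eq [Fintype Tet] {z : Tet → ℂ} (hz : z ∈ T.gluingVariety)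
    {w : Tet → Fin 3 → ℤ} (hw : T.IsClosedWeight w)
    (hv : ∀ p c, T.IsSimpleClosedCurve p c → Function.Injective (fun k => (p.tet k, p.flag k 0)) →
      pairing p.row w = 0) : flatteningProd z w = 1 ∨ flatteningProd z w = -1 := by
  obtain ⟨Y, hY⟩ := hw.exists_isSidePotential hv
  obtain ⟨c, hc⟩ := hY.exists_rowSum
  rw [← sq_eq_one_iff]
  have h0 := T.prod_rowSum hz (-c)
  have hn : T.rowSum (-c) = -T.rowSum c := map_neg T.rowSumHom c
  have hloc : ∀ t, (shape (z t) 0 ^ w t 2 * shape (z t) 2 ^ (-w t 0)) ^ 2 =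
      (∏ q, shape (z t) q ^ T.rowSum (-c) t q) * (-1) ^ T.rowSum c t 1 := by
    intro t
    have s0 := shape_ne_zero (hz.1 t).1 (hz.1 t).2 0
    have s1 := shape_ne_zero (hz.1 t).1 (hz.1 t).2 1
    have s2 := shape_ne_zero (hz.1 t).1 (hz.1 t).2 2
    have e0 := hc t 0
    have e2 := hc t 2
    simp only [dual, show (0 + 2 : Fin 3) = 2 by decide, show (0 + 1 : Fin 3) = 1 by decide,
      show (2 + 2 : Fin 3) = 1 by decide, show (2 + 1 : Fin 3) = 0 by decide] at e0 e2
    have p1 : (shape (z t) 0 ^ w t 2) ^ 2 = shape (z t) 0 ^ (T.rowSum c t 1 + -T.rowSum c t 0) := by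
      rw [← zpow_natCast, ← zpow_mul]; congr 1; push_cast; linarith
    have p2 : (shape (z t) 2 ^ (-w t 0)) ^ 2 = shape (z t) 2 ^ (T.rowSum c t 1 + -T.rowSum c t 2) := by
      rw [← zpow_natCast, ← zpow_mul]; congr 1; push_cast; linarith
    rw [mul_pow, p1, p2, ← shape_prod (hz.1 t).1 (hz.1 t).2, mul_zpow, mul_zpow, Fin.prod_univ_three, hn]
    simp only [Pi.neg_apply]
    rw [zpow_add₀ s0, zpow_add₀ s2]
    have : shape (z t) 1 ^ (-T.rowSum c t 1) * shape (z t) 1 ^ (T.rowSum c t 1) = 1 := by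
      rw [← zpow_add₀ s1]; simp
    linear_combination (-(shape (z t) 0 ^ T.rowSum c t 1 * shape (z t) 0 ^ (-T.rowSum c t 0) *
      (shape (z t) 2 ^ T.rowSum c t 1 * shape (z t) 2 ^ (-T.rowSum c t 2)))) * this
  rw [flatteningProd, ← Finset.prod_pow, Finset.prod_congr rfl fun t _ => hloc t, Finset.prod_mul_distrib, h0, one_mul]
  have : ∏ t, (-1 : ℂ) ^ T.rowSum c t 1 = (-1) ^ ∑ t, T.rowSum c t 1 := by
    induction (Finset.univ : Finset Tet) using Finset.cons_induction with
    | empty => simp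
    | cons a s ha ih => rw [Finset.prod_cons, Finset.sum_cons, zpow_add₀ (by norm_num), ih]
  rw [this]
  exact (even_sum_rowSum c fun t q => by rw [← hc]; exact even_two_mul _).neg_one_zpow

theorem flatteningProd_add [Fintype Tet] {z : Tet → ℂ} (hz : ∀ t, z t ≠ 0 ∧ z t ≠ 1) (f g : Tet → Fin 3 → ℤ) :
    flatteningProd z (f + g) = flatteningProd z f * flatteningProd z g := by
  unfold flatteningProd
  rw [← Finset.prod_mul_distrib]
  refine Finset.prod_congr rfl fun t _ => ?_
  have s0 := shape_ne_zero (hz t).1 (hz t).2 0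
  have s2 := shape_ne_zero (hz t).1 (hz t).2 2
  simp only [Pi.add_apply, neg_add]
  rw [zpow_add₀ s0, zpow_add₀ s2]
  ring

/-- For `f'` vanishing is required only on embedded cycles of triangles; this is all that can be
checked conveniently for the restriction of a flattening to the filled triangulation. -/
theorem IsStrongFlattening.flatteningProd_eq [Fintype Tet] {z : Tet → ℂ} (hz : z ∈ T.gluingVariety)
    {f f' : Tet → Fin 3 → ℤ} (hf : T.IsStrongFlattening f) (hf1 : ∀ t, f' t 0 + f' t 1 + f' t 2 = 1)
    (hf2 : ∀ e, pairing (T.edgeRow e) f' = 2)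
    (hf3 : ∀ p c, T.IsSimpleClosedCurve p c → Function.Injective (fun k => (p.tet k, p.flag k 0)) →
      pairing p.row f' = 0) :
    flatteningProd z f' = flatteningProd z f ∨ flatteningProd z f' = -flatteningProd z f := by
  have h : T.IsClosedWeight (f' - f) := by
    refine ⟨fun t => ?_, fun e => ?_⟩
    · have := hf1 t
      have := hf.1 t
      simp only [Pi.sub_apply]; omega
    · have := hf.2.1 e
      rw [pairing_sub_right, hf2 e]
      change 2 - (∑ t, ∑ q, T.edgeRow e t q * f t q) = 0
      rw [this]; rfl
  have e : f' = f + (f' - f) := by abel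
  rw [e, flatteningProd_add hz.1]
  rcases h.flatteningProd_eq hz (fun p c hp hi => by
    have := hf.2.2 p c hp
    rw [pairing_sub_right, hf3 p c hp hi]
    change 0 - (∑ t, ∑ q, p.row t q * f t q) = 0
    rw [this]; rfl) with h | h
  · left; rw [h, mul_one]
  · right; rw [h, mul_neg, mul_one]

end Gluing

namespace Gluing
variable {Tet : Type*} {T : Gluing Tet}

/-! ## Counting edges -/

theorem EndRel.symm {x y : EdgeEnd Tet} (h : T.EndRel x y) : T.EndRel y x := by
  obtain ⟨i, hi, hj, h1, h2, h3⟩ := h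
  refine ⟨T.perm x.tet i i, ?_, ?_, ?_, ?_, ?_⟩
  · rw [h2]; exact (T.perm x.tet i).injective.ne hi
  · rw [h3]; exact (T.perm x.tet i).injective.ne hj
  · rw [h1, T.adj_adj]
  · rw [h1, h2, T.perm_inv_self]
  · rw [h1, h3, T.perm_inv_self]

theorem linkVertexOf_induction {P : EdgeEnd Tet → Prop} (h : ∀ x y, T.EndRel x y → P x → P y)
    {x y : EdgeEnd Tet} (hxy : T.linkVertexOf x = T.linkVertexOf y) (hx : P x) : P y := by
  let f : T.LinkVertex → Prop := Quot.lift P fun x y hr => propext ⟨h x y hr, h y x hr.symm⟩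
  have : f (T.linkVertexOf x) := hx
  rwa [hxy] at this

variable (T) in
/-- The cusp at a vertex of the boundary surface. -/
def cuspOfLinkVertex : T.LinkVertex → T.Cusp :=
  Quot.lift (fun x => T.cuspOf x.tet x.tail) (by
    rintro x y ⟨i, hi, _, h1, h2, _⟩
    simp only [h1, h2, T.cuspOf_adj _ hi])

theorem card_eq_sum_fiber {A B : Type*} [Finite A] [Fintype B] (f : A → B) :
    Nat.card A = ∑ b, Nat.card {a // f a = b} := by
  rw [← Nat.card_sigma]
  exact Nat.card_congr (Equiv.sigmaFiberEquiv f).symm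

/-- The relations `2 V = F` of the boundary tori are summed over all cusps, there being four
triangles to each tetrahedron. -/
theorem IsIdealTriangulation.card_linkVertex [Finite Tet] (hT : T.IsIdealTriangulation) :
    Nat.card T.LinkVertex = 2 * Nat.card Tet := by
  have := Fintype.ofFinite T.Cusp
  have h1 := card_eq_sum_fiber T.cuspOfLinkVertex
  have h2 := card_eq_sum_fiber (fun x : Tet × Fin 4 => T.cuspOf x.1 x.2)
  have h3 : ∀ c, 2 * Nat.card {d // T.cuspOfLinkVertex d = c} =
      Nat.card {x : Tet × Fin 4 // T.cuspOf x.1 x.2 = c} := by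
    intro c
    have : {d : T.LinkVertex | ∃ x, T.linkVertexOf x = d ∧ T.cuspOf x.tet x.tail = c} =
        {d | T.cuspOfLinkVertex d = c} := by
      ext d
      constructor
      · rintro ⟨x, rfl, hx⟩; exact hx
      · intro hd
        induction d using Quot.ind with
        | mk x => exact ⟨x, rfl, hd⟩
    have h := hT.2 c
    rw [this] at h
    exact h
  have h4 : 2 * Nat.card T.LinkVertex = Nat.card (Tet × Fin 4) := by
    rw [h1, h2, Finset.mul_sum]
    exact Finset.sum_congr rfl fun c _ => h3 c
  rw [Nat.card_prod, Nat.card_eq_fintype_card (α := Fin 4), Fintype.card_fin] at h4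
  omega

/-- The edge with the opposite orientation. -/
def _root_.EdgeEnd.rev (x : EdgeEnd Tet) : EdgeEnd Tet := ⟨x.tet, x.head, x.tail, x.ne.symm⟩

theorem EndRel.rev {x y : EdgeEnd Tet} (h : T.EndRel x y) : T.EndRel x.rev y.rev := by
  obtain ⟨i, hi, hj, h1, h2, h3⟩ := h
  exact ⟨i, hj, hi, h1, h3, h2⟩

variable (T) in
/-- The edge ending at a vertex of the boundary surface. -/
def edgeOfLinkVertex : T.LinkVertex → T.Edge :=
  Quot.lift T.edgeOf fun _ _ h => Quot.sound (Or.inl h)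

variable (T) in
/-- The two ends of an edge. -/
def edgeEnds : T.Edge → Sym2 T.LinkVertex :=
  Quot.lift (fun x => s(T.linkVertexOf x, T.linkVertexOf x.rev)) (by
    rintro ⟨t, a, b, hab⟩ ⟨t', a', b', hab'⟩ (h | ⟨h1, h2, h3⟩)
    · simp only [linkVertexOf]
      rw [Quot.sound h, Quot.sound h.rev]
    · simp only at h1 h2 h3
      subst h1 h2 h3
      exact Sym2.eq_swap)

/-- Every edge has exactly two ends among the vertices of the boundary surface; they differ because
no edge is identified with its reverse. -/
theorem IsIdealTriangulation.card_edge [Finite Tet] (hT : T.IsIdealTriangulation) :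
    Nat.card T.Edge = Nat.card Tet := by
  have := Fintype.ofFinite T.Edge
  have h1 := card_eq_sum_fiber T.edgeOfLinkVertex
  have h2 : ∀ e, Nat.card {d // T.edgeOfLinkVertex d = e} = 2 := by
    intro e
    induction e using Quot.ind with
    | mk x =>
    change Set.ncard {d | T.edgeOfLinkVertex d = T.edgeOf x} = 2
    have : {d | T.edgeOfLinkVertex d = T.edgeOf x} = {T.linkVertexOf x, T.linkVertexOf x.rev} := by
      ext d
      constructor
      · intro hd
        induction d using Quot.ind with
        | mk y =>
          have : T.edgeOf y = T.edgeOf x := hd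
          have := congrArg T.edgeEnds this
          change s(T.linkVertexOf y, T.linkVertexOf y.rev) = s(T.linkVertexOf x, T.linkVertexOf x.rev) at this
          rcases Sym2.eq_iff.1 this with ⟨h, _⟩ | ⟨h, _⟩
          · exact Or.inl h
          · exact Or.inr h
      · rintro (rfl | rfl)
        · rfl
        · exact (T.edgeOf_swap x.tet x.ne).symm
    rw [this]
    exact Set.ncard_pair (hT.1 x x.rev rfl rfl rfl)
  simp only [h2] at h1
  rw [hT.card_linkVertex] at h1
  simp at h1
  rw [Nat.card_eq_fintype_card]
  omega

end Gluing

/-! ## The two tetrahedra at a cusp to be filled -/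

/-- The transposition of the two labels in `{1, 2, 3}` different from `s`. -/
def transp : Fin 4 → Perm (Fin 4) := ![1, swap 2 3, swap 1 3, swap 1 2]

theorem odd_perm_fixing_zero : ∀ σ : Perm (Fin 4), Perm.sign σ = -1 → σ 0 = 0 →
    σ = transp 1 ∨ σ = transp 2 ∨ σ = transp 3 := by decide

namespace Gluing
variable {Tet : Type*} {T : Gluing Tet}

namespace NiceCusps
variable {l : ℕ} (N : T.NiceCusps l)

/-- With the labellings `lab`, face `s` of the tetrahedron `a` at cusp `i` is glued to the tetrahedron
`a'` by `σ`. -/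
def Glued (i : Fin l) (lab : Fin 2 → Perm (Fin 4)) (a : Fin 2) (s : Fin 4) (a' : Fin 2) (σ : Perm (Fin 4)) : Prop :=
  T.adj (N.tet i a) (lab a s) = N.tet i a' ∧ ∀ r, T.perm (N.tet i a) (lab a s) (lab a r) = lab a' (σ r)

variable {N}

theorem tet_eq_iff {i : Fin l} {a a' : Fin 2} : N.tet i a = N.tet i a' ↔ a = a' := by
  refine ⟨fun h => ?_, fun h => by rw [h]⟩
  have := N.tet_ne i
  fin_cases a <;> fin_cases a' <;> first | rfl | exact absurd h this | exact absurd h.symm this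

theorem cuspOf_apex (i : Fin l) (a : Fin 2) : T.cuspOf (N.tet i a) (N.apex i a) = N.cusp i :=
  (N.meets i _ _).2 ⟨a, rfl, rfl⟩

section Glued
variable {i : Fin l} {lab : Fin 2 → Perm (Fin 4)}

theorem Glued.symm {a a' : Fin 2} {s : Fin 4} {σ : Perm (Fin 4)}
    (h : N.Glued i lab a s a' σ) : N.Glued i lab a' (σ s) a σ⁻¹ := by
  have h1 := T.adj_adj (N.tet i a) (lab a s)
  have h2 := T.perm_perm (N.tet i a) (lab a s)
  rw [h.1, h.2] at h1 h2
  refine ⟨h1, fun r => ?_⟩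
  rw [h2, Perm.inv_eq_iff_eq, h.2]; simp

theorem Glued.unique {a a' a'' : Fin 2} {s : Fin 4} {σ σ' : Perm (Fin 4)}
    (h : N.Glued i lab a s a' σ) (h' : N.Glued i lab a s a'' σ') : a' = a'' ∧ σ = σ' := by
  have h1 : a' = a'' := tet_eq_iff.1 (h.1.symm.trans h'.1)
  subst h1
  refine ⟨rfl, Perm.ext fun r => (lab a').injective ?_⟩
  rw [← h.2, ← h'.2]

theorem Glued.apply_ne {a : Fin 2} {s : Fin 4} {σ : Perm (Fin 4)} (h : N.Glued i lab a s a σ) : σ s ≠ s := by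
  intro hs
  refine T.free _ _ h.1 ?_
  rw [h.2, hs]

theorem exists_glued (h0 : ∀ a, lab a 0 = N.apex i a) (h1 : ∀ a, Perm.sign (lab a) = 1) (a : Fin 2)
    {s : Fin 4} (hs : s ≠ 0) : ∃ a' σ, σ 0 = 0 ∧ Perm.sign σ = -1 ∧ N.Glued i lab a s a' σ := by
  have h : T.cuspOf (T.adj (N.tet i a) (lab a s)) (T.perm (N.tet i a) (lab a s) (lab a 0)) = N.cusp i := by
    rw [T.cuspOf_adj _ ((lab a).injective.ne hs), h0, cuspOf_apex]
  obtain ⟨a', h2, h3⟩ := (N.meets i _ _).1 h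
  refine ⟨a', (lab a')⁻¹ * T.perm (N.tet i a) (lab a s) * lab a, ?_, ?_, h2, fun r => ?_⟩
  · rw [Perm.mul_apply, Perm.mul_apply, h3, Perm.inv_eq_iff_eq, h0]
  · simp [h1, T.odd]
  · simp

end Glued

/-- The torus consists of two triangles, so vanishing Euler characteristic leaves one vertex. -/
theorem ncard_linkVertex_cusp (hT : T.IsIdealTriangulation) (i : Fin l) :
    {d : T.LinkVertex | ∃ x, T.linkVertexOf x = d ∧ T.cuspOf x.tet x.tail = N.cusp i}.ncard = 1 := by
  have h := hT.2 (N.cusp i)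
  have : {x : Tet × Fin 4 | T.cuspOf x.1 x.2 = N.cusp i} =
      {(N.tet i 0, N.apex i 0), (N.tet i 1, N.apex i 1)} := by
    ext ⟨t, v⟩
    simp only [Set.mem_ofPred_eq, N.meets, Set.mem_insert_iff, Set.mem_singleton_iff, Prod.mk.injEq]
    exact Fin.exists_fin_two
  rw [this, Set.ncard_pair (fun h => N.tet_ne i (congrArg Prod.fst h))] at h
  omega

theorem linkVertexOf_eq (hT : T.IsIdealTriangulation) (i : Fin l) {x y : EdgeEnd Tet}
    (hx : T.cuspOf x.tet x.tail = N.cusp i) (hy : T.cuspOf y.tet y.tail = N.cusp i) :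
    T.linkVertexOf x = T.linkVertexOf y := by
  obtain ⟨d, hd⟩ := Set.ncard_eq_one.1 (ncard_linkVertex_cusp (N := N) hT i)
  have h1 : T.linkVertexOf x ∈ ({d} : Set T.LinkVertex) := hd ▸ ⟨x, rfl, hx⟩
  have h2 : T.linkVertexOf y ∈ ({d} : Set T.LinkVertex) := hd ▸ ⟨y, rfl, hy⟩
  exact h1.trans h2.symm

/-- Turning about the only vertex of the torus runs through all six corners, so a set of corners
that is closed under turning and not empty contains all of them. -/
theorem Glued.forall_of_invariant (hT : T.IsIdealTriangulation) {i : Fin l} {lab : Fin 2 → Perm (Fin 4)}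
    (h0 : ∀ a, lab a 0 = N.apex i a) (h1 : ∀ a, Perm.sign (lab a) = 1) (P : Fin 2 → Fin 4 → Prop)
    (hP : ∀ a r s a' σ, r ≠ 0 → s ≠ 0 → s ≠ r → N.Glued i lab a s a' σ → P a r → P a' (σ r))
    {a a' : Fin 2} {r r' : Fin 4} (hr : r ≠ 0) (hr' : r' ≠ 0) (h : P a r) : P a' r' := by
  let x : Fin 2 → (r : Fin 4) → r ≠ 0 → EdgeEnd Tet := fun a r hr =>
    ⟨N.tet i a, lab a 0, lab a r, (lab a).injective.ne hr.symm⟩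
  have hx : ∀ a r hr, T.cuspOf (x a r hr).tet (x a r hr).tail = N.cusp i := fun a r hr => by
    simp only [x, h0, cuspOf_apex]
  have := linkVertexOf_induction (P := fun y => ∃ a r, r ≠ 0 ∧ P a r ∧ y.tet = N.tet i a ∧
    y.tail = lab a 0 ∧ y.head = lab a r) ?_ (linkVertexOf_eq hT i (hx a r hr) (hx a' r' hr')) ⟨a, r, hr, h, rfl, rfl, rfl⟩
  · obtain ⟨b, s, hs, hP, e1, e2, e3⟩ := this
    obtain rfl := tet_eq_iff.1 e1
    obtain rfl := (lab a').injective e3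
    exact hP
  · rintro y y' ⟨j, hj, hj', e1, e2, e3⟩ ⟨a, r, hr, hp, f1, f2, f3⟩
    obtain ⟨s, rfl⟩ := (lab a).surjective j
    rw [f2, (lab a).injective.ne_iff] at hj
    rw [f3, (lab a).injective.ne_iff] at hj'
    obtain ⟨a', σ, hσ, _, hg⟩ := exists_glued (N := N) h0 h1 a hj
    refine ⟨a', σ r, fun h => hr (σ.injective (h.trans hσ.symm)), hP a r s a' σ hr hj hj' hg hp, ?_, ?_, ?_⟩
    · rw [e1, f1, hg.1]
    · rw [e2, f1, f2, hg.2, hσ]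
    · rw [e3, f1, f3, hg.2]

variable (N) in
/-- Standard labellings of the two tetrahedra at a cusp: label `0` is the apex, label `1` the
vertex opposite to the folding edge, and the faces `1, 2, 3` of each of the two tetrahedra are glued
to the same faces of the other one. -/
structure IsLabelling (i : Fin l) (lab : Fin 2 → Perm (Fin 4)) : Prop where
  even : ∀ a, Perm.sign (lab a) = 1
  zero : ∀ a, lab a 0 = N.apex i a
  one : ∀ a, lab a 1 = N.opp i a
  glued : ∀ a s, s ≠ 0 → N.Glued i lab a s (1 - a) (transp s)

/-- Only the gluing along face 1 is given. Of the ways to glue the remaining sides, those different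
from the standard one either violate injectivity of the gluing or close up a vertex inside corners
labelled `1`, contradicting that there is just one vertex. -/
theorem exists_isLabelling (hT : T.IsIdealTriangulation) (i : Fin l) : ∃ lab, N.IsLabelling i lab := by
  obtain ⟨lab0, e0, z0, o0⟩ := exists_even_perm (N.apex i 0) (N.opp i 0) (N.opp_ne i 0).symm
  -- The labels are transported through the common face; the transposition makes the second
  -- labelling even again and is the reason for `transp 1`.
  let lab : Fin 2 → Perm (Fin 4) := ![lab0, T.perm (N.tet i 0) (N.opp i 0) * lab0 * swap 2 3]
  have heven : ∀ a, Perm.sign (lab a) = 1 := by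
    intro a
    fin_cases a
    · exact e0
    · change Perm.sign (T.perm (N.tet i 0) (N.opp i 0) * lab0 * swap 2 3) = 1
      rw [Perm.sign_mul, Perm.sign_mul, e0, T.odd, Perm.sign_swap (by decide)]; rfl
  have hzero : ∀ a, lab a 0 = N.apex i a := by
    intro a
    fin_cases a
    · exact z0
    · change T.perm (N.tet i 0) (N.opp i 0) (lab0 (swap 2 3 0)) = N.apex i 1
      rw [show swap (2 : Fin 4) 3 0 = 0 by decide, z0]
      have : T.cuspOf (N.tet i 1) (T.perm (N.tet i 0) (N.opp i 0) (N.apex i 0)) = N.cusp i := by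
        rw [← N.opp_adj i, T.cuspOf_adj _ (N.opp_ne i 0), cuspOf_apex]
      obtain ⟨a, h1, h2⟩ := (N.meets i _ _).1 this
      rw [h2, ← tet_eq_iff.1 h1]
  have hone : ∀ a, lab a 1 = N.opp i a := by
    intro a
    fin_cases a
    · exact o0
    · change T.perm (N.tet i 0) (N.opp i 0) (lab0 (swap 2 3 1)) = N.opp i 1
      rw [show swap (2 : Fin 4) 3 1 = 1 by decide, o0, N.opp_opp]
  have g01 : N.Glued i lab 0 1 1 (transp 1) := by
    refine ⟨by rw [hone, N.opp_adj], fun r => ?_⟩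
    rw [hone]
    change _ = T.perm (N.tet i 0) (N.opp i 0) (lab0 (swap 2 3 (swap 2 3 r)))
    rw [swap_apply_self]; rfl
  have g11 : N.Glued i lab 1 1 0 (transp 1) := by
    have := g01.symm
    rwa [show transp 1 1 = 1 by decide, show (transp 1)⁻¹ = transp 1 by decide] at this
  have t1 : (transp 1)⁻¹ = transp 1 := by decide
  have t2 : (transp 2)⁻¹ = transp 2 := by decide
  have t3 : (transp 3)⁻¹ = transp 3 := by decide
  -- the faces of the second tetrahedron, given those of the first one
  have finish : N.Glued i lab 0 2 1 (transp 2) → N.Glued i lab 0 3 1 (transp 3) → ∃ lab, N.IsLabelling i lab := by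
    intro g02 g03
    have g12 := g02.symm
    have g13 := g03.symm
    rw [t2, show transp 2 2 = 2 by decide] at g12
    rw [t3, show transp 3 3 = 3 by decide] at g13
    refine ⟨lab, heven, hzero, hone, fun a s hs => ?_⟩
    fin_cases a <;> fin_cases s <;> first | exact absurd rfl hs | assumption
  -- the contradiction in the case that the link is a sphere
  have sphere : ∀ P : Fin 2 → Prop, P 0 → (∀ a a' s σ, P a → s ≠ 0 → s ≠ 1 → N.Glued i lab a s a' σ → P a' ∧ σ 1 = 1) → False := by
    intro P h0 hP
    have := Glued.forall_of_invariant hT hzero heven (fun a r => P a ∧ r = 1)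
      (fun a r s a' σ _ hs hsr hg h => by
        obtain ⟨h, rfl⟩ := h
        exact hP a a' s σ h hs hsr hg) (a := 0) (a' := 0) (r := 1) (r' := 2) (by decide) (by decide) ⟨h0, rfl⟩
    exact absurd this.2 (by decide)
  have two_three : ∀ s : Fin 4, s ≠ 0 → s ≠ 1 → s = 2 ∨ s = 3 := by decide
  obtain ⟨a2, σ2, hσ2, hs2, g02⟩ := exists_glued (N := N) hzero heven 0 (s := 2) (by decide)
  obtain ⟨a3, σ3, hσ3, hs3, g03⟩ := exists_glued (N := N) hzero heven 0 (s := 3) (by decide)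
  have fin2 : ∀ a : Fin 2, a = 0 ∨ a = 1 := by decide
  have notA : ∀ s σ, s ≠ 1 → N.Glued i lab 0 s 0 σ → σ s ≠ 1 := by
    intro s σ hs hg h
    have := hg.symm
    rw [h] at this
    exact absurd (this.unique g01).1 (by decide)
  have notB : ∀ s σ, s ≠ 1 → N.Glued i lab 0 s 1 σ → σ s ≠ 1 := by
    intro s σ hs hg h
    have := hg.symm
    rw [h] at this
    have := (this.unique g11).2
    have h2 : σ = transp 1 := by rw [← inv_inj, this, t1]
    rw [h2] at h
    exact hs ((transp 1).injective (h.trans (by decide)))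
  rcases fin2 a2 with rfl | rfl
  · have h1 := notA 2 σ2 (by decide) g02
    have h2 := g02.apply_ne
    obtain rfl : σ2 = transp 1 := by
      rcases odd_perm_fixing_zero σ2 hs2 hσ2 with rfl | rfl | rfl
      · rfl
      · exact absurd (by decide) h2
      · exact absurd (by decide) h1
    have g03' := g02.symm
    rw [t1, show transp 1 2 = 3 by decide] at g03'
    refine (sphere (fun a => a = 0) rfl fun a a' s σ ha hs0 hs1 hg => ?_).elim
    subst ha
    rcases two_three s hs0 hs1 with rfl | rfl
    · obtain ⟨rfl, rfl⟩ := hg.unique g02; exact ⟨rfl, by decide⟩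
    · obtain ⟨rfl, rfl⟩ := hg.unique g03'; exact ⟨rfl, by decide⟩
  · have h1 := notB 2 σ2 (by decide) g02
    rcases fin2 a3 with rfl | rfl
    · exfalso
      have h3 := notA 3 σ3 (by decide) g03
      have h4 := g03.apply_ne
      obtain rfl : σ3 = transp 1 := by
        rcases odd_perm_fixing_zero σ3 hs3 hσ3 with rfl | rfl | rfl
        · rfl
        · exact absurd (by decide) h3
        · exact absurd (by decide) h4
      have := g03.symm
      rw [show transp 1 3 = 2 by decide] at this
      exact absurd (this.unique g02).1 (by decide)
    · have h3 := notB 3 σ3 (by decide) g03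
      rcases odd_perm_fixing_zero σ2 hs2 hσ2 with rfl | rfl | rfl
      · rcases odd_perm_fixing_zero σ3 hs3 hσ3 with rfl | rfl | rfl
        · have g13 := g02.symm
          have g12 := g03.symm
          rw [t1, show transp 1 2 = 3 by decide] at g13
          rw [t1, show transp 1 3 = 2 by decide] at g12
          refine (sphere (fun a => True) trivial fun a a' s σ _ hs0 hs1 hg => ⟨trivial, ?_⟩).elim
          rcases fin2 a with rfl | rfl <;> rcases two_three s hs0 hs1 with rfl | rfl
          · obtain ⟨rfl, rfl⟩ := hg.unique g02; decide
          · obtain ⟨rfl, rfl⟩ := hg.unique g03; decide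
          · obtain ⟨rfl, rfl⟩ := hg.unique g12; decide
          · obtain ⟨rfl, rfl⟩ := hg.unique g13; decide
        · exact absurd (by decide) h3
        · have a1 := g02.symm
          have a2 := g03.symm
          rw [show transp 1 2 = 3 by decide] at a1
          rw [show transp 3 3 = 3 by decide] at a2
          exact absurd (a1.unique a2).2 (by decide)
      · rcases odd_perm_fixing_zero σ3 hs3 hσ3 with rfl | rfl | rfl
        · have a1 := g02.symm
          have a2 := g03.symm
          rw [show transp 2 2 = 2 by decide] at a1
          rw [show transp 1 3 = 2 by decide] at a2
          exact absurd (a1.unique a2).2 (by decide)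
        · exact absurd (by decide) h3
        · exact finish g02 g03
      · exact absurd (by decide) h1

end NiceCusps
end Gluing

namespace Gluing

theorem cuspOf_induction {Tet : Type*} {T : Gluing Tet} {P : Tet → Fin 4 → Prop}
    (h : ∀ t i v, i ≠ v → P t v → P (T.adj t i) (T.perm t i v))
    {t t' : Tet} {v v' : Fin 4} (he : T.cuspOf t v = T.cuspOf t' v') (hx : P t v) : P t' v' := by
  let f : T.Cusp → Prop := Quot.lift (fun x => P x.1 x.2) (by
    rintro ⟨t, v⟩ ⟨t', v'⟩ ⟨i, hi, hy⟩
    simp only [Prod.mk.injEq] at hy hi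
    obtain ⟨rfl, rfl⟩ := hy
    refine propext ⟨h t i v hi, fun h' => ?_⟩
    have := h _ (T.perm t i i) _ ((T.perm t i).injective.ne hi) h'
    rwa [T.adj_adj, T.perm_inv_self] at this)
  have : f (T.cuspOf t v) := hx
  rwa [he] at this

namespace NiceCusps
variable {Tet : Type*} {T : Gluing Tet} {l : ℕ} {N : T.NiceCusps l}

section single
variable {i : Fin l} {lab : Fin 2 → Perm (Fin 4)}

theorem IsLabelling.adj (h : N.IsLabelling i lab) (a : Fin 2) {s : Fin 4} (hs : s ≠ 0) :
    T.adj (N.tet i a) (lab a s) = N.tet i (1 - a) := (h.glued a s hs).1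

theorem IsLabelling.perm (h : N.IsLabelling i lab) (a : Fin 2) {s : Fin 4} (hs : s ≠ 0) (r : Fin 4) :
    T.perm (N.tet i a) (lab a s) (lab a r) = lab (1 - a) (transp s r) := (h.glued a s hs).2 r

theorem IsLabelling.lab_ne (_ : N.IsLabelling i lab) (a : Fin 2) {r s : Fin 4} (hrs : r ≠ s) :
    lab a r ≠ lab a s := (lab a).injective.ne hrs

/-- The three faces at the apex connect all six remaining vertices of the pair with each other. -/
theorem IsLabelling.cuspOf_eq (h : N.IsLabelling i lab) (a : Fin 2) {r : Fin 4} (hr : r ≠ 0) :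
    T.cuspOf (N.tet i a) (lab a r) = T.cuspOf (N.tet i 0) (lab 0 1) := by
  have step : ∀ a r s, s ≠ 0 → s ≠ r → T.cuspOf (N.tet i (1 - a)) (lab (1 - a) (transp s r)) =
      T.cuspOf (N.tet i a) (lab a r) := by
    intro a r s hs hsr
    rw [← h.adj a hs, ← h.perm a hs, T.cuspOf_adj _ (h.lab_ne a hsr)]
  have h1 := step 0 1 2 (by decide) (by decide)
  have h2 := step 0 1 3 (by decide) (by decide)
  have h3 := step 1 3 1 (by decide) (by decide)
  have h4 := step 0 2 3 (by decide) (by decide)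
  have h5 := step 0 3 2 (by decide) (by decide)
  have h6 := step 1 2 1 (by decide) (by decide)
  simp only [show (1 - 0 : Fin 2) = 1 by decide, show (1 - 1 : Fin 2) = 0 by decide,
    show transp 2 1 = 3 by decide, show transp 3 1 = 2 by decide, show transp 1 3 = 2 by decide,
    show transp 3 2 = 1 by decide, show transp 2 3 = 1 by decide, show transp 1 2 = 3 by decide] at h1 h2 h3 h4 h5 h6
  fin_cases a <;> fin_cases r <;> first | exact absurd rfl hr | skip
  · rfl
  · exact h3.trans h1
  · exact h6.trans h2
  · exact h4.trans (h3.trans h1)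
  · exact h2
  · exact h1

/-- The edge classes of the two tetrahedra: those of the edges from the apex to the other vertices
(index `0`), and of the edges of the once-punctured torus, opposite to the vertices `1, 2, 3`. -/
def blockEdge (N : T.NiceCusps l) (i : Fin l) (lab : Fin 2 → Perm (Fin 4)) : Fin 4 → T.Edge :=
  ![T.edgeOf ⟨N.tet i 0, lab 0 0, lab 0 1, (lab 0).injective.ne (by decide)⟩,
    T.edgeOf ⟨N.tet i 0, lab 0 2, lab 0 3, (lab 0).injective.ne (by decide)⟩,
    T.edgeOf ⟨N.tet i 0, lab 0 1, lab 0 3, (lab 0).injective.ne (by decide)⟩,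
    T.edgeOf ⟨N.tet i 0, lab 0 1, lab 0 2, (lab 0).injective.ne (by decide)⟩]

variable {R : Type*}

theorem IsLabelling.edgeVal_step [Zero R] (h : N.IsLabelling i lab) (c : T.Edge → R) (a : Fin 2) {r r' s : Fin 4} (hs : s ≠ 0)
    (hr : s ≠ r) (hr' : s ≠ r') : T.edgeVal c (N.tet i (1 - a)) (lab (1 - a) (transp s r)) (lab (1 - a) (transp s r')) =
      T.edgeVal c (N.tet i a) (lab a r) (lab a r') := by
  rw [← h.adj a hs, ← h.perm a hs, ← h.perm a hs, T.edgeVal_adj _ _ (h.lab_ne a hr) (h.lab_ne a hr')]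

theorem IsLabelling.edgeVal_apex [Zero R] (h : N.IsLabelling i lab) (c : T.Edge → R) (a : Fin 2) {r : Fin 4} (hr : r ≠ 0) :
    T.edgeVal c (N.tet i a) (lab a 0) (lab a r) = c (N.blockEdge i lab 0) := by
  have h1 := h.edgeVal_step c 0 (r := 0) (r' := 1) (s := 2) (by decide) (by decide) (by decide)
  have h2 := h.edgeVal_step c 0 (r := 0) (r' := 1) (s := 3) (by decide) (by decide) (by decide)
  have h3 := h.edgeVal_step c 1 (r := 0) (r' := 3) (s := 1) (by decide) (by decide) (by decide)
  have h4 := h.edgeVal_step c 0 (r := 0) (r' := 2) (s := 3) (by decide) (by decide) (by decide)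
  have h6 := h.edgeVal_step c 1 (r := 0) (r' := 2) (s := 1) (by decide) (by decide) (by decide)
  simp only [show (1 - 0 : Fin 2) = 1 by decide, show (1 - 1 : Fin 2) = 0 by decide, show ∀ s, transp s 0 = 0 by decide,
    show transp 2 1 = 3 by decide, show transp 3 1 = 2 by decide, show transp 1 3 = 2 by decide,
    show transp 3 2 = 1 by decide, show transp 1 2 = 3 by decide] at h1 h2 h3 h4 h6
  have h0 : T.edgeVal c (N.tet i 0) (lab 0 0) (lab 0 1) = c (N.blockEdge i lab 0) :=
    T.edgeVal_of_ne c _ _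
  rw [← h0]
  fin_cases a <;> fin_cases r <;> first | exact absurd rfl hr | skip
  · rfl
  · exact h3.trans h1
  · exact h6.trans h2
  · exact h4.trans (h3.trans h1)
  · exact h2
  · exact h1

theorem IsLabelling.edgeVal_outer [Zero R] (h : N.IsLabelling i lab) (c : T.Edge → R) (a : Fin 2) {s u v : Fin 4}
    (hs : s ≠ 0 ∧ u ≠ 0 ∧ v ≠ 0 ∧ s ≠ u ∧ s ≠ v ∧ u ≠ v) :
    T.edgeVal c (N.tet i a) (lab a u) (lab a v) = c (N.blockEdge i lab s) := by
  have h0 : ∀ s u v : Fin 4, (s, u, v) ∈ [((1 : Fin 4), (2 : Fin 4), (3 : Fin 4)), (2, 1, 3), (3, 1, 2)] →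
      ∀ a, T.edgeVal c (N.tet i a) (lab a u) (lab a v) = c (N.blockEdge i lab s) := by
    intro s u v hm a
    have key : T.edgeVal c (N.tet i 0) (lab 0 u) (lab 0 v) = c (N.blockEdge i lab s) := by
      simp only [List.mem_cons, Prod.mk.injEq, List.not_mem_nil, or_false] at hm
      rcases hm with ⟨rfl, rfl, rfl⟩ | ⟨rfl, rfl, rfl⟩ | ⟨rfl, rfl, rfl⟩ <;> exact T.edgeVal_of_ne c _ _
    have hm' : s ≠ 0 ∧ s ≠ u ∧ s ≠ v ∧ transp s u = v ∧ transp s v = u := by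
      simp only [List.mem_cons, Prod.mk.injEq, List.not_mem_nil, or_false] at hm
      rcases hm with ⟨rfl, rfl, rfl⟩ | ⟨rfl, rfl, rfl⟩ | ⟨rfl, rfl, rfl⟩ <;> decide
    have := h.edgeVal_step c 0 hm'.1 hm'.2.1 hm'.2.2.1
    rw [hm'.2.2.2.1, hm'.2.2.2.2, key, T.edgeVal_comm] at this
    fin_cases a
    · exact key
    · exact this
  have hc : ∀ s u v : Fin 4, (s ≠ 0 ∧ u ≠ 0 ∧ v ≠ 0 ∧ s ≠ u ∧ s ≠ v ∧ u ≠ v) →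
      (s, u, v) ∈ [((1 : Fin 4), (2 : Fin 4), (3 : Fin 4)), (2, 1, 3), (3, 1, 2)] ∨
      (s, v, u) ∈ [((1 : Fin 4), (2 : Fin 4), (3 : Fin 4)), (2, 1, 3), (3, 1, 2)] := by decide
  rcases hc s u v hs with hm | hm
  · exact h0 s u v hm a
  · rw [T.edgeVal_comm]; exact h0 s v u hm a

theorem IsLabelling.rowSum_eq [AddCommMonoid R] (h : N.IsLabelling i lab) (c : T.Edge → R) (a : Fin 2) {s : Fin 4} (hs : s ≠ 0) :
    T.rowSum c (N.tet i a) (quad (lab a 0) (lab a s)) = c (N.blockEdge i lab 0) + c (N.blockEdge i lab s) := by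
  have hπ : ∀ s : Fin 4, s ≠ 0 → ∃ π : Perm (Fin 4), π 0 = 0 ∧ π 1 = s := by decide
  obtain ⟨π, h0, h1⟩ := hπ s hs
  have := T.rowSum_quad c (N.tet i a) (lab a * π)
  simp only [Perm.mul_apply, h0, h1] at this
  have hd : ∀ π : Perm (Fin 4), π 0 = 0 → (π 1 ≠ 0 ∧ π 2 ≠ 0 ∧ π 3 ≠ 0 ∧ π 1 ≠ π 2 ∧ π 1 ≠ π 3 ∧ π 2 ≠ π 3) := by
    decide
  have hd := hd π h0
  rw [h1] at hd
  rw [this, h.edgeVal_apex c a hs, h.edgeVal_outer c a hd]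

end single

/-! ### Functions of the edges and the folding -/

variable {lab : Fin l → Fin 2 → Perm (Fin 4)}

/-- If a tetrahedron belonged to two filled cusps, the second would contain one, hence all three, of
its vertices other than the first apex. But it meets the tetrahedron only once. -/
theorem tet_injective (h : ∀ i, N.IsLabelling i (lab i)) {i i' : Fin l} {a a' : Fin 2}
    (he : N.tet i a = N.tet i' a') : i = i' ∧ a = a' := by
  by_cases hi : i = i'
  · subst hi; exact ⟨rfl, tet_eq_iff.1 he⟩
  exfalso
  obtain ⟨r, hr⟩ := (lab i a).surjective (N.apex i' a')
  have hr0 : r ≠ 0 := by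
    rintro rfl
    have h1 := cuspOf_apex (N := N) i' a'
    rw [← hr, ← he, (h i).zero, cuspOf_apex] at h1
    exact hi (N.cusp_injective h1)
  have h1 : ∀ r, r ≠ 0 → ∃ a'', N.tet i a = N.tet i' a'' ∧ lab i a r = N.apex i' a'' := by
    intro s hs
    refine (N.meets i' _ _).1 ?_
    rw [(h i).cuspOf_eq a hs, ← (h i).cuspOf_eq a hr0, hr, he, cuspOf_apex]
  obtain ⟨b, hb, hb'⟩ := h1 1 (by decide)
  obtain ⟨d, hd, hd'⟩ := h1 2 (by decide)
  have : b = d := tet_eq_iff.1 (hb.symm.trans hd)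
  subst this
  exact absurd ((lab i a).injective (hb'.trans hd'.symm)) (by decide)

/-- An outer face glued to a removed tetrahedron is glued to its outer face: otherwise a vertex
other than the apex would lie on a filled cusp. -/
theorem perm_apex (h : ∀ i, N.IsLabelling i (lab i)) {t : Tet} {k : Fin 4} {i j : Fin l} {a b : Fin 2} (ht : t = N.tet i a)
    (hk : k = N.apex i a) (hadj : T.adj t k = N.tet j b) : T.perm t k k = N.apex j b := by
  subst ht hk
  by_contra hne
  obtain ⟨v, hv⟩ := (T.perm (N.tet i a) (N.apex i a)).surjective (N.apex j b)
  have hv' : N.apex i a ≠ v := by rintro rfl; exact hne hv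
  have h1 := T.cuspOf_adj (N.tet i a) hv'
  rw [hv, hadj, cuspOf_apex] at h1
  obtain ⟨d, hd, hd'⟩ := (N.meets j _ _).1 h1.symm
  obtain ⟨rfl, rfl⟩ := tet_injective h hd
  exact hv' hd'.symm

theorem exists_lab_eq (h : ∀ i, N.IsLabelling i (lab i)) {t : Tet} {k v : Fin 4} {j : Fin l} {b : Fin 2}
    (hk : T.perm t k k = N.apex j b) (hv : v ≠ k) : ∃ r, r ≠ 0 ∧ T.perm t k v = lab j b r := by
  obtain ⟨r, hr⟩ := (lab j b).surjective (T.perm t k v)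
  refine ⟨r, ?_, hr.symm⟩
  rintro rfl
  rw [(h j).zero, ← hk] at hr
  exact hv ((T.perm t k).injective hr.symm)

theorem third_label : ∀ u v : Fin 4, u ≠ 0 → v ≠ 0 → u ≠ v →
    ∃ s, (s ≠ 0 ∧ u ≠ 0 ∧ v ≠ 0 ∧ s ≠ u ∧ s ≠ v ∧ u ≠ v) := by decide

theorem transp_one_third : ∀ s u v : Fin 4, (s ≠ 0 ∧ u ≠ 0 ∧ v ≠ 0 ∧ s ≠ u ∧ s ≠ v ∧ u ≠ v) →
    (transp 1 s ≠ 0 ∧ transp 1 u ≠ 0 ∧ transp 1 v ≠ 0 ∧ transp 1 s ≠ transp 1 u ∧ transp 1 s ≠ transp 1 v ∧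
      transp 1 u ≠ transp 1 v) := by decide

/-- Each fold preserves the edge with index `1` and exchanges those with indices `2` and `3`, on
which `c` agrees. -/
theorem Cross.edgeVal_eq {R : Type*} [Zero R] (h : ∀ i, N.IsLabelling i (lab i)) {c : T.Edge → R}
    (hc : ∀ i, c (N.blockEdge i (lab i) 2) = c (N.blockEdge i (lab i) 3)) {t s : Tet} {i : Fin 4} {σ : Perm (Fin 4)}
    (hx : N.Cross t i s σ) : ∀ a b, a ≠ i → b ≠ i → T.edgeVal c s (σ a) (σ b) = T.edgeVal c t a b := by
  induction hx with
  | direct t i _ => intro a b ha hb; exact T.edgeVal_adj c t ha.symm hb.symm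
  | fold t i j d s σ h1 h2 _ ih =>
    intro a b ha hb
    obtain ⟨u, hu, hu'⟩ := exists_lab_eq h h2 ha
    obtain ⟨v, hv, hv'⟩ := exists_lab_eq h h2 hb
    have h01 : (1 : Fin 4) ≠ 0 := by decide
    have e0 : transp 1 0 = 0 := by decide
    simp only [Perm.mul_apply]
    rw [← (h j).one, ← (h j).zero] at ih
    simp only [(h j).perm d h01, (h j).adj d h01, e0] at ih
    rw [← (h j).one, ← T.edgeVal_adj c t ha.symm hb.symm, hu', hv', h1, (h j).perm d h01, (h j).perm d h01,
      ih _ _ ((h j).lab_ne _ fun he => hu ((transp 1).injective (he.trans e0.symm)))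
        ((h j).lab_ne _ fun he => hv ((transp 1).injective (he.trans e0.symm)))]
    by_cases huv : u = v
    · rw [huv]; simp [edgeVal]
    obtain ⟨s, hs⟩ := third_label u v hu hv huv
    rw [(h j).edgeVal_outer c d hs, (h j).edgeVal_outer c (1 - d) (s := transp 1 s) (transp_one_third s u v hs)]
    have : ∀ s : Fin 4, s ≠ 0 → s = 1 ∨ s = 2 ∨ s = 3 := by decide
    rcases this s hs.1 with rfl | rfl | rfl
    · rw [show transp 1 1 = 1 by decide]
    · rw [show transp 1 2 = 3 by decide, hc]
    · rw [show transp 1 3 = 2 by decide, hc]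

namespace Filling
variable {Tet' : Type*} {T' : Gluing Tet'} (F : N.Filling T')

theorem emb_ne (t' : Tet') (i : Fin l) (a : Fin 2) : F.emb t' ≠ N.tet i a := (F.range_emb _).1 ⟨t', rfl⟩ i a

theorem tet_cases (t : Tet) : (∃ t', t = F.emb t') ∨ ∃ i a, t = N.tet i a := by
  by_cases h : ∃ t', F.emb t' = t
  · obtain ⟨t', rfl⟩ := h; exact Or.inl ⟨t', rfl⟩
  · right
    rw [F.range_emb] at h
    push Not at h
    exact h

/-- The tetrahedra are the remaining ones and the removed ones. -/
theorem sumElim_bijective (F : N.Filling T') (h : ∀ i, N.IsLabelling i (lab i)) :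
    Function.Bijective (Sum.elim F.emb fun x : Fin l × Fin 2 => N.tet x.1 x.2) := by
  refine ⟨?_, fun t => ?_⟩
  · refine F.emb_injective.sumElim (fun x y hxy => Prod.ext (tet_injective h hxy).1 (tet_injective h hxy).2) ?_
    exact fun t' x => F.emb_ne t' _ _
  · rcases F.tet_cases t with ⟨t', rfl⟩ | ⟨i, a, rfl⟩
    · exact ⟨Sum.inl t', rfl⟩
    · exact ⟨Sum.inr (i, a), rfl⟩

/-- Functions of the edges which are compatible with the folding are functions of the edges of the
filled triangulation. -/
theorem exists_edgeVal_eq {R : Type*} [Zero R] (h : ∀ i, N.IsLabelling i (lab i)) {c : T.Edge → R}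
    (hc : ∀ i, c (N.blockEdge i (lab i) 2) = c (N.blockEdge i (lab i) 3)) :
    ∃ c' : T'.Edge → R, ∀ t a b, T'.edgeVal c' t a b = T.edgeVal c (F.emb t) a b := by
  obtain ⟨c', hc'⟩ := T'.exists_edgeVal_eq (fun t a b => T.edgeVal c (F.emb t) a b)
    (fun t a b => T.edgeVal_comm c _ a b)
    (fun t i a b ha hb _ => (F.cross t i).edgeVal_eq h hc a b ha.symm hb.symm)
  refine ⟨c', fun t a b => ?_⟩
  by_cases hab : a = b
  · simp [edgeVal, hab]
  · exact hc' t a b hab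

/-- A nonzero value on the punctured torus of a pair is passed on through an outer face to another
removed pair. The vertices opposite to the filled cusp lie on an unfilled cusp, which meets a
remaining tetrahedron, where all values vanish. -/
theorem eq_zero_of_edgeVal_eq_zero {R : Type*} [Zero R] (h : ∀ i, N.IsLabelling i (lab i)) {c : T.Edge → R}
    (h0 : ∀ i, c (N.blockEdge i (lab i) 0) = 0) (hemb : ∀ t a b, T.edgeVal c (F.emb t) a b = 0) : c = 0 := by
  have houter : ∀ j s, s ≠ 0 → c (N.blockEdge j (lab j) s) = 0 := by
    by_contra hcon
    push Not at hcon
    obtain ⟨j0, s0, hs0, hj0⟩ := hcon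
    let Bad : Fin l → Prop := fun j => ∃ s, s ≠ 0 ∧ c (N.blockEdge j (lab j) s) ≠ 0
    -- Walking inside the class of a cusp, one never leaves the removed tetrahedra with nonzero
    -- outer values.
    let P : Tet → Fin 4 → Prop := fun t _ => ∃ j a, Bad j ∧ t = N.tet j a
    have hP : ∀ t i v, i ≠ v → P t v → P (T.adj t i) (T.perm t i v) := by
      rintro t i v - ⟨j, a, hbad, rfl⟩
      obtain ⟨s, rfl⟩ := (lab j a).surjective i
      by_cases hs : s = 0
      · subst hs
        obtain ⟨r, hr, hcr⟩ := hbad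
        obtain ⟨u, v, huv⟩ : ∃ u v, (r ≠ 0 ∧ u ≠ 0 ∧ v ≠ 0 ∧ r ≠ u ∧ r ≠ v ∧ u ≠ v) := by
          clear hcr; revert r; decide
        rw [← (h j).edgeVal_outer c a huv, ← T.edgeVal_adj c _ ((h j).lab_ne a huv.2.1.symm)
          ((h j).lab_ne a huv.2.2.1.symm)] at hcr
        rcases F.tet_cases (T.adj (N.tet j a) (lab j a 0)) with ⟨t', ht'⟩ | ⟨k, b, hkb⟩
        · rw [ht'] at hcr
          exact absurd (hemb _ _ _) hcr
        · refine ⟨k, b, ?_, hkb⟩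
          have hap := perm_apex h rfl ((h j).zero a) hkb
          obtain ⟨u', hu0, hu'⟩ := exists_lab_eq h hap ((h j).lab_ne a huv.2.1)
          obtain ⟨v', hv0, hv'⟩ := exists_lab_eq h hap ((h j).lab_ne a huv.2.2.1)
          rw [hkb, hu', hv'] at hcr
          have huv' : u' ≠ v' := by rintro rfl; simp [edgeVal] at hcr
          obtain ⟨s, hs⟩ := third_label u' v' hu0 hv0 huv'
          rw [(h k).edgeVal_outer c b hs] at hcr
          exact ⟨s, hs.1, hcr⟩
      · exact ⟨j, 1 - a, hbad, (h j).adj a hs⟩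
    have hcusp : ∀ i, T.cuspOf (N.tet j0 0) (lab j0 0 1) ≠ N.cusp i := by
      intro i hi
      obtain ⟨b, hb, hb'⟩ := (N.meets i _ _).1 hi
      obtain ⟨rfl, rfl⟩ := tet_injective h hb
      rw [← (h j0).zero] at hb'
      exact (h j0).lab_ne 0 (by decide) hb'
    obtain ⟨c', hc'⟩ := (F.range_cuspMap _).2 hcusp
    induction c' using Quot.ind with
    | mk x =>
    have e : T.cuspOf (N.tet j0 0) (lab j0 0 1) = T.cuspOf (F.emb x.1) x.2 := by
      rw [← hc', ← F.cuspMap_cuspOf]; rfl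
    obtain ⟨j, a, _, he⟩ := cuspOf_induction hP e ⟨j0, 0, ⟨s0, hs0, hj0⟩, rfl⟩
    exact F.emb_ne _ _ _ he
  funext e
  revert e
  refine T.edge_induction fun t a b hab => ?_
  rw [← T.edgeVal_of_ne c t hab]
  rcases F.tet_cases t with ⟨t', rfl⟩ | ⟨i, d, rfl⟩
  · exact hemb _ _ _
  · obtain ⟨u, rfl⟩ := (lab i d).surjective a
    obtain ⟨v, rfl⟩ := (lab i d).surjective b
    have huv : u ≠ v := fun he => hab (by rw [he])
    by_cases hu : u = 0
    · subst hu
      rw [(h i).edgeVal_apex c d huv.symm, h0]; rfl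
    by_cases hv : v = 0
    · subst hv
      rw [T.edgeVal_comm, (h i).edgeVal_apex c d hu, h0]; rfl
    obtain ⟨s, hs⟩ := third_label u v hu hv huv
    rw [(h i).edgeVal_outer c d hs, houter i s hs.1]; rfl

theorem exists_rep (E : T'.Edge) : ∃ x, T'.edgeOf x = E := Quot.exists_rep E

/-- A representative of an edge of the filled triangulation. -/
noncomputable def repEdge (E : T'.Edge) : T.Edge :=
  T.edgeOf ⟨F.emb (exists_rep E).choose.tet, (exists_rep E).choose.tail, (exists_rep E).choose.head,
    (exists_rep E).choose.ne⟩

theorem apply_repEdge {R : Type*} [Zero R] {c : T.Edge → R} {c' : T'.Edge → R}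
    (hc : ∀ t a b, T'.edgeVal c' t a b = T.edgeVal c (F.emb t) a b) (E : T'.Edge) : c (F.repEdge E) = c' E := by
  have h := hc (exists_rep E).choose.tet (exists_rep E).choose.tail (exists_rep E).choose.head
  rw [edgeVal_of_ne _ _ _ (exists_rep E).choose.ne, edgeVal_of_ne _ _ _ (exists_rep E).choose.ne] at h
  exact h.symm.trans (congrArg c' (exists_rep E).choose_spec)

/-- The coordinates of a function of the edges: the differences of its values on the edges that are
identified by the folding, its values on the removed edges, and those on the edges of the filled
triangulation. -/
noncomputable def coord (lab : Fin l → Fin 2 → Perm (Fin 4)) :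
    (T.Edge → ℚ) →ₗ[ℚ] (Fin l ⊕ Fin l ⊕ T'.Edge → ℚ) where
  toFun c := Sum.elim (fun i => c (N.blockEdge i (lab i) 2) - c (N.blockEdge i (lab i) 3))
    (Sum.elim (fun i => c (N.blockEdge i (lab i) 0)) fun E => c (F.repEdge E))
  map_add' c c' := by
    funext x
    rcases x with i | i | E <;> simp; ring
  map_smul' k c := by
    funext x
    rcases x with i | i | E <;> simp; ring

theorem card_tet [Finite Tet'] (F : N.Filling T') (h : ∀ i, N.IsLabelling i (lab i)) : Nat.card Tet = Nat.card Tet' + 2 * l := by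
  rw [← Nat.card_congr (Equiv.ofBijective _ (F.sumElim_bijective h)), Nat.card_sum, Nat.card_prod]
  simp [mul_comm]

section Finite
variable [Fintype Tet] [Fintype Tet']

/-- A function with vanishing coordinates is compatible with the folding, so it descends to the
filled triangulation, where it is zero; hence it is zero. The dimensions agree since both
triangulations have as many edges as tetrahedra. -/
theorem coord_bijective (hT : T.IsIdealTriangulation) (hT' : T'.IsIdealTriangulation)
    (h : ∀ i, N.IsLabelling i (lab i)) : Function.Bijective (F.coord lab) := by
  have := Fintype.ofFinite T.Edge
  have := Fintype.ofFinite T'.Edge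
  have hinj : Function.Injective (F.coord lab) := by
    rw [← LinearMap.ker_eq_bot, LinearMap.ker_eq_bot']
    intro c hc
    have h1 : ∀ i, c (N.blockEdge i (lab i) 2) = c (N.blockEdge i (lab i) 3) := fun i =>
      sub_eq_zero.1 (congrFun hc (Sum.inl i))
    have h2 : ∀ i, c (N.blockEdge i (lab i) 0) = 0 := fun i => congrFun hc (Sum.inr (Sum.inl i))
    obtain ⟨c', hc'⟩ := F.exists_edgeVal_eq h h1
    have h3 : c' = 0 := by
      funext E
      rw [← F.apply_repEdge hc' E]
      exact congrFun hc (Sum.inr (Sum.inr E))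
    refine F.eq_zero_of_edgeVal_eq_zero h h2 fun t a b => ?_
    rw [← hc', h3]
    simp [edgeVal]
  refine ⟨hinj, (LinearMap.injective_iff_surjective_of_finrank_eq_finrank ?_).1 hinj⟩
  have e1 := hT.card_edge
  have e2 := hT'.card_edge
  have e3 := F.card_tet h
  rw [Nat.card_eq_fintype_card (α := T.Edge)] at e1
  rw [Nat.card_eq_fintype_card (α := T'.Edge)] at e2
  rw [Module.finrank_fintype_fun_eq_card, Module.finrank_fintype_fun_eq_card, Fintype.card_sum, Fintype.card_sum,
    Fintype.card_fin]
  omega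

theorem exists_edge_function (hT : T.IsIdealTriangulation) (hT' : T'.IsIdealTriangulation)
    (h : ∀ i, N.IsLabelling i (lab i)) (d : Fin l → ℤ) (c' : T'.Edge → ℤ) :
    ∃ c : T.Edge → ℤ, (∀ i, c (N.blockEdge i (lab i) 2) = c (N.blockEdge i (lab i) 3) + d i) ∧
      (∀ i, c (N.blockEdge i (lab i) 0) = 0) ∧ ∀ E, c (F.repEdge E) = c' E := by
  obtain ⟨c, hc⟩ := (F.coord_bijective hT hT' h).2
    (Sum.elim (fun i => (d i : ℚ)) (Sum.elim 0 fun E => (c' E : ℚ)))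
  -- The prescribed values and differences are integers, so integer parts keep them.
  refine ⟨fun e => ⌊c e⌋, fun i => ?_, fun i => ?_, fun E => ?_⟩
  · change ⌊c _⌋ = ⌊c _⌋ + _
    have : c (N.blockEdge i (lab i) 2) - c (N.blockEdge i (lab i) 3) = d i := congrFun hc (Sum.inl i)
    rw [sub_eq_iff_eq_add'.1 this, Int.floor_add_intCast]
  · change ⌊c _⌋ = _
    have : c (N.blockEdge i (lab i) 0) = 0 := congrFun hc (Sum.inr (Sum.inl i))
    rw [this, Int.floor_zero]
  · change ⌊c _⌋ = _
    have : c (F.repEdge E) = c' E := congrFun hc (Sum.inr (Sum.inr E))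
    rw [this, Int.floor_intCast]

theorem exists_dual (F : N.Filling T') (hT : T.IsIdealTriangulation) (hT' : T'.IsIdealTriangulation)
    (h : ∀ i, N.IsLabelling i (lab i)) (d : Fin l → ℤ) :
    ∃ c : T.Edge → ℤ, (∀ i, c (N.blockEdge i (lab i) 2) = c (N.blockEdge i (lab i) 3) + d i) :=
  (F.exists_edge_function hT hT' h d 0).imp fun _ h => h.1

theorem exists_lift (hT : T.IsIdealTriangulation) (hT' : T'.IsIdealTriangulation)
    (h : ∀ i, N.IsLabelling i (lab i)) (c' : T'.Edge → ℤ) :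
    ∃ c : T.Edge → ℤ, (∀ i, c (N.blockEdge i (lab i) 2) = c (N.blockEdge i (lab i) 3)) ∧
      (∀ i, c (N.blockEdge i (lab i) 0) = 0) ∧ ∀ t a b, T'.edgeVal c' t a b = T.edgeVal c (F.emb t) a b := by
  obtain ⟨c, h1, h2, h3⟩ := F.exists_edge_function hT hT' h 0 c'
  have h1 : ∀ i, c (N.blockEdge i (lab i) 2) = c (N.blockEdge i (lab i) 3) := fun i => by
    rw [h1]; simp
  refine ⟨c, h1, h2, ?_⟩
  obtain ⟨c'', hc''⟩ := F.exists_edgeVal_eq h h1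
  have : c'' = c' := by
    funext E
    rw [← F.apply_repEdge hc'' E, h3]
  rwa [this] at hc''

/-- Multiplication by a compatible `c` is diagonal in the standard basis and also in the coordinates
`coord`, because it scales the difference of the values on the two identified edges by their common
factor. Comparing traces avoids any enumeration of the edge classes. -/
theorem sum_edge_eq [Fintype T.Edge] [Fintype T'.Edge] (hT : T.IsIdealTriangulation) (hT' : T'.IsIdealTriangulation)
    (h : ∀ i, N.IsLabelling i (lab i)) {c : T.Edge → ℤ} {c' : T'.Edge → ℤ}
    (hc : ∀ i, c (N.blockEdge i (lab i) 2) = c (N.blockEdge i (lab i) 3))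
    (hcc' : ∀ t a b, T'.edgeVal c' t a b = T.edgeVal c (F.emb t) a b) :
    ∑ e, c e = ∑ i, c (N.blockEdge i (lab i) 2) + ∑ i, c (N.blockEdge i (lab i) 0) + ∑ E, c' E := by
  classical
  let e := LinearEquiv.ofBijective _ (F.coord_bijective hT hT' h)
  let d : Fin l ⊕ Fin l ⊕ T'.Edge → ℚ := Sum.elim (fun i => c (N.blockEdge i (lab i) 2))
    (Sum.elim (fun i => c (N.blockEdge i (lab i) 0)) fun E => c' E)
  have h1 : e.conj (Matrix.toLin' (Matrix.diagonal fun x => (c x : ℚ))) = Matrix.toLin' (Matrix.diagonal d) := by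
    apply LinearMap.ext
    intro y
    obtain ⟨x, rfl⟩ := e.surjective y
    rw [LinearEquiv.conj_apply_apply, LinearEquiv.symm_apply_apply]
    funext k
    rw [Matrix.toLin'_apply, Matrix.toLin'_apply, Matrix.mulVec_diagonal]
    rcases k with i | i | E
    · change (Matrix.diagonal (fun x => (c x : ℚ))).mulVec x _ - (Matrix.diagonal (fun x => (c x : ℚ))).mulVec x _ = _
      rw [Matrix.mulVec_diagonal, Matrix.mulVec_diagonal, ← hc i]
      change _ = (c (N.blockEdge i (lab i) 2) : ℚ) * (x _ - x _)
      ring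
    · change (Matrix.diagonal (fun x => (c x : ℚ))).mulVec x _ = _
      rw [Matrix.mulVec_diagonal]; rfl
    · change (Matrix.diagonal (fun x => (c x : ℚ))).mulVec x _ = _
      rw [Matrix.mulVec_diagonal, F.apply_repEdge hcc']; rfl
  have h2 := LinearMap.trace_conj' (Matrix.toLin' (Matrix.diagonal fun x => (c x : ℚ))) e
  rw [h1, Matrix.trace_toLin'_eq, Matrix.trace_toLin'_eq, Matrix.trace_diagonal, Matrix.trace_diagonal] at h2
  simp only [d, Fintype.sum_sum_type, Sum.elim_inl, Sum.elim_inr] at h2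
  have h3 : ((∑ e, c e : ℤ) : ℚ) = ((∑ i, c (N.blockEdge i (lab i) 2) + ∑ i, c (N.blockEdge i (lab i) 0) + ∑ E, c' E : ℤ) : ℚ) := by
    push_cast
    rw [← h2]; ring
  exact_mod_cast h3

end Finite
end Filling
end NiceCusps
end Gluing

/-! ## Curves given by lists of arcs -/

/-- An arc of a curve (see `CuspPath`) together with the positions of its end points, in sixths of
the side, measured from the left end point of the side. -/
structure Arc (Tet : Type*) where
  tet : Tet
  flag : Perm (Fin 4)
  entry : ℕ
  exit : ℕ

/-- The distance, along side `s`, of an arc from the corner which it cuts off. -/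
def arcOffset (σ : Perm (Fin 4)) (x y : ℕ) (s : Fin 4) : ℕ :=
  if Perm.sign σ = 1 then (if s = σ 2 then y else x) else 6 - (if s = σ 2 then y else x)

namespace Arc
variable {Tet : Type*}

/-- The arc `a` is continued by `b`. -/
def Next (T : Gluing Tet) (a b : Arc Tet) : Prop :=
  b.tet = T.adj a.tet (a.flag 2) ∧ b.flag 0 = T.perm a.tet (a.flag 2) (a.flag 0) ∧
    b.flag 3 = T.perm a.tet (a.flag 2) (a.flag 2) ∧ b.entry = a.exit

/-- Arcs which, if they lie in the same triangle, cut off different corners and do not meet. -/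
def Disjoint (a b : Arc Tet) : Prop :=
  a.tet = b.tet → a.flag 0 = b.flag 0 → a.flag 1 ≠ b.flag 1 ∧
    ∀ s, s ≠ a.flag 0 → s ≠ a.flag 1 → s ≠ b.flag 1 →
      arcOffset a.flag a.entry a.exit s + arcOffset b.flag b.entry b.exit s < 6

theorem Disjoint.symm {a b : Arc Tet} (h : a.Disjoint b) : b.Disjoint a := by
  intro h1 h2
  obtain ⟨h3, h4⟩ := h h1.symm h2.symm
  refine ⟨h3.symm, fun s s0 s1 s2 => ?_⟩
  rw [add_comm]
  exact h4 s (h2 ▸ s0) s2 s1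

/-- The contribution of an arc to the pairing of a curve with a weight. -/
def weight (w : Tet → Fin 3 → ℤ) (a : Arc Tet) : ℤ :=
  ((Perm.sign a.flag : ℤˣ) : ℤ) * w a.tet (quad (a.flag 0) (a.flag 1))

open Classical in
/-- The contribution of an arc to a crossing number. -/
noncomputable def cross (t : Tet) (v j : Fin 4) (a : Arc Tet) : ℤ :=
  (if a.tet = t ∧ a.flag 0 = v ∧ a.flag 2 = j then 1 else 0)
    - (if a.tet = t ∧ a.flag 0 = v ∧ a.flag 3 = j then 1 else 0)

end Arc

namespace CuspPath
variable {Tet : Type*}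

/-- The closed path formed by a nonempty list of arcs. -/
def ofArcs (b : Arc Tet) (L : List (Arc Tet)) : CuspPath Tet where
  len := L.length
  tet k := ((b :: L)[k.1]'k.2).tet
  flag k := ((b :: L)[k.1]'k.2).flag

variable {b : Arc Tet} {L : List (Arc Tet)}

theorem getElem_add_one (k : Fin (L.length + 1)) :
    (b :: L)[(k + 1 : Fin (L.length + 1)).1]'(k + 1 : Fin (L.length + 1)).2 =
      (b :: L ++ [b])[k.1 + 1]'(by simp; omega) := by
  by_cases hk : k = Fin.last _
  · subst hk
    simp
  · have : k.1 < L.length := by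
      have := k.2
      have : k.1 ≠ L.length := fun h => hk (Fin.ext h)
      omega
    have e : (k + 1 : Fin (L.length + 1)).1 = k.1 + 1 := by
      rw [Fin.val_add_one, if_neg hk]
    simp only [e]
    rw [List.getElem_append_left]

theorem next_ofArcs {T : Gluing Tet} (h : (b :: L ++ [b]).IsChain (Arc.Next T)) (k : Fin (L.length + 1)) :
    Arc.Next T ((b :: L)[k.1]'k.2)
      ((b :: L)[(k + 1 : Fin (L.length + 1)).1]'(k + 1 : Fin (L.length + 1)).2) := by
  have := List.isChain_iff_getElem.1 h k.1 (by simp; omega)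
  rw [getElem_add_one]
  rwa [List.getElem_append_left k.2] at this

theorem isCurve_ofArcs {T : Gluing Tet} (h : (b :: L ++ [b]).IsChain (Arc.Next T)) :
    T.IsCurve (ofArcs b L) := fun k =>
  have := next_ofArcs h k
  ⟨this.1, this.2.1, this.2.2.1⟩

theorem isSimple_ofArcs {T : Gluing Tet} (h : (b :: L ++ [b]).IsChain (Arc.Next T))
    (hd : (b :: L).Pairwise Arc.Disjoint) (hpos : ∀ a ∈ b :: L, 0 < a.exit ∧ a.exit < 6) :
    (ofArcs b L).IsSimple := by
  let A : Fin (L.length + 1) → Arc Tet := fun k => (b :: L)[k.1]'k.2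
  have hA : ∀ k, 0 < (A k).exit ∧ (A k).exit < 6 := fun k => hpos _ (List.getElem_mem _)
  have hentry : ∀ k, ((A k).entry : ℝ) = (A (k - 1)).exit := fun k => by
    have := (next_ofArcs h (k - 1)).2.2.2
    simp only [sub_add_cancel] at this
    exact_mod_cast this
  have hentry' : ∀ k, (A k).entry < 6 := fun k => by
    have h1 := (hA (k - 1)).2
    have h2 : (A k).entry = (A (k - 1)).exit := by exact_mod_cast hentry k
    omega
  have hoff : ∀ (k : Fin (L.length + 1)) s, (ofArcs b L).offset (fun k => ((A k).exit : ℝ) / 6) k s =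
      (arcOffset (A k).flag (A k).entry (A k).exit s : ℝ) / 6 := by
    intro k s
    have h1 := (hA k).2.le
    have h2 := (hentry' k).le
    have h3 : ((A (k - 1)).exit : ℝ) / 6 = (A k).entry / 6 := congrArg (· / 6) (hentry k).symm
    change (if Perm.sign (A k).flag = 1 then
      (if s = (A k).flag 2 then ((A k).exit : ℝ) / 6 else ((A (k - 1)).exit : ℝ) / 6) else
      1 - (if s = (A k).flag 2 then ((A k).exit : ℝ) / 6 else ((A (k - 1)).exit : ℝ) / 6)) = _
    unfold arcOffset
    rw [h3]
    split_ifs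
    · rfl
    · rfl
    · rw [Nat.cast_sub h1]; push_cast; ring
    · rw [Nat.cast_sub h2]; push_cast; ring
  refine ⟨fun k => ((A k).exit : ℝ) / 6, fun k => ?_, fun k k' hk ht hv => ?_⟩
  · have h1 := hA k
    have h2 : (0 : ℝ) < (A k).exit := by exact_mod_cast h1.1
    have h3 : ((A k).exit : ℝ) < 6 := by exact_mod_cast h1.2
    constructor
    · positivity
    · linarith
  · have hdis : (A k).Disjoint (A k') := by
      rw [List.pairwise_iff_getElem] at hd
      rcases lt_trichotomy k k' with h | h | h
      · exact hd _ _ k.2 k'.2 h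
      · exact absurd h hk
      · exact (hd _ _ k'.2 k.2 h).symm
    obtain ⟨h1, h2⟩ := hdis ht hv
    refine ⟨fun h3 => absurd h3 h1, fun _ s s0 s1 s2 => ?_⟩
    refine lt_of_eq_of_lt (congrArg₂ (· + ·) (hoff k s) (hoff k' s)) ?_
    have := h2 s s0 s1 s2
    have : (arcOffset (A k).flag (A k).entry (A k).exit s : ℝ) +
      arcOffset (A k').flag (A k').entry (A k').exit s < 6 := by exact_mod_cast this
    linarith

theorem pairing_ofArcs [Fintype Tet] (w : Tet → Fin 3 → ℤ) :
    pairing (ofArcs b L).row w = ((b :: L).map (Arc.weight w)).sum := by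
  rw [pairing_row, ← Fin.sum_univ_fun_getElem]
  rfl

theorem crossing_ofArcs (t : Tet) (v j : Fin 4) :
    (ofArcs b L).crossing t v j = ((b :: L).map (Arc.cross t v j)).sum := by
  rw [crossing, ← Fin.sum_univ_fun_getElem]
  rfl

end CuspPath

theorem List.isChain_flatMap_range {α : Type*} {R : α → α → Prop} (g : ℕ → α) (f : ℕ → List α)
    (h : ∀ k, List.IsChain R (g k :: f k ++ [g (k + 1)])) (n : ℕ) :
    List.IsChain R ((List.range n).flatMap (fun k => g k :: f k) ++ [g n]) := by
  induction n with
  | zero => simp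
  | succ n ih =>
    rw [List.range_succ, List.flatMap_append, List.append_assoc]
    have h1 : List.IsChain R ([g n] ++ (f n ++ [g (n + 1)])) := by simpa using h n
    have := List.IsChain.append_overlap ih h1 (by simp)
    simpa using this

/-! ## The arcs through a removed pair of tetrahedra -/

/-- A permutation given with its inverse. -/
def permOf (f g : Fin 4 → Fin 4) (h : ∀ i, g (f i) = i ∧ f (g i) = i) : Perm (Fin 4) :=
  ⟨f, g, fun i => (h i).1, fun i => (h i).2⟩

/-- The arcs (as index of the tetrahedron relative to the one that is entered, flag in terms of the
labels, and positions) by which a curve entering the triangle at the vertex labelled `r` through the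
outer face passes to the outer face of the other tetrahedron. -/
def strand : Fin 4 → List (Fin 2 × Perm (Fin 4) × ℕ × ℕ) :=
  ![[],
    [(0, permOf ![1, 3, 2, 0] ![3, 0, 2, 1] (by decide), 3, 3),
      (1, permOf ![3, 0, 1, 2] ![1, 2, 3, 0] (by decide), 3, 4),
      (0, permOf ![2, 0, 3, 1] ![1, 3, 0, 2] (by decide), 4, 3),
      (1, permOf ![1, 2, 0, 3] ![2, 0, 1, 3] (by decide), 3, 3)],
    [(0, permOf ![2, 3, 1, 0] ![3, 2, 0, 1] (by decide), 3, 4),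
      (1, permOf ![3, 2, 0, 1] ![2, 3, 1, 0] (by decide), 4, 3)],
    [(0, permOf ![3, 2, 1, 0] ![3, 2, 1, 0] (by decide), 3, 2),
      (1, permOf ![2, 3, 0, 1] ![2, 3, 0, 1] (by decide), 2, 3)]]

/-- Two entries of `strand` are disjoint if they lie in the same triangle. -/
def StrandDisjoint (E E' : Perm (Fin 4) × ℕ × ℕ) : Prop :=
  E.1 0 = E'.1 0 → E.1 1 ≠ E'.1 1 ∧ ∀ s, (s ≠ E.1 0 ∧ s ≠ E.1 1 ∧ s ≠ E'.1 1) →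
    arcOffset E.1 E.2.1 E.2.2 s + arcOffset E'.1 E'.2.1 E'.2.2 s < 6

instance : DecidableRel StrandDisjoint := fun E E' => by unfold StrandDisjoint; infer_instance

-- The positions in sixths are chosen so that all strands through one pair can be drawn
-- simultaneously. The exceptions are a strand with itself and with the one that traverses the same
-- passage backwards.
set_option maxRecDepth 4000 in
theorem strand_disjoint : ∀ r r' : Fin 4, ∀ a a' : Fin 2,
    (r ≠ 0 ∧ r' ≠ 0 ∧ ¬ (a = a' ∧ r = r') ∧ ¬ (a' = 1 - a ∧ r' = transp 1 r)) →
    ∀ E ∈ strand r, ∀ E' ∈ strand r', a + E.1 = a' + E'.1 → StrandDisjoint E.2 E'.2 := by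
  decide

theorem strand_disjoint_self : ∀ r, (strand r).Pairwise fun E E' => E.1 = E'.1 → E.2.1 0 ≠ E'.2.1 0 := by
  decide

theorem strand_pos : ∀ r, ∀ E ∈ strand r, 0 < E.2.2.2 ∧ E.2.2.2 < 6 := by decide

/-- Consecutive entries of `strand`. -/
def StrandNext (E E' : Fin 2 × Perm (Fin 4) × ℕ × ℕ) : Prop :=
  E'.1 = 1 - E.1 ∧ E.2.1 2 ≠ 0 ∧ E'.2.1 0 = transp (E.2.1 2) (E.2.1 0) ∧
    E'.2.1 3 = transp (E.2.1 2) (E.2.1 2) ∧ E'.2.2.1 = E.2.2.2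

instance : DecidableRel StrandNext := fun E E' => by unfold StrandNext; infer_instance

theorem strand_spec : ∀ r : Fin 4, r ≠ 0 → (strand r).IsChain StrandNext ∧
    (∃ E ∈ (strand r).head?, E.1 = 0 ∧ E.2.1 0 = r ∧ E.2.1 3 = 0 ∧ E.2.2.1 = 3) ∧
    (∃ E ∈ (strand r).getLast?, E.1 = 1 ∧ E.2.1 0 = transp 1 r ∧ E.2.1 2 = 0 ∧ E.2.2.2 = 3) := by
  have h : ∀ r : Fin 4, r ≠ 0 → (strand r).IsChain StrandNext ∧
    (∀ h : strand r ≠ [], (((strand r).head h).1 = 0 ∧ ((strand r).head h).2.1 0 = r ∧ ((strand r).head h).2.1 3 = 0 ∧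
      ((strand r).head h).2.2.1 = 3) ∧
    (((strand r).getLast h).1 = 1 ∧ ((strand r).getLast h).2.1 0 = transp 1 r ∧ ((strand r).getLast h).2.1 2 = 0 ∧
      ((strand r).getLast h).2.2.2 = 3)) := by decide
  have h0 : ∀ r : Fin 4, r ≠ 0 → strand r ≠ [] := by decide
  intro r hr
  obtain ⟨h1, h2⟩ := h r hr
  exact ⟨h1, ⟨_, List.head?_eq_some_head (h0 r hr), (h2 (h0 r hr)).1⟩, ⟨_, List.getLast?_eq_some_getLast (h0 r hr), (h2 (h0 r hr)).2⟩⟩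

/-! ### Itineraries through consecutive removed pairs -/

namespace Gluing

/-- A side of a triangle of the boundary surface, given by the tetrahedron, the vertex and the face. -/
abbrev Side (Tet : Type*) := Tet × Fin 4 × Fin 4

/-- The side to which a side is glued. -/
def flip {Tet : Type*} (T : Gluing Tet) (d : Side Tet) : Side Tet :=
  (T.adj d.1 d.2.2, T.perm d.1 d.2.2 d.2.1, T.perm d.1 d.2.2 d.2.2)

theorem flip_flip {Tet : Type*} (T : Gluing Tet) (d : Side Tet) : T.flip (T.flip d) = d := by
  simp only [flip, T.adj_adj, T.perm_inv_self]

namespace NiceCusps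
variable {Tet : Type*} {T : Gluing Tet} {l : ℕ} {N : T.NiceCusps l} {lab : Fin l → Fin 2 → Perm (Fin 4)}

/-- The arcs of `strand r` in the pair of tetrahedra `i`, entered at tetrahedron `a`. -/
def strandArcs (N : T.NiceCusps l) (lab : Fin l → Fin 2 → Perm (Fin 4)) (x : Fin l × Fin 2 × Fin 4) : List (Arc Tet) :=
  (strand x.2.2).map fun E => ⟨N.tet x.1 (x.2.1 + E.1), lab x.1 (x.2.1 + E.1) * E.2.1, E.2.2.1, E.2.2.2⟩

/-- The outer side at the vertex labelled `r` of the tetrahedron `a` of the pair `i`. -/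
def outer (N : T.NiceCusps l) (lab : Fin l → Fin 2 → Perm (Fin 4)) (x : Fin l × Fin 2 × Fin 4) : Side Tet :=
  (N.tet x.1 x.2.1, lab x.1 x.2.1 x.2.2, lab x.1 x.2.1 0)

/-- The outer side to which an outer side is joined by the folding. -/
def opposite (x : Fin l × Fin 2 × Fin 4) : Fin l × Fin 2 × Fin 4 := (x.1, 1 - x.2.1, transp 1 x.2.2)

theorem opposite_opposite (x : Fin l × Fin 2 × Fin 4) : opposite (opposite x) = x := by
  have h1 : ∀ a : Fin 2, 1 - (1 - a) = a := by decide
  have h2 : ∀ r : Fin 4, transp 1 (transp 1 r) = r := by decide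
  simp only [opposite, h1, h2]

theorem opposite_ne_zero {x : Fin l × Fin 2 × Fin 4} (h : x.2.2 ≠ 0) : (opposite x).2.2 ≠ 0 := by
  have h2 : ∀ r : Fin 4, r ≠ 0 → transp 1 r ≠ 0 := by decide
  exact h2 _ h

theorem outer_injective (h : ∀ i, N.IsLabelling i (lab i)) : Function.Injective (N.outer lab) := by
  rintro ⟨i, a, r⟩ ⟨i', a', r'⟩ he
  simp only [outer, Prod.mk.injEq] at he
  obtain ⟨rfl, rfl⟩ := tet_injective h he.1
  rw [(lab i a).injective he.2.1]

theorem exists_strandArcs_eq (h : ∀ i, N.IsLabelling i (lab i)) {x : Fin l × Fin 2 × Fin 4} (hx : x.2.2 ≠ 0) :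
    ∃ X m, N.strandArcs lab x = X ++ [m] ∧ (m.tet, m.flag 0, m.flag 2) = N.outer lab (opposite x) ∧ m.exit = 3 ∧
      ∀ g : Arc Tet, T.flip (g.tet, g.flag 0, g.flag 2) = N.outer lab x → g.exit = 3 →
        (g :: (X ++ [m])).IsChain (Arc.Next T) := by
  obtain ⟨i, a, r⟩ := x
  obtain ⟨h1, ⟨E, hE, hE0, hE1, hE2, hE3⟩, ⟨E', hE', hE0', hE1', hE2', hE3'⟩⟩ := strand_spec r hx
  have h01 : ∀ a b : Fin 2, 1 - (a + b) = a + (1 - b) := by decide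
  have e1 : ∀ a : Fin 2, a + 1 = 1 - a := by decide
  have hch : (N.strandArcs lab (i, a, r)).IsChain (Arc.Next T) := by
    unfold strandArcs
    rw [List.isChain_map]
    refine h1.imp ?_
    rintro F F' ⟨k1, k2, k3, k4, k5⟩
    simp only [Arc.Next, Perm.mul_apply, (h i).adj _ k2, (h i).perm _ k2, h01, k1, k3, k4, k5, and_self]
  have hlast : (N.strandArcs lab (i, a, r)).getLast? = some ⟨N.tet i (a + E'.1), lab i (a + E'.1) * E'.2.1, E'.2.2.1, E'.2.2.2⟩ := by
    simp only [strandArcs, List.getLast?_map, Option.mem_def.1 hE', Option.map_some]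
  have hhead : (N.strandArcs lab (i, a, r)).head? = some ⟨N.tet i (a + E.1), lab i (a + E.1) * E.2.1, E.2.2.1, E.2.2.2⟩ := by
    simp only [strandArcs, List.head?_map, Option.mem_def.1 hE, Option.map_some]
  obtain ⟨X, hX⟩ := List.getLast?_eq_some_iff.1 hlast
  refine ⟨X, _, hX, ?_, hE3', fun g hg hg3 => ?_⟩
  · simp only [outer, opposite, Perm.mul_apply, hE0', hE1', hE2', e1]
  · rw [← hX]
    refine List.IsChain.cons hch ?_
    intro b hb
    rw [hhead, Option.mem_some_iff] at hb
    subst hb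
    simp only [flip, outer, Prod.mk.injEq] at hg
    simp only [Arc.Next, Perm.mul_apply, hE0, hE1, hE2, hE3, add_zero, hg, hg3, and_self]

/-- A curve that arrives at the side `d` passes through the outer sides in the list, and arrives at the
side `e` of a remaining tetrahedron. -/
inductive Arrives (N : T.NiceCusps l) (lab : Fin l → Fin 2 → Perm (Fin 4)) :
    Side Tet → List (Fin l × Fin 2 × Fin 4) → Side Tet → Prop
  | last (d : Side Tet) (h : ∀ i a, d.1 ≠ N.tet i a) : Arrives N lab d [] d
  | pass (x : Fin l × Fin 2 × Fin 4) (hx : x.2.2 ≠ 0) (P : List (Fin l × Fin 2 × Fin 4)) (e : Side Tet)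
      (h : Arrives N lab (T.flip (N.outer lab (opposite x))) P e) : Arrives N lab (N.outer lab x) (x :: P) e

theorem Arrives.isChain (h : ∀ i, N.IsLabelling i (lab i)) {d e : Side Tet} {P : List (Fin l × Fin 2 × Fin 4)}
    (hP : N.Arrives lab d P e) : ∀ g g' : Arc Tet, T.flip (g.tet, g.flag 0, g.flag 2) = d → g.exit = 3 →
      (g'.tet, g'.flag 0, g'.flag 3) = e → g'.entry = 3 →
      (g :: P.flatMap (N.strandArcs lab) ++ [g']).IsChain (Arc.Next T) := by
  induction hP with
  | last d _ =>
    rintro g g' rfl hg he hg'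
    simp only [flip, Prod.mk.injEq] at he
    simp only [List.flatMap_nil, List.cons_append, List.nil_append, List.isChain_cons_cons, List.isChain_singleton, and_true]
    exact ⟨he.1, he.2.1, he.2.2, by rw [hg, hg']⟩
  | pass x hx P e _ ih =>
    intro g g' hg hg3 he hg'
    obtain ⟨X, m, hX, hm, hm3, hch⟩ := exists_strandArcs_eq h hx
    have h1 := ih m g' (by rw [hm]) hm3 he hg'
    have h2 := hch g hg hg3
    have := List.IsChain.append_overlap (l₁ := g :: X) (l₂ := [m]) (by simpa using h2) (by simpa using h1) (by simp)
    rw [List.flatMap_cons, hX]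
    simpa using this

/-- The passage is deterministic: a side lies on a remaining tetrahedron or is the outer side of
exactly one triple. -/
theorem Arrives.unique (h : ∀ i, N.IsLabelling i (lab i)) {d e e' : Side Tet} {P P' : List (Fin l × Fin 2 × Fin 4)}
    (hP : N.Arrives lab d P e) (hP' : N.Arrives lab d P' e') : P = P' ∧ e = e' := by
  induction hP generalizing P' with
  | last d hd =>
    cases hP' with
    | last => exact ⟨rfl, rfl⟩
    | pass x _ => exact absurd rfl (hd x.1 x.2.1)
  | pass x hx P e _ ih =>
    generalize hy : N.outer lab x = y at hP'
    cases hP' with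
    | last _ hd => exact absurd (congrArg Prod.fst hy).symm (hd x.1 x.2.1)
    | pass x' _ P' _ hP' =>
      obtain rfl := outer_injective h hy
      obtain ⟨rfl, rfl⟩ := ih hP'
      exact ⟨rfl, rfl⟩

theorem Arrives.ne_zero {d e : Side Tet} {P : List (Fin l × Fin 2 × Fin 4)}
    (hP : N.Arrives lab d P e) : ∀ x ∈ P, x.2.2 ≠ 0 := by
  induction hP with
  | last => simp
  | pass x hx P e _ ih => exact List.forall_mem_cons.2 ⟨hx, ih⟩

theorem Arrives.tail {d e : Side Tet} {P : List (Fin l × Fin 2 × Fin 4)} (hP : N.Arrives lab d P e)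
    {x : Fin l × Fin 2 × Fin 4} (hx : x ∈ P) :
    ∃ Q, Q.length < P.length ∧ N.Arrives lab (T.flip (N.outer lab (opposite x))) Q e := by
  induction hP with
  | last => simp at hx
  | pass y hy P e h ih =>
    rcases List.mem_cons.1 hx with rfl | hx
    · exact ⟨P, by simp, h⟩
    · obtain ⟨Q, hQ, hQ'⟩ := ih hx
      exact ⟨Q, by simp; omega, hQ'⟩

theorem Arrives.eq_of_mem (h : ∀ i, N.IsLabelling i (lab i)) {d d' e e' : Side Tet} {P P' : List (Fin l × Fin 2 × Fin 4)}
    (hP : N.Arrives lab d P e) (hP' : N.Arrives lab d' P' e') {x : Fin l × Fin 2 × Fin 4} (hx : x ∈ P) (hx' : x ∈ P') : e = e' := by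
  obtain ⟨Q, _, hQ⟩ := hP.tail hx
  obtain ⟨Q', _, hQ'⟩ := hP'.tail hx'
  exact (hQ.unique h hQ').2

/-- A repetition would give two continuations of different lengths from the same side. -/
theorem Arrives.nodup (h : ∀ i, N.IsLabelling i (lab i)) {d e : Side Tet} {P : List (Fin l × Fin 2 × Fin 4)}
    (hP : N.Arrives lab d P e) : P.Nodup := by
  induction hP with
  | last => simp
  | pass x hx P e hP ih =>
    refine List.nodup_cons.2 ⟨fun hm => ?_, ih⟩
    obtain ⟨Q, hQ, hQ'⟩ := hP.tail hm
    rw [(hQ'.unique h hP).1] at hQ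
    omega

/-- The passage can be run backwards through the opposite outer sides; the tail `Q` makes the
induction work. -/
theorem Arrives.reverse {d e f : Side Tet} {P Q : List (Fin l × Fin 2 × Fin 4)}
    (hP : N.Arrives lab d P e) (hQ : N.Arrives lab (T.flip d) Q f) :
    N.Arrives lab (T.flip e) ((P.map opposite).reverse ++ Q) f := by
  induction hP generalizing Q with
  | last => simpa
  | pass x hx P e _ ih =>
    have := ih (Q := opposite x :: Q) (by
      rw [flip_flip]
      refine .pass (opposite x) (opposite_ne_zero hx) _ _ ?_
      rwa [opposite_opposite])
    simpa using this

theorem Cross.arrives (h : ∀ i, N.IsLabelling i (lab i)) {t s : Tet} {i : Fin 4} {σ : Perm (Fin 4)}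
    (hx : N.Cross t i s σ) : ∀ v, v ≠ i → ∃ P, N.Arrives lab (T.flip (t, v, i)) P (s, σ v, σ i) := by
  induction hx with
  | direct t i hd => exact fun v _ => ⟨[], .last _ hd⟩
  | fold t i j a s σ h1 h2 _ ih =>
    intro v hv
    obtain ⟨r, hr, hr'⟩ := exists_lab_eq h h2 hv
    have h01 : (1 : Fin 4) ≠ 0 := by decide
    have e0 : transp 1 0 = 0 := by decide
    rw [← (h j).one, ← (h j).zero] at ih
    simp only [(h j).perm a h01, (h j).adj a h01, e0] at ih
    obtain ⟨P, hP⟩ := ih (lab j (1 - a) (transp 1 r))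
      ((h j).lab_ne _ fun he => hr ((transp 1).injective (he.trans e0.symm)))
    refine ⟨(j, a, r) :: P, ?_⟩
    have := Arrives.pass (N := N) (lab := lab) (j, a, r) hr P _ hP
    convert this using 1
    · simp only [flip, outer, h1, h2, hr', (h j).zero]
    · simp only [Perm.mul_apply, h2, hr', ← (h j).one, ← (h j).zero, (h j).perm a h01, e0]

end NiceCusps
end Gluing

theorem List.sum_map_flatMap_range {α : Type*} (φ : α → ℤ) (f : ℕ → List α) (n : ℕ) :
    (((List.range n).flatMap f).map φ).sum = ∑ k ∈ Finset.range n, ((f k).map φ).sum := by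
  induction n with
  | zero => simp
  | succ n ih => rw [List.range_succ, Finset.sum_range_succ, ← ih]; simp

theorem List.sum_map_flatMap_eq_zero {α β : Type*} {φ : β → ℤ} {f : α → List β} {l : List α}
    (h : ∀ x ∈ l, ((f x).map φ).sum = 0) : ((l.flatMap f).map φ).sum = 0 := by
  induction l with
  | nil => simp
  | cons a l ih =>
    rw [List.forall_mem_cons] at h
    rw [List.flatMap_cons, List.map_append, List.sum_append, h.1, ih h.2, add_zero]

/-- The contribution of an entry of `strand` to the crossing number of the outer side at the vertex `s`
of the tetrahedron `b`. -/
def strandCross (a b : Fin 2) (s : Fin 4) (E : Fin 2 × Perm (Fin 4) × ℕ × ℕ) : ℤ :=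
  (if a + E.1 = b ∧ E.2.1 0 = s ∧ E.2.1 2 = 0 then 1 else 0) -
    (if a + E.1 = b ∧ E.2.1 0 = s ∧ E.2.1 3 = 0 then 1 else 0)

/-- A strand enters through one outer side and leaves through the opposite one, so its crossing
numbers with these two sides cancel. -/
theorem strandCross_sum : ∀ (a b : Fin 2) (r s : Fin 4),
    ((strand r).map (strandCross a b s)).sum + ((strand r).map (strandCross a (1 - b) (transp 1 s))).sum = 0 := by
  decide

/-! ### Pushing curves of the filled triangulation into the original one -/

namespace Gluing.NiceCusps
variable {Tet : Type*} {T : Gluing Tet} {l : ℕ} {N : T.NiceCusps l} {lab : Fin l → Fin 2 → Perm (Fin 4)}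

theorem tet_of_mem_strandArcs {x : Fin l × Fin 2 × Fin 4} {b : Arc Tet} (hb : b ∈ N.strandArcs lab x) :
    ∃ c, b.tet = N.tet x.1 c := by
  obtain ⟨E, _, rfl⟩ := List.mem_map.1 hb
  exact ⟨_, rfl⟩

theorem StrandDisjoint.mul {E E' : Perm (Fin 4) × ℕ × ℕ} (hE : StrandDisjoint E E') {π : Perm (Fin 4)}
    (hπ : Perm.sign π = 1) (t t' : Tet) : Arc.Disjoint ⟨t, π * E.1, E.2.1, E.2.2⟩ ⟨t', π * E'.1, E'.2.1, E'.2.2⟩ := by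
  have hoff : ∀ (σ : Perm (Fin 4)) x y s, arcOffset (π * σ) x y (π s) = arcOffset σ x y s := by
    intro σ x y s
    simp only [arcOffset, Perm.sign_mul, hπ, one_mul, Perm.mul_apply, π.injective.eq_iff]
  intro _ h0
  simp only [Perm.mul_apply, π.injective.eq_iff, ne_eq] at h0 ⊢
  obtain ⟨h1, h2⟩ := hE h0
  refine ⟨h1, fun s s0 s1 s2 => ?_⟩
  obtain ⟨s, rfl⟩ := π.surjective s
  rw [hoff, hoff]
  exact h2 s ⟨fun h => s0 (by rw [h]), fun h => s1 (by rw [h]), fun h => s2 (by rw [h])⟩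

theorem disjoint_strandArcs (h : ∀ i, N.IsLabelling i (lab i)) {x y : Fin l × Fin 2 × Fin 4} (hx : x.2.2 ≠ 0) (hy : y.2.2 ≠ 0)
    (hxy : x ≠ y) (hxy' : y ≠ opposite x) : ∀ a ∈ N.strandArcs lab x, ∀ b ∈ N.strandArcs lab y, a.Disjoint b := by
  obtain ⟨i, a, r⟩ := x
  obtain ⟨j, a', r'⟩ := y
  intro u hu v hv
  obtain ⟨E, hE, rfl⟩ := List.mem_map.1 hu
  obtain ⟨E', hE', rfl⟩ := List.mem_map.1 hv
  intro ht
  obtain ⟨rfl, hc⟩ := tet_injective h ht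
  have := strand_disjoint r r' a a' ⟨hx, hy, fun hh => hxy (by rw [hh.1, hh.2]), fun hh => hxy' (by
    rw [opposite, hh.1, hh.2])⟩ E hE E' hE' hc
  have h2 := StrandDisjoint.mul this ((h i).even (a + E.1)) (N.tet i (a + E.1)) (N.tet i (a' + E'.1))
  simp only [← hc] at h2 ⊢
  exact h2 rfl

theorem pairwise_disjoint_strandArcs (h : ∀ i, N.IsLabelling i (lab i)) (x : Fin l × Fin 2 × Fin 4) :
    (N.strandArcs lab x).Pairwise Arc.Disjoint := by
  unfold strandArcs
  rw [List.pairwise_map]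
  refine (strand_disjoint_self x.2.2).imp ?_
  intro E E' hE ht h0
  exfalso
  have hc := add_left_cancel (tet_injective h ht).2
  simp only [Perm.mul_apply, hc] at h0
  exact hE hc ((lab _ _).injective h0)

theorem sum_cross_strandArcs (h : ∀ i, N.IsLabelling i (lab i)) (x : Fin l × Fin 2 × Fin 4) (i : Fin l) (b : Fin 2) (s : Fin 4) :
    ((N.strandArcs lab x).map (Arc.cross (N.tet i b) (lab i b s) (lab i b 0))).sum +
      ((N.strandArcs lab x).map (Arc.cross (N.tet i (1 - b)) (lab i (1 - b) (transp 1 s)) (lab i (1 - b) 0))).sum = 0 := by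
  obtain ⟨j, a, r⟩ := x
  by_cases hij : j = i
  · subst hij
    have key : ∀ b s, (N.strandArcs lab (j, a, r)).map (Arc.cross (N.tet j b) (lab j b s) (lab j b 0)) =
        (strand r).map (strandCross a b s) := by
      intro b s
      unfold strandArcs
      rw [List.map_map]
      refine List.map_congr_left fun E _ => ?_
      simp only [Function.comp, Arc.cross, strandCross, Perm.mul_apply]
      by_cases hb : a + E.1 = b
      · subst hb
        simp only [(lab j (a + E.1)).injective.eq_iff, true_and]
      · have : N.tet j (a + E.1) ≠ N.tet j b := fun he => hb (tet_injective h he).2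
        simp only [this, hb, false_and, if_false]
    rw [key, key]
    exact strandCross_sum a b r s
  · have key : ∀ b v f, ((N.strandArcs lab (j, a, r)).map (Arc.cross (N.tet i b) v f)).sum = 0 := by
      intro b v f
      refine List.sum_eq_zero fun y hy => ?_
      obtain ⟨u, hu, rfl⟩ := List.mem_map.1 hy
      obtain ⟨c, hc⟩ := tet_of_mem_strandArcs hu
      have : u.tet ≠ N.tet i b := fun he => hij (tet_injective h (hc.symm.trans he)).1
      simp only [Arc.cross, this, false_and, if_false, sub_zero]
    rw [key, key, add_zero]

/-- Compatible functions of the corners of the boundary surface which take equal values on corners that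
are identified by the folding, if the crossing numbers of which they are a potential agree. -/
theorem corner_eq_of_crossing (i : Fin l) {lab : Fin 2 → Perm (Fin 4)} (h : N.IsLabelling i lab) {M : Tet → Fin 4 → Fin 4 → ℤ}
    (hM : ∀ t i a b, i ≠ a → i ≠ b → a ≠ b → M (T.adj t i) (T.perm t i a) (T.perm t i b) = M t a b)
    {x : Tet → Fin 4 → Fin 4 → ℤ}
    (hx : ∀ t (π : Perm (Fin 4)), Perm.sign π = 1 → x t (π 0) (π 2) = M t (π 0) (π 1) - M t (π 0) (π 3))
    (h0 : ∀ b s, s ≠ 0 → x (N.tet i b) (lab b s) (lab b 0) + x (N.tet i (1 - b)) (lab (1 - b) (transp 1 s)) (lab (1 - b) 0) = 0)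
    (a : Fin 2) {r s : Fin 4} (hr : r ≠ 0) (hs : s ≠ 0) (hrs : r ≠ s) :
    M (N.tet i (1 - a)) (lab (1 - a) (transp 1 r)) (lab (1 - a) (transp 1 s)) = M (N.tet i a) (lab a r) (lab a s) := by
  have step : ∀ a q r s, (q ≠ 0 ∧ q ≠ r ∧ q ≠ s ∧ r ≠ s) → M (N.tet i (1 - a)) (lab (1 - a) (transp q r)) (lab (1 - a) (transp q s)) =
      M (N.tet i a) (lab a r) (lab a s) := by
    intro a q r s hq
    rw [← h.adj a hq.1, ← h.perm a hq.1, ← h.perm a hq.1, hM _ _ _ _ (h.lab_ne a hq.2.1) (h.lab_ne a hq.2.2.1) (h.lab_ne a hq.2.2.2)]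
  have hx' : ∀ a (π : Perm (Fin 4)), Perm.sign π = 1 → x (N.tet i a) (lab a (π 0)) (lab a (π 2)) =
      M (N.tet i a) (lab a (π 0)) (lab a (π 1)) - M (N.tet i a) (lab a (π 0)) (lab a (π 3)) := fun a π hπ =>
    hx _ (lab a * π) (by rw [Perm.sign_mul, h.even, hπ, one_mul])
  have outer : ∀ a (π : Perm (Fin 4)), Perm.sign π = 1 → π 2 = 0 →
      M (N.tet i a) (lab a (π 0)) (lab a (π 1)) - M (N.tet i a) (lab a (π 0)) (lab a (π 3)) =
      M (N.tet i (1 - a)) (lab (1 - a) (transp 1 (π 0))) (lab (1 - a) (transp 1 (π 1))) -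
        M (N.tet i (1 - a)) (lab (1 - a) (transp 1 (π 0))) (lab (1 - a) (transp 1 (π 3))) := by
    intro a π hπ h2
    have h1 := h0 a (π 0) (fun he => absurd (π.injective (he.trans h2.symm)) (by decide))
    have e0 : transp 1 0 = 0 := by decide
    have h3 := hx' (1 - a) (transp 1 * π * swap 1 3) (by
      rw [Perm.sign_mul, Perm.sign_mul, hπ]; decide)
    simp only [Perm.mul_apply, show swap (1 : Fin 4) 3 0 = 0 by decide, show swap (1 : Fin 4) 3 1 = 3 by decide,
      show swap (1 : Fin 4) 3 2 = 2 by decide, show swap (1 : Fin 4) 3 3 = 1 by decide, h2, e0] at h3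
    have h4 := hx' a π hπ
    rw [h2] at h4
    linarith
  -- The hypothesis on the outer sides equates differences of corner values. The gluing along face 1
  -- equates one of the two corners, hence the other.
  have c2 : ∀ a, M (N.tet i a) (lab a 2) (lab a 1) = M (N.tet i (1 - a)) (lab (1 - a) 3) (lab (1 - a) 1) := by
    intro a
    have h1 := step a 1 2 3 (by decide)
    have hp : ∃ π : Perm (Fin 4), Perm.sign π = 1 ∧ π 0 = 2 ∧ π 2 = 0 ∧ π 1 = 1 ∧ π 3 = 3 ∨
      Perm.sign π = 1 ∧ π 0 = 2 ∧ π 2 = 0 ∧ π 1 = 3 ∧ π 3 = 1 := by decide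
    simp only [show transp 1 2 = 3 by decide, show transp 1 3 = 2 by decide] at h1
    obtain ⟨π, ⟨hπ, p0, p2, p1, p3⟩ | ⟨hπ, p0, p2, p1, p3⟩⟩ := hp <;>
    · have h2 := outer a π hπ p2
      simp only [p0, p1, p3, show transp 1 2 = 3 by decide, show transp 1 3 = 2 by decide, show transp 1 1 = 1 by decide] at h2
      linarith
  have c3 : ∀ a, M (N.tet i a) (lab a 3) (lab a 1) = M (N.tet i (1 - a)) (lab (1 - a) 2) (lab (1 - a) 1) := by
    intro a
    have h1 := c2 (1 - a)
    rw [show ∀ a : Fin 2, 1 - (1 - a) = a by decide] at h1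
    exact h1.symm
  have s1 := step a 1 2 3 (by decide)
  have s2 := step a 1 3 2 (by decide)
  have s3 := step a 2 1 3 (by decide)
  have s4 := step a 3 1 2 (by decide)
  have s5 := step a 2 3 1 (by decide)
  have s6 := step a 3 2 1 (by decide)
  have k2 := c2 a
  have k3 := c3 a
  simp only [show transp 2 1 = 3 by decide, show transp 3 1 = 2 by decide, show transp 1 3 = 2 by decide,
    show transp 3 2 = 1 by decide, show transp 2 3 = 1 by decide, show transp 1 2 = 3 by decide] at s1 s2 s3 s4 s5 s6
  have e11 : transp 1 1 = 1 := by decide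
  have e12 : transp 1 2 = 3 := by decide
  have e13 : transp 1 3 = 2 := by decide
  fin_cases r <;> fin_cases s <;> first | exact absurd rfl hr | exact absurd rfl hs | exact absurd rfl hrs | skip
  all_goals simp only [Fin.mk_one, Fin.reduceFinMk, e11, e12, e13]; linarith

theorem Cross.corner_eq (h : ∀ i, N.IsLabelling i (lab i)) {M : Tet → Fin 4 → Fin 4 → ℤ}
    (hM : ∀ t i a b, i ≠ a → i ≠ b → a ≠ b → M (T.adj t i) (T.perm t i a) (T.perm t i b) = M t a b)
    (hfold : ∀ i a r s, r ≠ 0 → s ≠ 0 → r ≠ s → M (N.tet i (1 - a)) (lab i (1 - a) (transp 1 r)) (lab i (1 - a) (transp 1 s)) =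
      M (N.tet i a) (lab i a r) (lab i a s)) {t s : Tet} {i : Fin 4} {σ : Perm (Fin 4)}
    (hx : N.Cross t i s σ) : ∀ a b, a ≠ i → b ≠ i → a ≠ b → M s (σ a) (σ b) = M t a b := by
  induction hx with
  | direct t i _ => intro a b ha hb hab; exact hM t i a b ha.symm hb.symm hab
  | fold t i j d s σ h1 h2 _ ih =>
    intro a b ha hb hab
    obtain ⟨u, hu, hu'⟩ := exists_lab_eq h h2 ha
    obtain ⟨v, hv, hv'⟩ := exists_lab_eq h h2 hb
    have huv : u ≠ v := by
      rintro rfl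
      exact hab ((T.perm t i).injective (hu'.trans hv'.symm))
    have h01 : (1 : Fin 4) ≠ 0 := by decide
    have e0 : transp 1 0 = 0 := by decide
    simp only [Perm.mul_apply]
    rw [← (h j).one, ← (h j).zero] at ih
    simp only [(h j).perm d h01, (h j).adj d h01, e0] at ih
    rw [← (h j).one, ← hM t i a b ha.symm hb.symm hab, hu', hv', h1, (h j).perm d h01, (h j).perm d h01,
      ih _ _ ((h j).lab_ne _ fun he => hu ((transp 1).injective (he.trans e0.symm)))
        ((h j).lab_ne _ fun he => hv ((transp 1).injective (he.trans e0.symm)))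
        ((h j).lab_ne _ ((transp 1).injective.ne huv)), hfold j d u v hu hv huv]

namespace Filling
variable {Tet' : Type*} {T' : Gluing Tet'} (F : N.Filling T')

/-- The function of the boundary vertices that exhibits a boundary descends through the folding,
because opposite crossing numbers on folded outer sides make its values agree on identified corners.
It serves to show that pushed curves stay nontrivial. -/
theorem isBoundary (h : ∀ i, N.IsLabelling i (lab i)) {x : Tet → Fin 4 → Fin 4 → ℤ} (hx : T.IsBoundary x)
    (h0 : ∀ i b s, s ≠ 0 → x (N.tet i b) (lab i b s) (lab i b 0) +
      x (N.tet i (1 - b)) (lab i (1 - b) (transp 1 s)) (lab i (1 - b) 0) = 0) :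
    T'.IsBoundary fun t => x (F.emb t) := by
  obtain ⟨n, hn⟩ := hx
  let M : Tet → Fin 4 → Fin 4 → ℤ := fun t a b => if h : a ≠ b then n (T.linkVertexOf ⟨t, a, b, h⟩) else 0
  have hMn : ∀ t a b (h : a ≠ b), M t a b = n (T.linkVertexOf ⟨t, a, b, h⟩) := fun t a b h => dif_pos h
  have hM : ∀ t i a b, i ≠ a → i ≠ b → a ≠ b → M (T.adj t i) (T.perm t i a) (T.perm t i b) = M t a b := by
    intro t i a b ha hb hab
    rw [hMn _ _ _ ((T.perm t i).injective.ne hab), hMn _ _ _ hab, linkVertexOf_adj _ _ hab ha hb]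
  have hxM : ∀ t (π : Perm (Fin 4)), Perm.sign π = 1 → x t (π 0) (π 2) = M t (π 0) (π 1) - M t (π 0) (π 3) := by
    intro t π hπ
    rw [hMn _ _ _ (π.injective.ne (by decide)), hMn _ _ _ (π.injective.ne (by decide)), hn t π hπ]
  have hcross : ∀ t i a b, i ≠ a → i ≠ b → a ≠ b →
      M (F.emb (T'.adj t i)) (T'.perm t i a) (T'.perm t i b) = M (F.emb t) a b := fun t i a b ha hb hab =>
    (F.cross t i).corner_eq h hM (fun i a r s hr hs hrs => corner_eq_of_crossing i (h i) hM hxM (h0 i) a hr hs hrs)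
      a b ha.symm hb.symm hab
  refine ⟨Quot.lift (fun y => M (F.emb y.tet) y.tail y.head) ?_, fun t π hπ => hxM _ _ hπ⟩
  rintro ⟨t, a, b, hab⟩ ⟨t', a', b', hab'⟩ ⟨i, hi, hj, e1, e2, e3⟩
  simp only at hi hj e1 e2 e3 ⊢
  subst e1 e2 e3
  exact (hcross t i a b hi hj hab).symm

/-- A curve of the filled triangulation that is an embedded cycle of triangles is pushed to a simple
closed curve of the original triangulation. -/
theorem exists_push (h : ∀ i, N.IsLabelling i (lab i)) [Fintype Tet] [Fintype Tet'] {p : CuspPath Tet'} {c : T'.Cusp}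
    (hp : T'.IsSimpleClosedCurve p c) (hinj : Function.Injective fun k => (p.tet k, p.flag k 0)) :
    ∃ P d, T.IsSimpleClosedCurve P d ∧ ∀ w : Tet → Fin 3 → ℤ,
      (∀ x, ((N.strandArcs lab x).map (Arc.weight w)).sum = 0) → pairing P.row w = pairing p.row fun t => w (F.emb t) := by
  obtain ⟨hcurve, -, -, hnb⟩ := hp
  have hex : ∀ k, ∃ P, N.Arrives lab (T.flip (F.emb (p.tet k), p.flag k 0, p.flag k 2)) P
      (F.emb (p.tet (k + 1)), p.flag (k + 1) 0, p.flag (k + 1) 3) := by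
    intro k
    have := (F.cross (p.tet k) (p.flag k 2)).arrives h (p.flag k 0) (p.flag_ne k (by decide))
    rwa [← (hcurve k).1, ← (hcurve k).2.1, ← (hcurve k).2.2] at this
  choose P hP using hex
  have hinj' : ∀ k k', (F.emb (p.tet k), p.flag k 0) = (F.emb (p.tet k'), p.flag k' 0) → k = k' := fun k k' hk =>
    hinj (Prod.ext (F.emb_injective (Prod.mk.inj hk).1) (Prod.mk.inj hk).2)
  -- An outer side determines where the passage ends, and an embedded cycle arrives at each triangle
  -- only once.
  have hsame : ∀ k k' x, x ∈ P k → x ∈ P k' → k = k' := by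
    intro k k' x hx hx'
    have he := (hP k).eq_of_mem h (hP k') hx hx'
    simp only [Prod.mk.injEq] at he
    exact add_right_cancel (hinj' (k + 1) (k' + 1) (Prod.ext he.1 he.2.1))
  -- Otherwise the reversed passage from arc `k` and the passage from arc `k'` end at the same side,
  -- which would be both the exit and the entry of one arc.
  have hopp : ∀ k k' x, x ∈ P k → opposite x ∈ P k' → False := by
    intro k k' x hx hx'
    have hr := (hP k).reverse (Q := []) (by
      rw [flip_flip]
      exact .last _ fun i a => F.emb_ne _ _ _)
    have he := hr.eq_of_mem h (hP k') (x := opposite x) (by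
      rw [List.append_nil, List.mem_reverse]
      exact List.mem_map_of_mem hx) hx'
    simp only [Prod.mk.injEq] at he
    have hk := hinj' k (k' + 1) (Prod.ext he.1 he.2.1)
    have h23 := he.2.2
    rw [← hk] at h23
    exact p.flag_ne k (by decide) h23
  -- Indices are read modulo the length, so that the list of arcs over a range closes up at `p.len +
  -- 1`.
  let κ : ℕ → Fin (p.len + 1) := fun k => Fin.ofNat (p.len + 1) k
  have hκ : ∀ k, κ (k + 1) = κ k + 1 := fun k => Fin.ext (by simp [κ, Fin.val_add])
  have hκ' : ∀ k : Fin (p.len + 1), κ k = k := fun k => Fin.ext (Nat.mod_eq_of_lt k.2)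
  let g : ℕ → Arc Tet := fun k => ⟨F.emb (p.tet (κ k)), p.flag (κ k), 3, 3⟩
  let f : ℕ → List (Arc Tet) := fun k => (P (κ k)).flatMap (N.strandArcs lab)
  have hchain : ∀ k, (g k :: f k ++ [g (k + 1)]).IsChain (Arc.Next T) := by
    intro k
    refine (hP (κ k)).isChain h (g k) (g (k + 1)) rfl rfl ?_ rfl
    simp only [g, hκ]
  have hL := List.isChain_flatMap_range g f hchain (p.len + 1)
  have hg0 : g (p.len + 1) = g 0 := by
    have : κ (p.len + 1) = κ 0 := Fin.ext (by simp [κ])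
    simp only [g, this]
  obtain ⟨L, hLeq⟩ : ∃ L, (List.range (p.len + 1)).flatMap (fun k => g k :: f k) = g 0 :: L := by
    rw [List.range_succ_eq_map, List.flatMap_cons]
    exact ⟨_, rfl⟩
  have hcast : ∀ k ∈ List.range (p.len + 1), ∀ k' ∈ List.range (p.len + 1),
      κ k = κ k' → k = k' := by
    intro k hk k' hk' he
    have := congrArg Fin.val he
    simp only [κ, Fin.ofNat] at this
    rwa [Nat.mod_eq_of_lt (List.mem_range.1 hk), Nat.mod_eq_of_lt (List.mem_range.1 hk')] at this
  have hgf : ∀ k k', ∀ b ∈ f k', (g k).Disjoint b := by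
    intro k k' b hb ht
    obtain ⟨x, _, hx⟩ := List.mem_flatMap.1 hb
    obtain ⟨d, hd⟩ := tet_of_mem_strandArcs hx
    exact absurd (ht.trans hd) (F.emb_ne _ _ _)
  have hff : ∀ k k' x y, x ∈ P k → y ∈ P k' → x ≠ y → ∀ a ∈ N.strandArcs lab x, ∀ b ∈ N.strandArcs lab y, a.Disjoint b :=
    fun k k' x y hx hy hxy => disjoint_strandArcs h ((hP k).ne_zero x hx) ((hP k').ne_zero y hy) hxy
      fun he => hopp k k' x hx (he ▸ hy)
  have hdis : ((List.range (p.len + 1)).flatMap fun k => g k :: f k).Pairwise Arc.Disjoint := by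
    rw [List.pairwise_flatMap]
    refine ⟨fun k _ => List.pairwise_cons.2 ⟨hgf k k, ?_⟩, ?_⟩
    · rw [List.pairwise_flatMap]
      refine ⟨fun x _ => pairwise_disjoint_strandArcs h x, ?_⟩
      refine ((hP (κ k)).nodup h).imp_of_mem fun {x y} hx hy hxy => hff (κ k) (κ k) x y hx hy hxy
    · refine List.nodup_range.imp_of_mem fun {k k'} hk hk' hkk' => ?_
      have hne : κ k ≠ κ k' := fun he => hkk' (hcast k hk k' hk' he)
      intro a ha b hb
      rcases List.mem_cons.1 ha with rfl | ha <;> rcases List.mem_cons.1 hb with rfl | hb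
      · exact fun ht h0 => absurd (hinj' _ _ (Prod.ext ht h0)) hne
      · exact hgf _ _ _ hb
      · exact (hgf _ _ _ ha).symm
      · obtain ⟨x, hx, hax⟩ := List.mem_flatMap.1 ha
        obtain ⟨y, hy, hby⟩ := List.mem_flatMap.1 hb
        exact hff (κ k) (κ k') x y hx hy (fun he => hne (hsame (κ k) (κ k') x hx (he ▸ hy))) a hax b hby
  have hpos : ∀ a ∈ (List.range (p.len + 1)).flatMap (fun k => g k :: f k), 0 < a.exit ∧ a.exit < 6 := by
    intro a ha
    obtain ⟨k, _, hk⟩ := List.mem_flatMap.1 ha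
    rcases List.mem_cons.1 hk with rfl | hk
    · exact ⟨by simp [g], by simp [g]⟩
    · obtain ⟨x, _, hx⟩ := List.mem_flatMap.1 hk
      obtain ⟨E, hE, rfl⟩ := List.mem_map.1 hx
      exact strand_pos _ E hE
  have hsum : ∀ φ : Arc Tet → ℤ, (∀ x, ((N.strandArcs lab x).map φ).sum = 0) →
      (((List.range (p.len + 1)).flatMap fun k => g k :: f k).map φ).sum =
        ∑ k, φ ⟨F.emb (p.tet k), p.flag k, 3, 3⟩ := by
    intro φ hφ
    rw [List.sum_map_flatMap_range, Finset.sum_range]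
    refine Finset.sum_congr rfl fun k _ => ?_
    rw [List.map_cons, List.sum_cons, List.sum_map_flatMap_eq_zero fun x _ => hφ x, add_zero]
    simp only [g, hκ']
  rw [hLeq] at hL hdis hpos hsum
  rw [hg0] at hL
  have hcurve' := CuspPath.isCurve_ofArcs hL
  have hcross : ∀ t v j, (CuspPath.ofArcs (g 0) L).crossing (F.emb t) v j = p.crossing t v j := by
    intro t v j
    rw [CuspPath.crossing_ofArcs, hsum]
    · unfold CuspPath.crossing Arc.cross
      refine Finset.sum_congr rfl fun k _ => ?_
      by_cases ht : p.tet k = t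
      · simp [ht]
      · have ht' : F.emb (p.tet k) ≠ F.emb t := fun he => ht (F.emb_injective he)
        simp [ht, ht']
    · refine fun x => List.sum_eq_zero fun y hy => ?_
      obtain ⟨u, hu, rfl⟩ := List.mem_map.1 hy
      obtain ⟨d, hd⟩ := tet_of_mem_strandArcs hu
      have : u.tet ≠ F.emb t := fun he => F.emb_ne _ _ _ (he.symm.trans hd)
      simp only [Arc.cross, this, false_and, if_false, sub_zero]
  have hcross' : ∀ i b s, s ≠ 0 → (CuspPath.ofArcs (g 0) L).crossing (N.tet i b) (lab i b s) (lab i b 0) +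
      (CuspPath.ofArcs (g 0) L).crossing (N.tet i (1 - b)) (lab i (1 - b) (transp 1 s)) (lab i (1 - b) 0) = 0 := by
    intro i b s _
    have hmap : ∀ (M : List (Arc Tet)) (φ ψ : Arc Tet → ℤ), (M.map φ).sum + (M.map ψ).sum = (M.map fun a => φ a + ψ a).sum :=
      fun M φ ψ => List.sum_map_add.symm
    rw [CuspPath.crossing_ofArcs, CuspPath.crossing_ofArcs, hmap, hsum]
    · exact Finset.sum_eq_zero fun k _ => by simp only [Arc.cross, F.emb_ne, false_and, if_false, sub_zero, add_zero]
    · intro x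
      rw [← hmap]
      exact sum_cross_strandArcs h x i b s
  refine ⟨CuspPath.ofArcs (g 0) L, _, ⟨hcurve', hcurve'.isOn, CuspPath.isSimple_ofArcs hL hdis hpos, fun hb => hnb ?_⟩, fun w hw => ?_⟩
  · have := F.isBoundary h hb hcross'
    rwa [show (fun t => (CuspPath.ofArcs (g 0) L).crossing (F.emb t)) = p.crossing from
      funext fun t => funext fun v => funext fun j => hcross t v j] at this
  · rw [CuspPath.pairing_ofArcs, hsum _ hw, CuspPath.pairing_row]
    rfl

end Filling
end Gluing.NiceCusps

theorem Fin.sum_three_add {R : Type*} [AddCommMonoid R] (F : Fin 3 → R) (q : Fin 3) : ∑ r, F r = F q + F (q + 1) + F (q + 2) := by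
  rw [Fin.sum_univ_three]
  fin_cases q
  · rfl
  · change F 0 + F 1 + F 2 = F 1 + F 2 + F 0; abel
  · change F 0 + F 1 + F 2 = F 2 + F 0 + F 1; abel

theorem isSimple_of_injective {Tet : Type*} {p : CuspPath Tet} (h : Function.Injective fun k => (p.tet k, p.flag k 0)) :
    p.IsSimple :=
  ⟨fun _ => 1 / 2, fun _ => by norm_num, fun _ _ hk h1 h2 => absurd (h (Prod.ext h1 h2)) hk⟩

/-! ### Flattenings adapted to the folding -/

namespace Gluing.NiceCusps
variable {Tet : Type*} {T : Gluing Tet} {l : ℕ} {N : T.NiceCusps l}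

theorem IsLabelling.quad_two {i : Fin l} {lab : Fin 2 → Perm (Fin 4)} (h : N.IsLabelling i lab) (a : Fin 2) :
    quad (lab a 0) (lab a 2) = quad (lab a 0) (lab a 1) + 1 := (quad_of_even _ (h.even a)).1

theorem IsLabelling.quad_three {i : Fin l} {lab : Fin 2 → Perm (Fin 4)} (h : N.IsLabelling i lab) (a : Fin 2) :
    quad (lab a 0) (lab a 3) = quad (lab a 0) (lab a 1) + 2 := (quad_of_even _ (h.even a)).2

theorem IsLabelling.sum_quad {R : Type*} [AddCommMonoid R] {i : Fin l} {lab : Fin 2 → Perm (Fin 4)} (h : N.IsLabelling i lab) (a : Fin 2)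
    (F : Fin 3 → R) : ∑ q, F q = F (quad (lab a 0) (lab a 1)) + F (quad (lab a 0) (lab a 2)) + F (quad (lab a 0) (lab a 3)) := by
  rw [h.quad_two, h.quad_three, ← Fin.sum_three_add]

/-- All crossing numbers of a null-homologous curve at one of the cusps are zero. -/
theorem crossing_eq_zero_of_isBoundary (hT : T.IsIdealTriangulation) {x : Tet → Fin 4 → Fin 4 → ℤ} (hx : T.IsBoundary x)
    (i : Fin l) (a : Fin 2) {s : Fin 4} (hs : s ≠ N.apex i a) : x (N.tet i a) (N.apex i a) s = 0 := by
  obtain ⟨n, hn⟩ := hx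
  obtain ⟨π, hπ, h0, h2⟩ : ∃ π : Perm (Fin 4), Perm.sign π = 1 ∧ π 0 = N.apex i a ∧ π 2 = s := by
    have : ∀ a b : Fin 4, b ≠ a → ∃ π : Perm (Fin 4), Perm.sign π = 1 ∧ π 0 = a ∧ π 2 = b := by decide
    exact this _ _ hs
  have h1 := hn (N.tet i a) π hπ
  rw [linkVertexOf_eq (N := N) hT i (x := ⟨_, π 0, π 1, _⟩) (y := ⟨N.tet i a, π 0, π 3, π.injective.ne (by decide)⟩)
    (by simp only [h0, cuspOf_apex]) (by simp only [h0, cuspOf_apex]), sub_self, h0, h2] at h1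
  exact h1

section strong
variable [Fintype Tet] {f : Tet → Fin 3 → ℤ}

/-- A strong flattening takes equal values on the two tetrahedra at a cusp with two triangles. -/
theorem _root_.Gluing.IsStrongFlattening.apply_tet_eq (hT : T.IsIdealTriangulation) (hf : T.IsStrongFlattening f) {i : Fin l}
    {lab : Fin 2 → Perm (Fin 4)} (h : N.IsLabelling i lab) {r : Fin 4} (hr : r ≠ 0) :
    f (N.tet i 0) (quad (lab 0 0) (lab 0 r)) = f (N.tet i 1) (quad (lab 1 0) (lab 1 r)) := by
  obtain ⟨σ, h0, h1⟩ : ∃ σ : Perm (Fin 4), σ 0 = 0 ∧ σ 1 = r := by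
    have : ∀ r : Fin 4, r ≠ 0 → ∃ σ : Perm (Fin 4), σ 0 = 0 ∧ σ 1 = r := by decide
    exact this r hr
  have hτ : ∀ s, transp s s = s := by decide
  have hτ0 : ∀ s, transp s 0 = 0 := by decide
  have h2 : σ 2 ≠ 0 := by rw [← h0]; exact σ.injective.ne (by decide)
  have h3 : σ 3 ≠ 0 := by rw [← h0]; exact σ.injective.ne (by decide)
  -- A curve of two arcs, cutting off the corner `r` in each of the two triangles, on opposite sides
  -- of the curve. It crosses one side exactly once, so it is nontrivial, and its pairing with `f`
  -- is the difference of the two values up to sign.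
  let p : CuspPath Tet := ⟨1, N.tet i, ![lab 0 * σ, lab 1 * (σ * swap 2 3)]⟩
  have e0 : swap (2 : Fin 4) 3 0 = 0 := by decide
  have e1 : swap (2 : Fin 4) 3 1 = 1 := by decide
  have hp : T.IsCurve p := by
    have hk : ∀ k : Fin 2, k = 0 ∨ k = 1 := by decide
    let fl : Fin 2 → Perm (Fin 4) := ![lab 0 * σ, lab 1 * (σ * swap 2 3)]
    have key : ∀ k : Fin 2, N.tet i (k + 1) = T.adj (N.tet i k) (fl k 2) ∧
        fl (k + 1) 0 = T.perm (N.tet i k) (fl k 2) (fl k 0) ∧ fl (k + 1) 3 = T.perm (N.tet i k) (fl k 2) (fl k 2) := by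
      intro k
      rcases hk k with rfl | rfl
      · refine ⟨(h.adj 0 h2).symm, ?_, ?_⟩
        · change lab 1 (σ (swap 2 3 0)) = T.perm (N.tet i 0) (lab 0 (σ 2)) (lab 0 (σ 0))
          rw [h.perm 0 h2, e0, h0, hτ0]; rfl
        · change lab 1 (σ (swap 2 3 3)) = T.perm (N.tet i 0) (lab 0 (σ 2)) (lab 0 (σ 2))
          rw [h.perm 0 h2, swap_apply_right, hτ]; rfl
      · have h3' : σ (swap 2 3 2) ≠ 0 := by rwa [swap_apply_left]
        refine ⟨(h.adj 1 h3').symm, ?_, ?_⟩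
        · change lab 0 (σ 0) = T.perm (N.tet i 1) (lab 1 (σ (swap 2 3 2))) (lab 1 (σ (swap 2 3 0)))
          rw [h.perm 1 h3', e0, h0, hτ0]; rfl
        · change lab 0 (σ 3) = T.perm (N.tet i 1) (lab 1 (σ (swap 2 3 2))) (lab 1 (σ (swap 2 3 2)))
          rw [h.perm 1 h3', swap_apply_left, hτ]; rfl
    exact key
  have hinj : Function.Injective fun k => (p.tet k, p.flag k 0) := fun k k' hk => tet_eq_iff.1 (congrArg Prod.fst hk)
  have hcr : p.crossing (N.tet i 0) (N.apex i 0) (lab 0 (σ 2)) = 1 := by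
    have h10 : N.tet i 1 ≠ N.tet i 0 := (N.tet_ne i).symm
    have hσ : σ 3 ≠ σ 2 := σ.injective.ne (by decide)
    unfold CuspPath.crossing
    change ∑ k : Fin 2, _ = _
    rw [Fin.sum_univ_two]
    simp [p, h10, h0, h.zero, hσ]
  have hnb : ¬ T.IsBoundary p.crossing := by
    intro hb
    rw [crossing_eq_zero_of_isBoundary hT hb i 0 (by rw [← h.zero]; exact h.lab_ne 0 h2)] at hcr
    exact zero_ne_one hcr
  have hpair : pairing p.row f = 0 := hf.2.2 p _ ⟨hp, hp.isOn, isSimple_of_injective hinj, hnb⟩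
  rw [p.pairing_row] at hpair
  change ∑ k : Fin 2, _ = _ at hpair
  rw [Fin.sum_univ_two] at hpair
  simp only [p, Matrix.cons_val_zero, Matrix.cons_val_one, Perm.mul_apply, e0, e1, h0, h1, Perm.sign_mul, h.even, one_mul,
    Perm.sign_swap (show (2 : Fin 4) ≠ 3 by decide)] at hpair
  rcases Int.units_eq_one_or (Perm.sign σ) with hs | hs <;> rw [hs] at hpair <;> simp at hpair <;> omega

end strong

/-- The strands at `2` and `3` meet only corners of the type of `23`, where `f` vanishes. The four
contributions of the strand at `1` cancel in pairs, opposite edges having the same type. -/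
theorem sum_weight_strandArcs {f : Tet → Fin 3 → ℤ} {lab : Fin l → Fin 2 → Perm (Fin 4)} (h : ∀ i, N.IsLabelling i (lab i))
    (h0 : ∀ i a, f (N.tet i a) (quad (lab i a 0) (lab i a 1)) = 0) (x : Fin l × Fin 2 × Fin 4) :
    ((N.strandArcs lab x).map (Arc.weight f)).sum = 0 := by
  obtain ⟨i, a, r⟩ := x
  have hopp : ∀ a, quad (lab i a 2) (lab i a 3) = quad (lab i a 0) (lab i a 1) := fun a => quad_opposite _
  have hopp' : ∀ a, quad (lab i a 1) (lab i a 2) = quad (lab i a 0) (lab i a 3) := fun a => by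
    have : ∀ π : Perm (Fin 4), quad (π 1) (π 2) = quad (π 0) (π 3) := by decide
    exact this _
  have hopp'' : ∀ a, quad (lab i a 1) (lab i a 3) = quad (lab i a 0) (lab i a 2) := fun a => by
    have : ∀ π : Perm (Fin 4), quad (π 1) (π 3) = quad (π 0) (π 2) := by decide
    exact this _
  unfold strandArcs
  rw [List.map_map]
  have hw : ∀ E : Fin 2 × Perm (Fin 4) × ℕ × ℕ, (Arc.weight f ∘ fun E : Fin 2 × Perm (Fin 4) × ℕ × ℕ =>
      ⟨N.tet i (a + E.1), lab i (a + E.1) * E.2.1, E.2.2.1, E.2.2.2⟩) E = ((Perm.sign E.2.1 : ℤˣ) : ℤ) *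
        f (N.tet i (a + E.1)) (quad (lab i (a + E.1) (E.2.1 0)) (lab i (a + E.1) (E.2.1 1))) := by
    intro E
    simp only [Function.comp, Arc.weight, Perm.sign_mul, (h i).even, one_mul, Perm.mul_apply]
  -- The table lists tetrahedron, sign, triangle and corner of every arc.
  have hl : ∀ r, (strand r).map (fun E => (E.1, Perm.sign E.2.1, E.2.1 0, E.2.1 1)) =
      (![[], [(0, 1, 1, 3), (1, -1, 3, 0), (0, -1, 2, 0), (1, 1, 1, 2)], [(0, -1, 2, 3), (1, -1, 3, 2)],
        [(0, 1, 3, 2), (1, 1, 2, 3)]] : Fin 4 → List (Fin 2 × ℤˣ × Fin 4 × Fin 4)) r := by decide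
  have key : (strand r).map (Arc.weight f ∘ fun E : Fin 2 × Perm (Fin 4) × ℕ × ℕ =>
      ⟨N.tet i (a + E.1), lab i (a + E.1) * E.2.1, E.2.2.1, E.2.2.2⟩) = _ :=
    (List.map_congr_left fun E _ => hw E).trans (List.map_map (f := fun E : Fin 2 × Perm (Fin 4) × ℕ × ℕ =>
      (E.1, Perm.sign E.2.1, E.2.1 0, E.2.1 1)) (g := fun y : Fin 2 × ℤˣ × Fin 4 × Fin 4 => (y.2.1 : ℤ) *
      f (N.tet i (a + y.1)) (quad (lab i (a + y.1) y.2.2.1) (lab i (a + y.1) y.2.2.2)))).symm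
  rw [key, hl]
  fin_cases r
  · rfl
  · simp [hopp', hopp'', quad_comm (lab i _ 3) (lab i _ 0), quad_comm (lab i _ 2) (lab i _ 0)]
  · simp [hopp, quad_comm (lab i _ 3) (lab i _ 2), h0]
  · simp [hopp, quad_comm (lab i _ 3) (lab i _ 2), h0]

namespace Filling
variable {Tet' : Type*} {T' : Gluing Tet'} {lab : Fin l → Fin 2 → Perm (Fin 4)}

theorem sum_tet {R : Type*} [AddCommMonoid R] (F : N.Filling T') [Fintype Tet] [Fintype Tet'] (h : ∀ i, N.IsLabelling i (lab i)) (φ : Tet → R) :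
    ∑ t, φ t = ∑ t, φ (F.emb t) + ∑ i, (φ (N.tet i 0) + φ (N.tet i 1)) := by
  rw [← (Equiv.ofBijective _ (F.sumElim_bijective h)).sum_comp, Fintype.sum_sum_type, Fintype.sum_prod_type]
  simp only [Fin.sum_univ_two]
  rfl

theorem prod_tet {R : Type*} [CommMonoid R] (F : N.Filling T') [Fintype Tet] [Fintype Tet'] (h : ∀ i, N.IsLabelling i (lab i)) (φ : Tet → R) :
    ∏ t, φ t = (∏ t, φ (F.emb t)) * ∏ i, (φ (N.tet i 0) * φ (N.tet i 1)) := by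
  rw [← (Equiv.ofBijective _ (F.sumElim_bijective h)).prod_comp, Fintype.prod_sum_type, Fintype.prod_prod_type]
  simp only [Fin.prod_univ_two]
  rfl

theorem rowSum_emb (F : N.Filling T') {R : Type*} [AddCommMonoid R] {c : T.Edge → R} {c' : T'.Edge → R}
    (hc : ∀ t a b, T'.edgeVal c' t a b = T.edgeVal c (F.emb t) a b) (t : Tet') : T'.rowSum c' t = T.rowSum c (F.emb t) := by
  unfold rowSum
  congr 1
  funext a b
  exact hc t a b

variable [Fintype Tet] [Fintype Tet'] (F : N.Filling T') {f : Tet → Fin 3 → ℤ}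

theorem exists_isStrongFlattening (F : N.Filling T') (hT : T.IsIdealTriangulation) (hT' : T'.IsIdealTriangulation)
    (h : ∀ i, N.IsLabelling i (lab i)) (hf : T.IsStrongFlattening f) :
    ∃ g, T.IsStrongFlattening g ∧ ∀ i a, g (N.tet i a) (quad (lab i a 0) (lab i a 1)) = 0 := by
  -- The dual of `rowSum c` at the type of `01` is the value of `c` on the edge `3` minus that on
  -- the edge `2`, which is made to be minus the value of `f`. One choice works for both tetrahedra
  -- because `f` agrees on them.
  obtain ⟨c, hc⟩ := F.exists_dual hT hT' h fun i => f (N.tet i 0) (quad (lab i 0 0) (lab i 0 1))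
  have hw := T.isClosedWeight_dual c
  have hwp := fun p (hp : T.IsCurve p) => T.pairing_row_dual c hp
  refine ⟨f + fun t => dual (T.rowSum c t), ⟨fun t => ?_, fun e => ?_, fun p d hp => ?_⟩, fun i a => ?_⟩
  · have h1 := hf.1 t
    have h2 := hw.1 t
    simp only [Pi.add_apply]
    linarith
  · have h1 : pairing (T.edgeRow e) f = 2 := hf.2.1 e
    change pairing _ _ = _
    rw [pairing_add_right, h1, hw.2 e, add_zero]
  · have h1 : pairing p.row f = 0 := hf.2.2 p d hp
    change pairing _ _ = _
    rw [pairing_add_right, h1, hwp p hp.1, add_zero]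
  · have h1 : f (N.tet i a) (quad (lab i a 0) (lab i a 1)) = f (N.tet i 0) (quad (lab i 0 0) (lab i 0 1)) := by
      fin_cases a
      · rfl
      · exact (hf.apply_tet_eq hT (h i) (by decide)).symm
    simp only [Pi.add_apply, dual]
    rw [← (h i).quad_two, ← (h i).quad_three, (h i).rowSum_eq c a (by decide), (h i).rowSum_eq c a (by decide), h1, hc]
    ring

/-- The flattening is paired with a lift `c` of the indicator function of `E`. The total is twice
the sum of `c`, which `sum_edge_eq` evaluates. Each removed tetrahedron accounts for the value of
`c` on the identified edges, and what remains is 2. -/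
theorem pairing_edgeRow_emb (hT : T.IsIdealTriangulation) (hT' : T'.IsIdealTriangulation)
    (h : ∀ i, N.IsLabelling i (lab i)) (hf : T.IsStrongFlattening f)
    (h0 : ∀ i a, f (N.tet i a) (quad (lab i a 0) (lab i a 1)) = 0) (E : T'.Edge) :
    pairing (T'.edgeRow E) (fun t => f (F.emb t)) = 2 := by
  classical
  have := Fintype.ofFinite T.Edge
  have := Fintype.ofFinite T'.Edge
  obtain ⟨c, h1, h2, h3⟩ := F.exists_lift hT hT' h (Pi.single E 1)
  have h4 := F.sum_edge_eq hT hT' h h1 h3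
  have h5 : pairing (T.rowSum c) f = 2 * ∑ e, c e := by
    rw [pairing_rowSum, Finset.mul_sum]
    exact Finset.sum_congr rfl fun e _ => by rw [show pairing (T.edgeRow e) f = 2 from hf.2.1 e, mul_comm]
  have h6 : pairing (T.rowSum c) f = pairing (T'.edgeRow E) (fun t => f (F.emb t)) +
      ∑ i, (c (N.blockEdge i (lab i) 2) + c (N.blockEdge i (lab i) 2)) := by
    unfold pairing
    rw [F.sum_tet h]
    congr 1
    · refine Finset.sum_congr rfl fun t _ => Finset.sum_congr rfl fun q _ => ?_
      rw [edgeRow_eq, F.rowSum_emb h3]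
    · have key : ∀ i a, ∑ q, T.rowSum c (N.tet i a) q * f (N.tet i a) q = c (N.blockEdge i (lab i) 2) := by
        intro i a
        have hs := (h i).sum_quad a (f (N.tet i a))
        rw [Fin.sum_univ_three, hf.1, h0] at hs
        rw [(h i).sum_quad a, h0, (h i).rowSum_eq c a (s := 2) (by decide), (h i).rowSum_eq c a (s := 3) (by decide), h2, ← h1]
        linear_combination -c (N.blockEdge i (lab i) 2) * hs
      exact Finset.sum_congr rfl fun i _ => by rw [key, key]
  simp only [Finset.sum_add_distrib, h2, Finset.sum_const_zero, Finset.sum_pi_single', Finset.mem_univ, if_true] at h4 h6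
  linarith

/-- The flattening products of the two triangulations. -/
theorem flatteningProd_eq {z : Tet → ℂ} (hT : T.IsIdealTriangulation) (hT' : T'.IsIdealTriangulation)
    (h : ∀ i, N.IsLabelling i (lab i)) (hz' : (fun t => z (F.emb t)) ∈ T'.gluingVariety) (hf : T.IsStrongFlattening f)
    (h0 : ∀ i a, f (N.tet i a) (quad (lab i a 0) (lab i a 1)) = 0) {f' : Tet' → Fin 3 → ℤ} (hf' : T'.IsStrongFlattening f') :
    flatteningProd (fun t => z (F.emb t)) (fun t => f (F.emb t)) = flatteningProd (fun t => z (F.emb t)) f' ∨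
    flatteningProd (fun t => z (F.emb t)) (fun t => f (F.emb t)) = -flatteningProd (fun t => z (F.emb t)) f' := by
  refine hf'.flatteningProd_eq hz' (fun t => hf.1 _) (F.pairing_edgeRow_emb hT hT' h hf h0) fun p c hp hinj => ?_
  obtain ⟨P, d, hP, hw⟩ := F.exists_push h hp hinj
  rw [← hw f (sum_weight_strandArcs h h0)]
  exact hf.2.2 P d hP

end Filling
end Gluing.NiceCusps

/-! ### Curves at a cusp with two triangles -/

namespace Gluing.NiceCusps
variable {Tet : Type*} {T : Gluing Tet} {l : ℕ} {N : T.NiceCusps l} {i : Fin l} {lab : Fin 2 → Perm (Fin 4)}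

variable (N i lab) in
/-- A curve at a cusp with two triangles: its `k`-th arc lies in the triangle `a k`, and leaves it through the
side on the face labelled `s k`. -/
structure IsWord (p : CuspPath Tet) (a : Fin (p.len + 1) → Fin 2) (s : Fin (p.len + 1) → Fin 4) : Prop where
  ne_zero : ∀ k, s k ≠ 0
  tet : ∀ k, p.tet k = N.tet i (a k)
  apex : ∀ k, p.flag k 0 = lab (a k) 0
  exit : ∀ k, p.flag k 2 = lab (a k) (s k)
  entry : ∀ k, p.flag (k + 1) 3 = lab (a (k + 1)) (s k)
  next : ∀ k, a (k + 1) = 1 - a k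

theorem IsLabelling.exists_isWord (h : N.IsLabelling i lab) {p : CuspPath Tet} (hp : T.IsCurve p) (hi : T.IsOn p (N.cusp i)) :
    ∃ a s, N.IsWord i lab p a s := by
  choose a ha ha' using fun k => (N.meets i _ _).1 (hi k)
  choose s hs using fun k => (lab (a k)).surjective (p.flag k 2)
  have hs0 : ∀ k, s k ≠ 0 := by
    intro k hk
    have := hs k
    rw [hk, h.zero, ← ha'] at this
    exact p.flag_ne k (by decide) this
  have hnext : ∀ k, a (k + 1) = 1 - a k := by
    intro k
    have := (hp k).1
    rw [ha, ha, ← hs, h.adj _ (hs0 k)] at this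
    exact tet_eq_iff.1 this
  refine ⟨a, s, hs0, ha, fun k => by rw [ha', h.zero], fun k => (hs k).symm, fun k => ?_, hnext⟩
  rw [(hp k).2.2, ha, ← hs, h.perm _ (hs0 k), hnext, show ∀ s, transp s s = s by decide]

section word
variable {p : CuspPath Tet} {a : Fin (p.len + 1) → Fin 2} {s : Fin (p.len + 1) → Fin 4}

theorem IsWord.crossing_eq (hw : N.IsWord i lab p a s) (b : Fin 2) (j : Fin 4) :
    p.crossing (N.tet i b) (lab b 0) (lab b j) = ∑ k, if s k = j then (if a k = b then 1 else -1) else 0 := by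
  have hb : ∀ a b : Fin 2, a ≠ b ↔ 1 - a = b := by decide
  classical
  unfold CuspPath.crossing
  rw [Finset.sum_sub_distrib, ← Fin.sum_comp_add_one fun k => if p.tet k = N.tet i b ∧ p.flag k 0 = lab b 0 ∧ p.flag k 3 = lab b j
    then (1 : ℤ) else 0, ← Finset.sum_sub_distrib]
  refine Finset.sum_congr rfl fun k _ => ?_
  have h1 : (p.tet k = N.tet i b ∧ p.flag k 0 = lab b 0 ∧ p.flag k 2 = lab b j) ↔ a k = b ∧ s k = j := by
    rw [hw.tet, hw.apex, hw.exit, tet_eq_iff]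
    constructor
    · rintro ⟨rfl, _, h2⟩; exact ⟨rfl, (lab _).injective h2⟩
    · rintro ⟨rfl, rfl⟩; exact ⟨rfl, rfl, rfl⟩
  have h2 : (p.tet (k + 1) = N.tet i b ∧ p.flag (k + 1) 0 = lab b 0 ∧ p.flag (k + 1) 3 = lab b j) ↔ a k ≠ b ∧ s k = j := by
    rw [hw.tet, hw.apex, hw.entry, tet_eq_iff, hb, hw.next]
    constructor
    · rintro ⟨rfl, _, h2⟩; exact ⟨rfl, (lab _).injective h2⟩
    · rintro ⟨rfl, rfl⟩; exact ⟨rfl, rfl, rfl⟩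
  simp only [h1, h2]
  by_cases h3 : a k = b <;> by_cases h4 : s k = j <;> simp [h3, h4]

theorem IsWord.crossing_one_sub (hw : N.IsWord i lab p a s) (b : Fin 2) (j : Fin 4) :
    p.crossing (N.tet i (1 - b)) (lab (1 - b) 0) (lab (1 - b) j) = -p.crossing (N.tet i b) (lab b 0) (lab b j) := by
  have hb : ∀ a b : Fin 2, a = 1 - b ↔ ¬ a = b := by decide
  rw [hw.crossing_eq, hw.crossing_eq, ← Finset.sum_neg_distrib]
  refine Finset.sum_congr rfl fun k _ => ?_
  simp only [hb]
  by_cases h3 : a k = b <;> by_cases h4 : s k = j <;> simp [h3, h4]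

theorem IsWord.corner_eq_zero (hw : N.IsWord i lab p a s) (b : Fin 2) {v : Fin 4} (hv : v ≠ 0) (j : Fin 4) :
    p.corner (N.tet i b) (lab b v) j = 0 := by
  unfold CuspPath.corner
  refine Finset.sum_eq_zero fun k _ => if_neg ?_
  rw [hw.tet, hw.apex, tet_eq_iff]
  rintro ⟨rfl, h, _⟩
  exact hv ((lab _).injective h).symm

theorem IsWord.row_eq_zero (hw : N.IsWord i lab p a s) {t : Tet} (ht : ∀ b, t ≠ N.tet i b) (q : Fin 3) : p.row t q = 0 := by
  unfold CuspPath.row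
  refine Finset.sum_eq_zero fun k _ => if_neg ?_
  rw [hw.tet]
  exact fun h => ht _ h.1.symm

theorem IsWord.row_quad (hw : N.IsWord i lab p a s) (b : Fin 2) {r : Fin 4} (hr : r ≠ 0) :
    p.row (N.tet i b) (quad (lab b 0) (lab b r)) = p.corner (N.tet i b) (lab b 0) (lab b r) := by
  obtain ⟨σ, h0, h1⟩ : ∃ σ : Perm (Fin 4), σ 0 = 0 ∧ σ 1 = r := by
    have : ∀ r : Fin 4, r ≠ 0 → ∃ σ : Perm (Fin 4), σ 0 = 0 ∧ σ 1 = r := by decide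
    exact this r hr
  have h2 : σ 2 ≠ 0 := by rw [← h0]; exact σ.injective.ne (by decide)
  have h3 : σ 3 ≠ 0 := by rw [← h0]; exact σ.injective.ne (by decide)
  have := oppSum_quad (fun u v => p.corner (N.tet i b) u v + p.corner (N.tet i b) v u) (fun u v => add_comm _ _) (lab b * σ)
  simp only [Perm.mul_apply, h0, h1] at this
  rw [CuspPath.row_eq, this, hw.corner_eq_zero b hr, hw.corner_eq_zero b h2, hw.corner_eq_zero b h3]
  ring

/-- The corner numbers at the apex in terms of the crossing numbers. -/
theorem IsWord.corner_two (h : N.IsLabelling i lab) (b : Fin 2) :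
    p.corner (N.tet i b) (lab b 0) (lab b 2) = p.corner (N.tet i b) (lab b 0) (lab b 1) +
      p.crossing (N.tet i b) (lab b 0) (lab b 3) := by
  have := p.crossing_eq (N.tet i b) (π := lab b * (swap 1 2 * swap 2 3)) (by rw [Perm.sign_mul, h.even]; decide)
  simp only [Perm.mul_apply, show swap (2 : Fin 4) 3 0 = 0 by decide, show swap (1 : Fin 4) 2 0 = 0 by decide,
    show swap (2 : Fin 4) 3 1 = 1 by decide, show swap (1 : Fin 4) 2 1 = 2 by decide, show swap (2 : Fin 4) 3 2 = 3 by decide,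
    show swap (1 : Fin 4) 2 3 = 3 by decide, show swap (2 : Fin 4) 3 3 = 2 by decide, show swap (1 : Fin 4) 2 2 = 1 by decide] at this
  linarith

theorem IsWord.corner_three (h : N.IsLabelling i lab) (b : Fin 2) :
    p.corner (N.tet i b) (lab b 0) (lab b 3) = p.corner (N.tet i b) (lab b 0) (lab b 1) -
      p.crossing (N.tet i b) (lab b 0) (lab b 2) := by
  have := p.crossing_eq (N.tet i b) (h.even b)
  linarith

/-- The arcs alternate between the two triangles, so a cyclic shift changes the sign of the sum. -/
theorem IsWord.sum_alternating (hw : N.IsWord i lab p a s) : ∑ k, (if a k = 0 then (1 : ℤ) else -1) = 0 := by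
  have h1 := Fin.sum_comp_add_one fun k => if a k = 0 then (1 : ℤ) else -1
  have h2 : ∀ a : Fin 2, (if 1 - a = 0 then (1 : ℤ) else -1) = -(if a = 0 then 1 else -1) := by decide
  simp only [hw.next, h2] at h1
  rw [Finset.sum_neg_distrib] at h1
  omega

/-- The number of arcs is even. -/
theorem IsWord.even_sum_corner (hw : N.IsWord i lab p a s) :
    Even (∑ b, ∑ r, p.corner (N.tet i b) (lab b 0) (lab b r)) := by
  have h1 : ∑ b, ∑ r, p.corner (N.tet i b) (lab b 0) (lab b r) = ∑ k, ((Perm.sign (p.flag k) : ℤˣ) : ℤ) := by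
    unfold CuspPath.corner
    rw [Finset.sum_congr rfl fun b _ => Finset.sum_comm, Finset.sum_comm]
    refine Finset.sum_congr rfl fun k _ => ?_
    rw [Finset.sum_eq_single (a k), Finset.sum_eq_single ((lab (a k)).symm (p.flag k 1))]
    · exact if_pos ⟨hw.tet k, hw.apex k, by simp⟩
    · intro r _ hr
      refine if_neg ?_
      rintro ⟨_, _, h⟩
      exact hr (by rw [h, symm_apply_apply])
    · exact fun h => absurd (Finset.mem_univ _) h
    · intro b _ hb
      refine Finset.sum_eq_zero fun r _ => if_neg ?_
      rw [hw.tet]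
      rintro ⟨h, _⟩
      exact hb (tet_eq_iff.1 h).symm
    · exact fun h => absurd (Finset.mem_univ _) h
  rw [h1, ← sub_zero (∑ k, _), ← hw.sum_alternating, ← Finset.sum_sub_distrib]
  refine Finset.even_sum _ fun k _ => ?_
  rcases Int.units_eq_one_or (Perm.sign (p.flag k)) with h | h <;> rw [h] <;> split_ifs <;> decide

end word
end Gluing.NiceCusps

/-! ## Affine maps of the complex plane -/

/-- The affine map `w ↦ a w + b`. -/
noncomputable def affinePerm (a b : ℂ) (ha : a ≠ 0) : Perm ℂ where
  toFun w := a * w + b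
  invFun w := (w - b) / a
  left_inv w := by field_simp; ring
  right_inv w := by field_simp; ring

def IsAffinePerm (f : Perm ℂ) : Prop := ∃ a b : ℂ, ∀ w, f w = a * w + b

theorem IsAffinePerm.mul {f g : Perm ℂ} (hf : IsAffinePerm f) (hg : IsAffinePerm g) : IsAffinePerm (f * g) := by
  obtain ⟨a, b, hf⟩ := hf
  obtain ⟨c, d, hg⟩ := hg
  exact ⟨a * c, a * d + b, fun w => by rw [Perm.mul_apply, hg, hf]; ring⟩

theorem isAffinePerm_affinePerm (a b : ℂ) (ha : a ≠ 0) : IsAffinePerm (affinePerm a b ha) := ⟨a, b, fun _ => rfl⟩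

theorem IsAffinePerm.ext {f g : Perm ℂ} (hf : IsAffinePerm f) (hg : IsAffinePerm g) {p q : ℂ} (hpq : p ≠ q)
    (hp : f p = g p) (hq : f q = g q) : f = g := by
  obtain ⟨a, b, hf⟩ := hf
  obtain ⟨c, d, hg⟩ := hg
  rw [hf, hg] at hp hq
  have h1 : a = c := by
    have : (a - c) * (p - q) = 0 := by linear_combination hp - hq
    rcases mul_eq_zero.1 this with h | h
    · exact sub_eq_zero.1 h
    · exact absurd (sub_eq_zero.1 h) hpq
  subst h1
  have h2 : b = d := by linear_combination hp
  subst h2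
  exact Equiv.ext fun w => by rw [hf, hg]

/-- Once around the cycle, the accumulated product of the commuting increments must be trivial. -/
theorem zpow_mul_zpow_eq_one_of_cyclic {G : Type*} [Group G] {u v : G} (huv : u * v = v * u) {n : ℕ} {ψ : Fin (n + 1) → G}
    {m m' : Fin (n + 1) → ℤ} (h : ∀ k, ψ (k + 1) = ψ k * (u ^ m k * v ^ m' k)) : u ^ (∑ k, m k) * v ^ (∑ k, m' k) = 1 := by
  let κ : ℕ → Fin (n + 1) := fun k => Fin.ofNat (n + 1) k
  have hκ : ∀ k, κ (k + 1) = κ k + 1 := fun k => Fin.ext (by simp [κ, Fin.val_add])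
  have hκ' : ∀ k : Fin (n + 1), κ k = k := fun k => Fin.ext (Nat.mod_eq_of_lt k.2)
  have hc : Commute u v := huv
  have key : ∀ j : ℕ, ψ (κ j) = ψ (κ 0) * (u ^ (∑ k ∈ Finset.range j, m (κ k)) * v ^ (∑ k ∈ Finset.range j, m' (κ k))) := by
    intro j
    induction j with
    | zero => simp
    | succ j ih =>
      rw [hκ, h, ih, Finset.sum_range_succ, Finset.sum_range_succ, zpow_add, zpow_add]
      have := (hc.zpow_zpow (m (κ j)) (∑ k ∈ Finset.range j, m' (κ k))).eq
      simp only [mul_assoc]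
      rw [← mul_assoc (v ^ _) (u ^ _) (v ^ _), ← this]
      simp only [mul_assoc]
  have h1 := key (n + 1)
  have h0 : κ (n + 1) = κ 0 := Fin.ext (by simp [κ])
  rw [h0, left_eq_mul, Finset.sum_range, Finset.sum_range] at h1
  simpa only [hκ'] using h1

/-- The vertices labelled `1, 2, 3` of a triangle of shape `x`. -/
noncomputable def trianglePoint (x : ℂ) : Fin 4 → ℂ := ![0, 0, 1, x]

theorem trianglePoint_ne {x : ℂ} (h0 : x ≠ 0) (h1 : x ≠ 1) {r s : Fin 4} (hr : r ≠ 0) (hs : s ≠ 0) (hrs : r ≠ s) :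
    trianglePoint x r ≠ trianglePoint x s := by
  fin_cases r <;> fin_cases s <;> simp_all [trianglePoint, eq_comm]

/-- Two triangles of shapes `x` and `y`, glued along their three sides as the triangles of a torus, with a developing
map along a closed path which crosses the second and third side algebraically once each, in the same direction,
and the first one twice in the other direction. If the developing map closes up then `x y = 1`. -/
theorem mul_eq_one_of_developing {x : Fin 2 → ℂ} (hx0 : ∀ b, x b ≠ 0) (hx1 : ∀ b, x b ≠ 1) {n : ℕ}
    {a : Fin (n + 1) → Fin 2} {s : Fin (n + 1) → Fin 4} (ha : ∀ k, a (k + 1) = 1 - a k) (hs : ∀ k, s k ≠ 0)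
    {ζ : Fin (n + 1) → Fin 4 → ℂ} (h2 : ∀ k, ζ k 2 ≠ ζ k 1) (h3 : ∀ k, ζ k 3 - ζ k 1 = x (a k) * (ζ k 2 - ζ k 1))
    (hζ : ∀ k r, r ≠ 0 → r ≠ s k → ζ (k + 1) (transp (s k) r) = ζ k r) {ε : ℤ} (hε : ε = 1 ∨ ε = -1)
    (hc : ∀ j, j = 2 ∨ j = 3 → ∑ k, (if s k = j then (if a k = 0 then 1 else -1) else 0) = ε) : x 0 * x 1 = 1 := by
  have hx1' : ∀ b, 1 - x b ≠ 0 := fun b h => hx1 b (sub_eq_zero.1 h).symm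
  have hx1'' : ∀ b, x b - 1 ≠ 0 := fun b h => hx1 b (sub_eq_zero.1 h)
  -- The first triangle has vertices `0, 1, x 0` and the second `0, 1, x 1`. `M r` moves the second
  -- triangle so that it is attached to the first along side `r`.
  let M : Fin 4 → Perm ℂ := ![1,
    affinePerm ((x 0 - 1) / (1 - x 1)) (x 0 - (x 0 - 1) / (1 - x 1)) (div_ne_zero (hx1'' 0) (hx1' 1)),
    affinePerm (-x 0 / x 1) (x 0) (div_ne_zero (neg_ne_zero.2 (hx0 0)) (hx0 1)),
    affinePerm (-1) 1 (by norm_num)]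
  have hMaff : ∀ r, r ≠ 0 → IsAffinePerm (M r) := by
    intro r hr
    fin_cases r
    · exact absurd rfl hr
    all_goals exact ⟨_, _, fun _ => rfl⟩
  have hM : ∀ r j, (r ≠ 0 ∧ j ≠ 0 ∧ j ≠ r) → M r (trianglePoint (x 1) (transp r j)) = trianglePoint (x 0) j := by
    have hl : ∀ r j : Fin 4, (r ≠ 0 ∧ j ≠ 0 ∧ j ≠ r) → (r, j, transp r j) ∈ [((1 : Fin 4), (2 : Fin 4), (3 : Fin 4)), (1, 3, 2),
      (2, 1, 3), (2, 3, 1), (3, 1, 2), (3, 2, 1)] := by decide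
    intro r j hrj
    have h01 := hx0 1
    have h11 := hx1' 1
    have := hl r j hrj
    simp only [List.mem_cons, Prod.mk.injEq, List.not_mem_nil, or_false] at this
    rcases this with ⟨rfl, rfl, e⟩ | ⟨rfl, rfl, e⟩ | ⟨rfl, rfl, e⟩ | ⟨rfl, rfl, e⟩ | ⟨rfl, rfl, e⟩ | ⟨rfl, rfl, e⟩ <;> rw [e]
    · change (x 0 - 1) / (1 - x 1) * x 1 + (x 0 - (x 0 - 1) / (1 - x 1)) = 1
      field_simp; ring
    · change (x 0 - 1) / (1 - x 1) * 1 + (x 0 - (x 0 - 1) / (1 - x 1)) = x 0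
      ring
    · change (-x 0 / x 1) * x 1 + x 0 = 0
      field_simp; ring
    · change (-x 0 / x 1) * 0 + x 0 = x 0
      ring
    · change (-1 : ℂ) * 1 + 1 = 0
      ring
    · change (-1 : ℂ) * 0 + 1 = 1
      ring
  let φ : Fin (n + 1) → Perm ℂ := fun k => affinePerm (ζ k 2 - ζ k 1) (ζ k 1) (sub_ne_zero.2 (h2 k))
  have hφaff : ∀ k, IsAffinePerm (φ k) := fun k => isAffinePerm_affinePerm _ _ _
  have hφ : ∀ k r, r ≠ 0 → φ k (trianglePoint (x (a k)) r) = ζ k r := by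
    intro k r hr
    fin_cases r
    · exact absurd rfl hr
    · change (ζ k 2 - ζ k 1) * 0 + ζ k 1 = ζ k 1
      ring
    · change (ζ k 2 - ζ k 1) * 1 + ζ k 1 = ζ k 2
      ring
    · change (ζ k 2 - ζ k 1) * x (a k) + ζ k 1 = ζ k 3
      linear_combination -h3 k
  have htwo : ∀ s : Fin 4, s ≠ 0 → ∃ r r', r ≠ 0 ∧ r' ≠ 0 ∧ r ≠ s ∧ r' ≠ s ∧ r ≠ r' := by decide
  have hτ : ∀ s r : Fin 4, transp s (transp s r) = r := by decide
  have hτ0 : ∀ s r : Fin 4, r ≠ 0 → transp s r ≠ 0 := by decide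
  have hτs : ∀ s r : Fin 4, r ≠ s → transp s r ≠ s := by decide
  have stepA : ∀ k, a k = 0 → φ (k + 1) = φ k * M (s k) := by
    intro k hk
    have hk' : a (k + 1) = 1 := by rw [ha, hk]; rfl
    obtain ⟨r, r', hr, hr', hrs, hrs', hrr⟩ := htwo (s k) (hs k)
    have pt : ∀ r, r ≠ 0 → r ≠ s k → φ (k + 1) (trianglePoint (x 1) (transp (s k) r)) =
        (φ k * M (s k)) (trianglePoint (x 1) (transp (s k) r)) := by
      intro r hr hrs
      have h4 := hφ (k + 1) _ (hτ0 (s k) r hr)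
      have h5 := hφ k r hr
      rw [hk'] at h4
      rw [hk] at h5
      rw [Perm.mul_apply, hM _ _ ⟨hs k, hr, hrs⟩, h4, h5, hζ k r hr hrs]
    exact (hφaff _).ext ((hφaff _).mul (hMaff _ (hs k))) (trianglePoint_ne (hx0 1) (hx1 1) (hτ0 _ _ hr) (hτ0 _ _ hr')
      ((transp (s k)).injective.ne hrr)) (pt r hr hrs) (pt r' hr' hrs')
  have stepB : ∀ k, a k ≠ 0 → φ (k + 1) = φ k * (M (s k))⁻¹ := by
    intro k hk
    have h01 : ∀ b : Fin 2, b ≠ 0 → b = 1 := by decide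
    have hk1 := h01 _ hk
    have hk' : a (k + 1) = 0 := by rw [ha, hk1]; rfl
    rw [eq_mul_inv_iff_mul_eq]
    obtain ⟨r, r', hr, hr', hrs, hrs', hrr⟩ := htwo (s k) (hs k)
    have pt : ∀ r, r ≠ 0 → r ≠ s k → (φ (k + 1) * M (s k)) (trianglePoint (x 1) r) = φ k (trianglePoint (x 1) r) := by
      intro r hr hrs
      have h4 := hφ (k + 1) _ (hτ0 (s k) r hr)
      have h5 := hφ k r hr
      have h6 := hM (s k) (transp (s k) r) ⟨hs k, hτ0 _ _ hr, hτs _ _ hrs⟩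
      rw [hτ] at h6
      rw [hk'] at h4
      rw [hk1] at h5
      rw [Perm.mul_apply, h6, h4, h5, hζ k r hr hrs]
    exact ((hφaff _).mul (hMaff _ (hs k))).ext (hφaff _) (trianglePoint_ne (hx0 1) (hx1 1) hr hr' hrr)
      (pt r hr hrs) (pt r' hr' hrs')
  let u := M 2 * (M 1)⁻¹
  let v := M 3 * (M 1)⁻¹
  -- These maps are the holonomies of two loops of the torus. They commute without any hypothesis on
  -- the shapes because the product of the six corners around the only vertex is always 1.
  have huv : u * v = v * u := by
    have : M 2 * (M 1)⁻¹ * M 3 = M 3 * (M 1)⁻¹ * M 2 := by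
      refine Equiv.ext fun w => ?_
      change (-x 0 / x 1) * ((-1 * w + 1 - (x 0 - (x 0 - 1) / (1 - x 1))) / ((x 0 - 1) / (1 - x 1))) + x 0 =
        -1 * ((-x 0 / x 1 * w + x 0 - (x 0 - (x 0 - 1) / (1 - x 1))) / ((x 0 - 1) / (1 - x 1))) + 1
      have h01 := hx0 1
      have h11 := hx1' 1
      have h10 := hx1'' 0
      field_simp
      ring
    simp only [u, v, ← mul_assoc]
    rw [this]
  -- Side 1 serves as the reference crossing. With this correction the step across side 1 is
  -- trivial, and those across sides 2 and 3 are `u` and `v` or their inverses.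
  let ψ : Fin (n + 1) → Perm ℂ := fun k => if a k = 0 then φ k else φ k * (M 1)⁻¹
  have hψ : ∀ k, ψ (k + 1) = ψ k * (u ^ (if s k = 2 then (if a k = 0 then (1 : ℤ) else -1) else 0) *
      v ^ (if s k = 3 then (if a k = 0 then (1 : ℤ) else -1) else 0)) := by
    intro k
    have hcase : ∀ s : Fin 4, s ≠ 0 → s = 1 ∨ s = 2 ∨ s = 3 := by decide
    have hna : ∀ b : Fin 2, (1 - b = 0) ↔ ¬ b = 0 := by decide
    have hsk := hcase _ (hs k)
    simp only [ψ, ha, hna]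
    by_cases hk : a k = 0
    · have := stepA k hk
      simp only [hk, if_true, not_true, if_false]
      rw [this]
      rcases hsk with h | h | h <;> simp [h, u, v, mul_assoc]
    · have := stepB k hk
      simp only [hk, if_false, not_false_eq_true, if_true]
      rw [this]
      rcases hsk with h | h | h <;> simp [h, u, v]
  have hone := zpow_mul_zpow_eq_one_of_cyclic huv hψ
  rw [hc 2 (Or.inl rfl), hc 3 (Or.inr rfl)] at hone
  have huv1 : u * v = 1 := by
    rcases hε with rfl | rfl
    · simpa using hone
    · rw [huv, ← inv_inj]
      simpa using hone
  -- Following the point `x 0` through `u v = 1` shows that `M 1` fixes `0`, which is the equation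
  -- sought.
  have e1 := hM 1 3 (by decide)
  have e2 := hM 3 1 (by decide)
  have e3 := hM 2 3 (by decide)
  have e4 : (M 1)⁻¹ (x 0) = 1 := by
    rw [Perm.inv_eq_iff_eq]; exact e1.symm
  have e5 := Equiv.congr_fun huv1 (x 0)
  simp only [u, v, Perm.mul_apply, e4, Perm.one_apply] at e5
  have e6 : M 3 1 = 0 := e2
  have e7 : M 2 0 = x 0 := e3
  rw [e6] at e5
  have e8 : (M 1)⁻¹ 0 = 0 := (M 2).injective (e5.trans e7.symm)
  rw [Perm.inv_eq_iff_eq] at e8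
  have e9 : (0 : ℂ) = (x 0 - 1) / (1 - x 1) * 0 + (x 0 - (x 0 - 1) / (1 - x 1)) := e8
  have h11 := hx1' 1
  field_simp at e9
  linear_combination e9

/-! ## The ideal vertices -/

/-- The determinant of two vectors of the plane. -/
def planeDet (a b : Fin 2 → ℂ) : ℂ := a 0 * b 1 - a 1 * b 0

theorem planeDet_mulVec (M : Matrix (Fin 2) (Fin 2) ℂ) (a b : Fin 2 → ℂ) :
    planeDet (M.mulVec a) (M.mulVec b) = M.det * planeDet a b := by
  simp only [planeDet, Matrix.mulVec, dotProduct, Fin.sum_univ_two, Matrix.det_fin_two]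
  ring

theorem planeDet_smul_left (c : ℂ) (a b : Fin 2 → ℂ) : planeDet (c • a) b = c * planeDet a b := by
  simp [planeDet]; ring

theorem planeDet_smul_right (c : ℂ) (a b : Fin 2 → ℂ) : planeDet a (c • b) = c * planeDet a b := by
  simp [planeDet]; ring

theorem planeDet_idealVertex_ne {z : ℂ} (h0 : z ≠ 0) (h1 : z ≠ 1) : ∀ a b : Fin 4, a ≠ b →
    planeDet (idealVertex z a) (idealVertex z b) ≠ 0 := by
  have h2 : z - 1 ≠ 0 := sub_ne_zero.2 h1
  have h3 : 1 - z ≠ 0 := sub_ne_zero.2 h1.symm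
  intro a b hab
  fin_cases a <;> fin_cases b <;> first | exact absurd rfl hab | simp [planeDet, idealVertex, h0, h2, h3]

/-- The shape parameters are cross ratios of the ideal vertices. -/
theorem planeDet_idealVertex {z : ℂ} (h0 : z ≠ 0) (h1 : z ≠ 1) (π : Perm (Fin 4)) (hπ : Perm.sign π = 1) :
    planeDet (idealVertex z (π 3)) (idealVertex z (π 1)) * planeDet (idealVertex z (π 2)) (idealVertex z (π 0)) =
      shape z (quad (π 0) (π 1)) *
        (planeDet (idealVertex z (π 2)) (idealVertex z (π 1)) * planeDet (idealVertex z (π 3)) (idealVertex z (π 0))) := by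
  have hl : ∀ π : Perm (Fin 4), Perm.sign π = 1 → (quad (π 0) (π 1), π 0, π 1, π 2, π 3) ∈
      [((0 : Fin 3), (0 : Fin 4), (1 : Fin 4), (2 : Fin 4), (3 : Fin 4)), (0, 1, 0, 3, 2), (0, 2, 3, 0, 1), (0, 3, 2, 1, 0),
        (1, 0, 2, 3, 1), (1, 2, 0, 1, 3), (1, 1, 3, 2, 0), (1, 3, 1, 0, 2),
        (2, 0, 3, 1, 2), (2, 3, 0, 2, 1), (2, 1, 2, 0, 3), (2, 2, 1, 3, 0)] := by decide
  have h2 : 1 - z ≠ 0 := sub_ne_zero.2 h1.symm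
  have := hl π hπ
  simp only [List.mem_cons, Prod.mk.injEq, List.not_mem_nil, or_false] at this
  rcases this with ⟨e, e0, e1, e2, e3⟩ | ⟨e, e0, e1, e2, e3⟩ | ⟨e, e0, e1, e2, e3⟩ | ⟨e, e0, e1, e2, e3⟩ | ⟨e, e0, e1, e2, e3⟩ |
    ⟨e, e0, e1, e2, e3⟩ | ⟨e, e0, e1, e2, e3⟩ | ⟨e, e0, e1, e2, e3⟩ | ⟨e, e0, e1, e2, e3⟩ | ⟨e, e0, e1, e2, e3⟩ |
    ⟨e, e0, e1, e2, e3⟩ | ⟨e, e0, e1, e2, e3⟩ <;> rw [e, e0, e1, e2, e3] <;>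
  simp [planeDet, idealVertex, shape] <;> (try field_simp)

theorem planeDet_pluecker (w w' m u : Fin 2 → ℂ) :
    planeDet w m * planeDet w' u - planeDet w' m * planeDet w u = planeDet w w' * planeDet m u := by
  simp only [planeDet]; ring

theorem shape_add_one {z : ℂ} (h0 : z ≠ 0) (h1 : z ≠ 1) (q : Fin 3) : shape z (q + 1) * (1 - shape z q) = 1 := by
  have h2 : 1 - z ≠ 0 := sub_ne_zero.2 h1.symm
  fin_cases q
  · change 1 / (1 - z) * (1 - z) = 1
    field_simp
  · change (1 - 1 / z) * (1 - 1 / (1 - z)) = 1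
    field_simp; ring
  · change z * (1 - (1 - 1 / z)) = 1
    field_simp; ring

theorem shape_add_two {z : ℂ} (h0 : z ≠ 0) (h1 : z ≠ 1) (q : Fin 3) : shape z (q + 2) * shape z q = shape z q - 1 := by
  have h2 : 1 - z ≠ 0 := sub_ne_zero.2 h1.symm
  fin_cases q
  · change (1 - 1 / z) * z = z - 1
    field_simp
  · change z * (1 / (1 - z)) = 1 / (1 - z) - 1
    field_simp; ring
  · change 1 / (1 - z) * (1 - 1 / z) = 1 - 1 / z - 1
    field_simp; ring

theorem shape_ne_one {z : ℂ} (h0 : z ≠ 0) (h1 : z ≠ 1) (q : Fin 3) : shape z q ≠ 1 := by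
  intro h
  have := shape_add_one h0 h1 q
  rw [h] at this
  simp at this

/-! ### The shape parameters at a filled cusp -/

namespace Gluing.NiceCusps
variable {Tet : Type*} {T : Gluing Tet} {l : ℕ} {N : T.NiceCusps l} {i : Fin l} {lab : Fin 2 → Perm (Fin 4)}

/-- The shape parameters at the edges labelled `h` of the two tetrahedra at a cusp are inverse to each other if the
holonomy of the curve killed by the folding is trivial. -/
theorem IsLabelling.shape_mul_eq_one (h : N.IsLabelling i lab) {z : Tet → ℂ} (hz : ∀ t, z t ≠ 0 ∧ z t ≠ 1) {p : CuspPath Tet}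
    (hp : T.IsCurve p) (hi : T.IsOn p (N.cusp i)) (hm : N.IsMeridian i p) (hρ : T.HolonomyTrivial z p) :
    shape (z (N.tet i 0)) (quad (lab 0 0) (lab 0 1)) * shape (z (N.tet i 1)) (quad (lab 1 0) (lab 1 1)) = 1 := by
  obtain ⟨a, s, hw⟩ := h.exists_isWord hp hi
  obtain ⟨D, hD⟩ := hρ
  let w : Fin (p.len + 1) → Fin 4 → (Fin 2 → ℂ) := fun k j =>
    (D k : Matrix (Fin 2) (Fin 2) ℂ).mulVec (idealVertex (z (N.tet i (a k))) (lab (a k) j))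
  have hDdet : ∀ k, (D k : Matrix (Fin 2) (Fin 2) ℂ).det ≠ 0 := fun k =>
    ((Matrix.isUnit_iff_isUnit_det _).1 (D k).isUnit).ne_zero
  have hww : ∀ k j j', planeDet (w k j) (w k j') = (D k : Matrix (Fin 2) (Fin 2) ℂ).det *
      planeDet (idealVertex (z (N.tet i (a k))) (lab (a k) j)) (idealVertex (z (N.tet i (a k))) (lab (a k) j')) :=
    fun k j j' => planeDet_mulVec _ _ _
  have hne : ∀ k j j', j ≠ j' → planeDet (w k j) (w k j') ≠ 0 := fun k j j' hj => by
    rw [hww]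
    exact mul_ne_zero (hDdet k) (planeDet_idealVertex_ne (hz _).1 (hz _).2 _ _ (h.lab_ne _ hj))
  have hstep : ∀ k r, r ≠ s k → ∃ c : ℂ, c ≠ 0 ∧ w k r = c • w (k + 1) (transp (s k) r) := by
    intro k r hr
    obtain ⟨c, hc, hc'⟩ := hD k (lab (a k) r) (by rw [hw.exit]; exact h.lab_ne _ hr)
    refine ⟨c, hc, ?_⟩
    rw [hw.tet, hw.tet, hw.exit, h.perm _ (hw.ne_zero k), hw.next] at hc'
    simp only [w, hw.next]
    exact hc'
  have hτ0 : ∀ s, transp s 0 = 0 := by decide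
  have hu : ∀ k, ∃ c : ℂ, c ≠ 0 ∧ w k 0 = c • w 0 0 := by
    intro k
    induction k using Fin.cyclic_induction with
    | h0 => exact ⟨1, one_ne_zero, by simp⟩
    | h k ih =>
      obtain ⟨c, hc, hc'⟩ := ih
      obtain ⟨d, hd, hd'⟩ := hstep k 0 (hw.ne_zero k).symm
      rw [hτ0] at hd'
      refine ⟨d⁻¹ * c, mul_ne_zero (inv_ne_zero hd) hc, ?_⟩
      rw [mul_smul, ← hc', hd', inv_smul_smul₀ hd]
  let u := w 0 0
  let m := w 0 1
  have hmu : planeDet m u ≠ 0 := hne 0 1 0 (by decide)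
  have hlu : ∀ k r, r ≠ 0 → planeDet (w k r) u ≠ 0 := by
    intro k r hr h0
    obtain ⟨c, hc, hc'⟩ := hu k
    have := hne k r 0 hr
    rw [hc', planeDet_smul_right] at this
    exact this (by rw [show planeDet (w k r) (w 0 0) = 0 from h0, mul_zero])
  -- A projective coordinate with `u` at infinity and `m` at zero. It is insensitive to scaling, so
  -- the vertices shared by consecutive tetrahedra get equal coordinates and the placed tetrahedra
  -- become a chain of triangles in the plane.
  let ζ : Fin (p.len + 1) → Fin 4 → ℂ := fun k r => planeDet (w k r) m / planeDet (w k r) u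
  have hdiff : ∀ k r r', r ≠ 0 → r' ≠ 0 → ζ k r - ζ k r' =
      planeDet (w k r) (w k r') * planeDet m u / (planeDet (w k r) u * planeDet (w k r') u) := by
    intro k r r' hr hr'
    have h1 := hlu k r hr
    have h2 := hlu k r' hr'
    rw [← planeDet_pluecker, div_sub_div _ _ h1 h2]
    ring
  obtain ⟨ε, hε, h1, h23⟩ := hm
  refine mul_eq_one_of_developing (x := fun b => shape (z (N.tet i b)) (quad (lab b 0) (lab b 1)))
    (fun b => shape_ne_zero (hz _).1 (hz _).2 _) (fun b => shape_ne_one (hz _).1 (hz _).2 _) hw.next hw.ne_zero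
    (ζ := ζ) (fun k hk => ?_) (fun k => ?_) (fun k r hr hrs => ?_) (ε := -ε) ?_ (fun j hj => ?_)
  · have h2 := hdiff k 2 1 (by decide) (by decide)
    rw [hk, sub_self, eq_comm, div_eq_zero_iff] at h2
    rcases h2 with h2 | h2
    · exact mul_ne_zero (hne k 2 1 (by decide)) hmu h2
    · exact mul_ne_zero (hlu k 2 (by decide)) (hlu k 1 (by decide)) h2
  · rw [hdiff k 3 1 (by decide) (by decide), hdiff k 2 1 (by decide) (by decide)]
    obtain ⟨c, hc, hc'⟩ := hu k
    have e := planeDet_idealVertex (hz (N.tet i (a k))).1 (hz (N.tet i (a k))).2 (lab (a k)) (h.even _)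
    have e' : planeDet (w k 3) (w k 1) * planeDet (w k 2) (w k 0) = shape (z (N.tet i (a k))) (quad (lab (a k) 0) (lab (a k) 1)) *
        (planeDet (w k 2) (w k 1) * planeDet (w k 3) (w k 0)) := by
      rw [hww, hww, hww, hww]
      linear_combination (D k : Matrix (Fin 2) (Fin 2) ℂ).det ^ 2 * e
    rw [hc', planeDet_smul_right, planeDet_smul_right] at e'
    have e'' : planeDet (w k 3) (w k 1) * planeDet (w k 2) u = shape (z (N.tet i (a k))) (quad (lab (a k) 0) (lab (a k) 1)) *
        (planeDet (w k 2) (w k 1) * planeDet (w k 3) u) := mul_left_cancel₀ hc (by linear_combination e')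
    have h1 := hlu k 1 (by decide)
    have h2 := hlu k 2 (by decide)
    have h3 := hlu k 3 (by decide)
    field_simp
    linear_combination e''
  · obtain ⟨c, hc, hc'⟩ := hstep k r hrs
    simp only [ζ]
    rw [hc', planeDet_smul_left, planeDet_smul_left, mul_div_mul_left _ _ hc]
  · rcases hε with rfl | rfl <;> simp
  · have h4 := h23 (lab 0 j) (by rw [← h.zero]; exact h.lab_ne 0 (by rcases hj with rfl | rfl <;> decide))
      (by rw [← h.one]; exact h.lab_ne 0 (by rcases hj with rfl | rfl <;> decide))
    rw [← h.zero, hw.crossing_eq] at h4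
    exact h4

end Gluing.NiceCusps

theorem four_mul_sinh_half_sq (w : ℂ) : 4 * Complex.sinh (w / 2) ^ 2 = Complex.exp w + (Complex.exp w)⁻¹ - 2 := by
  have h1 : Complex.exp w = Complex.exp (w / 2) ^ 2 := by rw [← Complex.exp_nat_mul]; congr 1; push_cast; ring
  have h0 := Complex.exp_ne_zero (w / 2)
  rw [Complex.sinh, h1, Complex.exp_neg]
  field_simp
  ring

/-! ### Rows and holonomies of curves at a filled cusp -/

namespace Gluing.NiceCusps
variable {Tet : Type*} {T : Gluing Tet} {l : ℕ} {N : T.NiceCusps l} {i : Fin l} {lab : Fin 2 → Perm (Fin 4)}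

theorem IsLabelling.prod_quad {R : Type*} [CommMonoid R] (h : N.IsLabelling i lab) (a : Fin 2)
    (F : Fin 3 → R) : ∏ q, F q = F (quad (lab a 0) (lab a 1)) * F (quad (lab a 0) (lab a 2)) * F (quad (lab a 0) (lab a 3)) :=
  h.sum_quad (R := Additive R) a F

theorem IsMeridian.crossing_eq (h : N.IsLabelling i lab) {p : CuspPath Tet} (hm : N.IsMeridian i p) :
    ∃ ε : ℤ, (ε = 1 ∨ ε = -1) ∧ p.crossing (N.tet i 0) (lab 0 0) (lab 0 2) = -ε ∧
      p.crossing (N.tet i 0) (lab 0 0) (lab 0 3) = -ε := by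
  obtain ⟨ε, hε, -, h23⟩ := hm
  rw [← h.zero, ← h.one] at h23
  exact ⟨ε, hε, h23 _ (h.lab_ne 0 (by decide)) (h.lab_ne 0 (by decide)), h23 _ (h.lab_ne 0 (by decide)) (h.lab_ne 0 (by decide))⟩

/-- The rows of a curve at a cusp with two triangles. -/
theorem IsLabelling.exists_row_eq (h : N.IsLabelling i lab) {p : CuspPath Tet} (hp : T.IsCurve p) (hi : T.IsOn p (N.cusp i)) :
    ∃ u : Fin 2 → ℤ, Even (u 0 + u 1) ∧ (∀ t, (∀ b, t ≠ N.tet i b) → ∀ q, p.row t q = 0) ∧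
      ∀ b, p.row (N.tet i b) (quad (lab b 0) (lab b 1)) = u b ∧
        p.row (N.tet i b) (quad (lab b 0) (lab b 2)) = u b + (-1) ^ (b : ℕ) * p.crossing (N.tet i 0) (lab 0 0) (lab 0 3) ∧
        p.row (N.tet i b) (quad (lab b 0) (lab b 3)) = u b - (-1) ^ (b : ℕ) * p.crossing (N.tet i 0) (lab 0 0) (lab 0 2) := by
  obtain ⟨a, s, hw⟩ := h.exists_isWord hp hi
  have hcr : ∀ (b : Fin 2) (j : Fin 4), p.crossing (N.tet i b) (lab b 0) (lab b j) =
      (-1) ^ (b : ℕ) * p.crossing (N.tet i 0) (lab 0 0) (lab 0 j) := by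
    intro b j
    fin_cases b
    · change _ = (-1) ^ 0 * _
      rw [pow_zero, one_mul]; rfl
    · change _ = (-1) ^ 1 * _
      have := hw.crossing_one_sub 0 j
      rw [show (1 - 0 : Fin 2) = 1 by decide] at this
      rw [pow_one, neg_one_mul]
      exact this
  refine ⟨fun b => p.corner (N.tet i b) (lab b 0) (lab b 1), ?_, fun t ht q => hw.row_eq_zero ht q, fun b => ⟨?_, ?_, ?_⟩⟩
  · have h1 := hw.even_sum_corner
    simp only [Fin.sum_univ_two, Fin.sum_univ_four, CuspPath.corner_self, IsWord.corner_two h, IsWord.corner_three h, hcr 1 2, hcr 1 3] at h1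
    simp only [Fin.val_one, pow_one] at h1
    obtain ⟨k, hk⟩ := h1
    exact ⟨k - (p.corner (N.tet i 0) (lab 0 0) (lab 0 1) + p.corner (N.tet i 1) (lab 1 0) (lab 1 1)), by beta_reduce; linarith⟩
  · rw [hw.row_quad b (by decide)]
  · rw [hw.row_quad b (by decide), IsWord.corner_two h, hcr]
  · rw [hw.row_quad b (by decide), IsWord.corner_three h, hcr]

/-- The holonomy of the core curve of the filled solid torus. -/
theorem IsLabelling.holonomy_eq [Fintype Tet] (h : N.IsLabelling i lab) {z : Tet → ℂ} (hz : ∀ t, z t ≠ 0 ∧ z t ≠ 1)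
    (hxy : shape (z (N.tet i 0)) (quad (lab 0 0) (lab 0 1)) * shape (z (N.tet i 1)) (quad (lab 1 0) (lab 1 1)) = 1)
    {p : CuspPath Tet} (hm : N.IsMeridian i p) {γ : CuspPath Tet} (hγ : T.IsCurve γ)
    (hi : T.IsOn γ (N.cusp i)) (hpγ : N.IntersectOnce i p γ) :
    γ.holonomy z + (γ.holonomy z)⁻¹ = -(shape (z (N.tet i 0)) (quad (lab 0 0) (lab 0 1)) +
      (shape (z (N.tet i 0)) (quad (lab 0 0) (lab 0 1)))⁻¹) := by
  classical
  obtain ⟨ε, hε, m2, m3⟩ := hm.crossing_eq h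
  obtain ⟨u, hu, h0, h1⟩ := h.exists_row_eq hγ hi
  have hn := hpγ (lab 0 2) (lab 0 3) (h.lab_ne 0 (by decide)) (by rw [← h.zero]; exact h.lab_ne 0 (by decide))
    (by rw [← h.zero]; exact h.lab_ne 0 (by decide))
  rw [← h.zero, m2, m3] at hn
  set n2 := γ.crossing (N.tet i 0) (lab 0 0) (lab 0 2)
  set n3 := γ.crossing (N.tet i 0) (lab 0 0) (lab 0 3)
  have hd : n3 - n2 = 1 ∨ n3 - n2 = -1 := by
    rcases hε with rfl | rfl <;> rcases (abs_eq zero_le_one).1 hn with h | h <;> [right; left; left; right] <;> linarith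
  have hhol : γ.holonomy z = (∏ q, shape (z (N.tet i 0)) q ^ γ.row (N.tet i 0) q) * ∏ q, shape (z (N.tet i 1)) q ^ γ.row (N.tet i 1) q := by
    refine Fintype.prod_eq_mul _ _ (N.tet_ne i) fun t ht => Finset.prod_eq_one fun q _ => ?_
    rw [h0 t (fun b => by fin_cases b; exacts [ht.1, ht.2]), zpow_zero]
  rw [h.prod_quad 0, h.prod_quad 1, (h1 0).1, (h1 0).2.1, (h1 0).2.2, (h1 1).1, (h1 1).2.1, (h1 1).2.2, h.quad_two, h.quad_two,
    h.quad_three, h.quad_three] at hhol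
  have hA := hz (N.tet i 0)
  have hB := hz (N.tet i 1)
  have ex := shape_add_one hA.1 hA.2 (quad (lab 0 0) (lab 0 1))
  have ex' := shape_add_two hA.1 hA.2 (quad (lab 0 0) (lab 0 1))
  have ey := shape_add_one hB.1 hB.2 (quad (lab 1 0) (lab 1 1))
  have ey' := shape_add_two hB.1 hB.2 (quad (lab 1 0) (lab 1 1))
  have hx1 := shape_ne_zero hA.1 hA.2 (quad (lab 0 0) (lab 0 1))
  have hx2 := shape_ne_zero hA.1 hA.2 (quad (lab 0 0) (lab 0 1) + 1)
  have hx3 := shape_ne_zero hA.1 hA.2 (quad (lab 0 0) (lab 0 1) + 2)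
  set x1 := shape (z (N.tet i 0)) (quad (lab 0 0) (lab 0 1))
  set x2 := shape (z (N.tet i 0)) (quad (lab 0 0) (lab 0 1) + 1)
  set x3 := shape (z (N.tet i 0)) (quad (lab 0 0) (lab 0 1) + 2)
  set y1 := shape (z (N.tet i 1)) (quad (lab 1 0) (lab 1 1))
  set y2 := shape (z (N.tet i 1)) (quad (lab 1 0) (lab 1 1) + 1)
  set y3 := shape (z (N.tet i 1)) (quad (lab 1 0) (lab 1 1) + 2)
  -- Since `x1 * y1 = 1`, the second triangle is similar to the mirror image of the first: its other
  -- parameters are the inverses of those of the first in reversed order.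
  have e1 : y1 = x1⁻¹ := eq_inv_of_mul_eq_one_right hxy
  have e23 : x2 * x3 = -x1⁻¹ := by
    have : x2 * x3 * x1 = -1 := by linear_combination x2 * ex' - ex
    field_simp
    linear_combination this
  have e3 : y3 = x2⁻¹ := by
    rw [e1] at ey'
    have : y3 = 1 - x1 := by
      field_simp at ey'
      exact ey'
    rw [this]
    exact eq_inv_of_mul_eq_one_right ex
  have e2 : y2 = x3⁻¹ := by
    rw [e1] at ey
    have h3 : y2 * (x3 * x1) = x1 := by
      field_simp at ey
      linear_combination ey + y2 * ex'
    refine eq_inv_of_mul_eq_one_left (mul_right_cancel₀ hx1 ?_)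
    linear_combination h3
  have key : γ.holonomy z = (-x1⁻¹) ^ (n3 - n2) := by
    rw [hhol, e1, e2, e3, ← e23]
    simp only [Fin.val_zero, Fin.val_one, pow_zero, pow_one, one_mul, neg_one_mul, zpow_add₀ hx2,
      zpow_sub₀ hx3, zpow_sub₀ (inv_ne_zero hx2), zpow_add₀ (inv_ne_zero hx3), zpow_neg, inv_zpow, inv_inv,
      zpow_sub₀ (mul_ne_zero hx2 hx3), mul_zpow]
    -- The undetermined constants `u` contribute only a power of `-1`, with even exponent because
    -- the number of arcs is even.
    have hs : (x1 * x2 * x3) ^ (u 0) * ((x1 * x2 * x3) ^ (u 1))⁻¹ = 1 := by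
      have : x1 * x2 * x3 = -1 := by
        rw [mul_assoc, e23]
        field_simp
      rw [this, ← zpow_neg, ← zpow_add₀ (by norm_num), Even.neg_one_zpow]
      have := hu.add (even_two_mul (-u 1))
      rwa [show u 0 + u 1 + 2 * -u 1 = u 0 + -u 1 by ring] at this
    simp only [mul_zpow] at hs
    have h1 := zpow_ne_zero (u 1) hx1
    have h2 := zpow_ne_zero (u 1) hx2
    have h3 := zpow_ne_zero (u 1) hx3
    have h4 := zpow_ne_zero n2 hx2
    have h5 := zpow_ne_zero n2 hx3
    field_simp
    field_simp at hs
    linear_combination hs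
  rw [key]
  rcases hd with h | h
  · rw [h]; simp
  · rw [h]; simp; ring

end Gluing.NiceCusps

/-! ## Determinants -/

/-- Each determinant is an integral multiple of the other. If they do not vanish, the two integers
are inverse to each other. The rows need not be independent over the integers. -/
theorem Matrix.det_eq_or_eq_neg_of_span_eq {ι : Type*} [Fintype ι] [DecidableEq ι] {A B : ι → ι → ℂ}
    (h : Submodule.span ℤ (Set.range A) = Submodule.span ℤ (Set.range B)) :
    (Matrix.of A).det = (Matrix.of B).det ∨ (Matrix.of A).det = -(Matrix.of B).det := by
  have key : ∀ A B : ι → ι → ℂ, Submodule.span ℤ (Set.range A) ≤ Submodule.span ℤ (Set.range B) →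
      ∃ k : ℤ, (Matrix.of A).det = k * (Matrix.of B).det := by
    intro A B hAB
    have h1 : ∀ i, ∃ c : ι → ℤ, ∑ j, c j • B j = A i := fun i =>
      (Submodule.mem_span_range_iff_exists_fun ℤ).1 (hAB (Submodule.subset_span ⟨i, rfl⟩))
    choose P hP using h1
    refine ⟨(Matrix.of P).det, ?_⟩
    have h2 : Matrix.of A = (Matrix.of P).map (Int.castRingHom ℂ) * Matrix.of B := by
      ext i j
      rw [Matrix.of_apply, ← hP i, Matrix.mul_apply, Finset.sum_apply]
      exact Finset.sum_congr rfl fun k _ => by simp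
    rw [h2, Matrix.det_mul, ← RingHom.mapMatrix_apply, ← RingHom.map_det]
    rfl
  obtain ⟨k, hk⟩ := key A B h.le
  obtain ⟨m, hm⟩ := key B A h.ge
  by_cases h0 : (Matrix.of A).det = 0
  · left; rw [hm, h0, mul_zero]
  · have h1 : k * m = 1 := by
      have : ((k * m : ℤ) : ℂ) * (Matrix.of A).det = 1 * (Matrix.of A).det := by
        push_cast
        rw [mul_assoc, ← hm, one_mul, ← hk]
      exact_mod_cast mul_right_cancel₀ h0 this
    rcases Int.eq_one_or_neg_one_of_mul_eq_one h1 with rfl | rfl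
    · left; rw [hk]; simp
    · right; rw [hk]; simp

/-- A determinant in which all rows but those numbered by the first summand are proportional on each pair of columns
`inl i`, `inr (inr i)`. -/
theorem Matrix.det_mul_prod_eq_of_proportional {K m n : Type*} [CommRing K] [Fintype m] [Fintype n] [DecidableEq m] [DecidableEq n]
    {M : Matrix (m ⊕ (n ⊕ m)) (m ⊕ (n ⊕ m)) K} {a b ω v : m → K}
    (h1 : ∀ r i, M (Sum.inr r) (Sum.inl i) * b i = M (Sum.inr r) (Sum.inr (Sum.inr i)) * a i)
    (h2 : ∀ i j, M (Sum.inl i) (Sum.inl j) * b j - M (Sum.inl i) (Sum.inr (Sum.inr j)) * a j = if i = j then ω i else 0)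
    (h3 : ∀ i t, M (Sum.inr (Sum.inr i)) (Sum.inr (Sum.inl t)) = 0)
    (h4 : ∀ i j, M (Sum.inr (Sum.inr i)) (Sum.inr (Sum.inr j)) = if i = j then v i else 0) :
    M.det * ∏ i, b i = (∏ i, ω i) * (Matrix.of fun s t => M (Sum.inr (Sum.inl s)) (Sum.inr (Sum.inl t))).det * ∏ i, v i := by
  -- The column operation: scale column `inl i` by `b i` and subtract `a i` times its partner. It
  -- clears all rows but the first block in these columns.
  let E : Matrix (m ⊕ (n ⊕ m)) (m ⊕ (n ⊕ m)) K :=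
    Matrix.fromBlocks (Matrix.diagonal b) 0 (Matrix.fromRows 0 (Matrix.diagonal fun i => -a i)) 1
  have hE : E.det = ∏ i, b i := by
    rw [Matrix.det_fromBlocks_zero₁₂, Matrix.det_diagonal, Matrix.det_one, mul_one]
  have hM : M * E = Matrix.fromBlocks (Matrix.diagonal ω) M.toBlocks₁₂ 0 M.toBlocks₂₂ := by
    rw [← M.fromBlocks_toBlocks, Matrix.fromBlocks_multiply]
    simp only [Matrix.toBlocks_fromBlocks₁₂, Matrix.toBlocks_fromBlocks₂₂, Matrix.mul_zero, Matrix.mul_one, zero_add]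
    have hs : ∀ (f : n ⊕ m → K) (j : m), ∑ x, f x * Matrix.fromRows (0 : Matrix n m K) (Matrix.diagonal fun i => -a i) x j =
        -(f (Sum.inr j) * a j) := by
      intro f j
      rw [Fintype.sum_sum_type]
      simp [Matrix.fromRows_apply_inl, Matrix.fromRows_apply_inr, Matrix.diagonal_apply]
    congr 1
    · ext i j
      rw [Matrix.add_apply, Matrix.mul_diagonal, Matrix.mul_apply, hs, Matrix.diagonal_apply, ← h2]
      simp only [Matrix.toBlocks₁₁, Matrix.toBlocks₁₂, Matrix.of_apply]
      ring
    · ext r j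
      rw [Matrix.add_apply, Matrix.mul_diagonal, Matrix.mul_apply, hs]
      simp only [Matrix.toBlocks₂₁, Matrix.toBlocks₂₂, Matrix.of_apply, Matrix.zero_apply]
      rw [h1]; ring
  have h22 : M.toBlocks₂₂ = Matrix.fromBlocks (Matrix.of fun s t => M (Sum.inr (Sum.inl s)) (Sum.inr (Sum.inl t)))
      M.toBlocks₂₂.toBlocks₁₂ 0 (Matrix.diagonal v) := by
    rw [← M.toBlocks₂₂.fromBlocks_toBlocks]
    congr 1
    · ext i t
      exact h3 i t
    · ext i j
      rw [Matrix.diagonal_apply]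
      exact h4 i j
  rw [← hE, ← Matrix.det_mul, hM, Matrix.det_fromBlocks_zero₂₁, h22, Matrix.det_fromBlocks_zero₂₁, Matrix.det_diagonal,
    Matrix.det_diagonal, mul_assoc]

/-! ## The entries of the matrix -/

/-- The coefficients of the entries of the matrix in the definition of the 1-loop invariant. -/
noncomputable def loopCoeff (z : ℂ) : Fin 3 → ℂ := ![shape z 2, -1, z⁻¹]

/-- Together with `loopCoeff_self`, this makes the entries of a column computable from any edge
type, independently of how a labelling sits relative to the fixed labels. -/
theorem loopCoeff_add_one {z : ℂ} (h0 : z ≠ 0) (h1 : z ≠ 1) (q : Fin 3) :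
    loopCoeff z (q + 1) = -shape z q * loopCoeff z (q + 2) := by
  have h2 : 1 - z ≠ 0 := sub_ne_zero.2 h1.symm
  fin_cases q
  · change -1 = -z * z⁻¹
    field_simp
  · change z⁻¹ = -(1 / (1 - z)) * (1 - 1 / z)
    field_simp; ring
  · change 1 - 1 / z = -(1 - 1 / z) * -1
    ring

theorem loopCoeff_self {z : ℂ} (h0 : z ≠ 0) (h1 : z ≠ 1) (q : Fin 3) :
    loopCoeff z q = (shape z q - 1) * loopCoeff z (q + 2) := by
  have h2 : 1 - z ≠ 0 := sub_ne_zero.2 h1.symm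
  fin_cases q
  · change 1 - 1 / z = (z - 1) * z⁻¹
    field_simp
  · change -1 = (1 / (1 - z) - 1) * (1 - 1 / z)
    field_simp; ring
  · change z⁻¹ = (1 - 1 / z - 1) * -1
    field_simp; ring

theorem loopCoeff_ne_zero {z : ℂ} (h0 : z ≠ 0) (h1 : z ≠ 1) (q : Fin 3) : loopCoeff z q ≠ 0 := by
  fin_cases q
  · exact Gluing.shape_ne_zero h0 h1 2
  · change (-1 : ℂ) ≠ 0
    norm_num
  · exact inv_ne_zero h0

/-- The contribution of a tetrahedron to the product given by a flattening which vanishes on one of its edges. -/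
theorem loopCoeff_mul_flattening {z : ℂ} (h0 : z ≠ 0) (h1 : z ≠ 1) {f : Fin 3 → ℤ} (hf : f 0 + f 1 + f 2 = 1) {q : Fin 3}
    (hq : f q = 0) : ∃ n : ℤ, loopCoeff z (q + 2) * (shape z 0 ^ f 2 * shape z 2 ^ (-f 0)) = (-1) ^ n * (shape z q)⁻¹ ^ f (q + 1) := by
  have h2 : 1 - z ≠ 0 := sub_ne_zero.2 h1.symm
  have s0 := Gluing.shape_ne_zero h0 h1 0
  have s2 := Gluing.shape_ne_zero h0 h1 2
  fin_cases q
  · refine ⟨0, ?_⟩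
    have e : f 2 = 1 + -f 1 := by have : f 0 = 0 := hq; linarith
    have e0 : f 0 = 0 := hq
    change z⁻¹ * _ = _ * (shape z 0)⁻¹ ^ f 1
    rw [e, e0, zpow_add₀ s0, inv_zpow, zpow_neg, show shape z 0 = z from rfl]
    field_simp
    simp
  · refine ⟨f 2, ?_⟩
    have e : -f 0 = f 2 + -1 := by have : f 1 = 0 := hq; linarith
    change shape z 2 * _ = _ * (shape z 1)⁻¹ ^ f 2
    rw [e, zpow_add₀ s2, ← mul_zpow, zpow_neg_one,
      show shape z 2 * (shape z 0 ^ f 2 * (shape z 2 ^ f 2 * (shape z 2)⁻¹)) = shape z 0 ^ f 2 * shape z 2 ^ f 2 by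
        field_simp, ← mul_zpow]
    congr 1
    change z * (1 - 1 / z) = -1 * (1 / (1 - z))⁻¹
    field_simp; ring
  · refine ⟨1, ?_⟩
    have e : f 2 = 0 := hq
    change -1 * _ = _ * (shape z 2)⁻¹ ^ f 0
    rw [e]
    simp

namespace Gluing
variable {Tet : Type*} (T : Gluing Tet)

/-- The row of the matrix which is given by a row of exponents. -/
noncomputable def loopRow (z : Tet → ℂ) : (Tet → Fin 3 → ℤ) →ₗ[ℤ] (Tet → ℂ) where
  toFun x t := ∑ q, (x t q : ℂ) * loopCoeff (z t) q
  map_add' x y := by funext t; simp [add_mul, Finset.sum_add_distrib]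
  map_smul' k x := by funext t; simp [mul_assoc, Finset.mul_sum]

theorem loopRow_apply (z : Tet → ℂ) (x : Tet → Fin 3 → ℤ) (t : Tet) :
    loopRow z x t = ∑ q, (x t q : ℂ) * loopCoeff (z t) q := rfl

theorem oneLoopMatrix_eq {z : Tet → ℂ} (hz : ∀ t, z t ≠ 0) (α : T.Cusp → CuspPath Tet) (S : Set T.Edge) (r : Tet ≃ S ⊕ T.Cusp) :
    T.oneLoopMatrix α z S r = Matrix.of fun i => loopRow z (T.nzRow α S (r i)) := by
  ext i t
  have h := hz t
  simp only [oneLoopMatrix, Matrix.of_apply, loopRow_apply, Fin.sum_univ_three]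
  change _ = _ * (1 - 1 / z t) + _ * (-1) + _ * (z t)⁻¹
  rw [show shape (z t) 2 = 1 - 1 / z t from rfl]
  field_simp
  ring

/-- The rows of exponents which are constant on each tetrahedron. -/
def constRows (Tet : Type*) : Submodule ℤ (Tet → Fin 3 → ℤ) where
  carrier := {x | ∀ t q q', x t q = x t q'}
  zero_mem' _ _ _ := rfl
  add_mem' hx hy t q q' := by simp only [Pi.add_apply]; rw [hx t q q', hy t q q']
  smul_mem' k x hx t q q' := by simp only [Pi.smul_apply]; rw [hx t q q']

theorem loopRow_of_mem_constRows {z : Tet → ℂ} (hz : ∀ t, z t ≠ 0) {x : Tet → Fin 3 → ℤ} (hx : x ∈ constRows Tet) :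
    loopRow z x = 0 := by
  funext t
  have h := hz t
  rw [loopRow_apply, Fin.sum_univ_three, hx t 1 0, hx t 2 0]
  change _ * (1 - 1 / z t) + _ * (-1) + _ * (z t)⁻¹ = 0
  field_simp
  ring

/-- The three coefficients of a tetrahedron sum up to zero, so the relations `z z' z'' = -1` do not
show in the matrix and the row modules matter only modulo them. -/
theorem span_loopRow_eq {z : Tet → ℂ} (hz : ∀ t, z t ≠ 0) {ι ι' : Type*} {A : ι → Tet → Fin 3 → ℤ} {B : ι' → Tet → Fin 3 → ℤ}
    (h : Submodule.span ℤ (Set.range A) ⊔ constRows Tet = Submodule.span ℤ (Set.range B) ⊔ constRows Tet) :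
    Submodule.span ℤ (Set.range fun i => loopRow z (A i)) = Submodule.span ℤ (Set.range fun i => loopRow z (B i)) := by
  have h0 : (constRows Tet).map (loopRow z) = ⊥ := by
    rw [eq_bot_iff]
    rintro _ ⟨x, hx, rfl⟩
    exact loopRow_of_mem_constRows hz hx
  have h1 := congrArg (Submodule.map (loopRow z)) h
  rw [Submodule.map_sup, Submodule.map_sup, h0, sup_bot_eq, sup_bot_eq, Submodule.map_span, Submodule.map_span, ← Set.range_comp,
    ← Set.range_comp] at h1
  exact h1

end Gluing

theorem CuspPath.map_row {Tet Tet' : Type*} {f : Tet' → Tet} (hf : Function.Injective f) (p : CuspPath Tet') (t : Tet') (q : Fin 3) :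
    (p.map f).row (f t) q = p.row t q := by
  classical
  unfold row
  refine Finset.sum_congr rfl fun k _ => ?_
  have h : (p.map f).tet k = f t ↔ p.tet k = t := hf.eq_iff
  simp only [h]
  congr

theorem CuspPath.map_row_eq_zero {Tet Tet' : Type*} {f : Tet' → Tet} (p : CuspPath Tet') {t : Tet} (ht : ∀ t', f t' ≠ t) (q : Fin 3) :
    (p.map f).row t q = 0 :=
  Finset.sum_eq_zero fun _ _ => if_neg fun h => ht _ h.1

theorem loopCoeff_sum {z : ℂ} (h0 : z ≠ 0) (h1 : z ≠ 1) (q : Fin 3) :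
    loopCoeff z q + loopCoeff z (q + 1) + loopCoeff z (q + 2) = 0 := by
  rw [loopCoeff_add_one h0 h1, loopCoeff_self h0 h1]; ring

namespace Gluing

/-! ### Modules spanned by the rows -/

section span
variable {Tet : Type*} {T : Gluing Tet}

theorem edgeRow_mem_range (e : T.Edge) : T.edgeRow e ∈ LinearMap.range T.rowSumHom := by
  classical
  exact ⟨Pi.single e 1, by funext t q; exact (T.edgeRow_eq e t q).symm⟩

/-- The rows of a generating set of edges, together with arbitrary further rows. -/
theorem Generates.span_eq [Finite T.Edge] {S : Set T.Edge} (hS : T.Generates S) {κ : Type*} (R : κ → Tet → Fin 3 → ℤ) :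
    Submodule.span ℤ (Set.range (Sum.elim (fun e : S => T.edgeRow e.1) R)) ⊔ constRows Tet =
      LinearMap.range T.rowSumHom ⊔ Submodule.span ℤ (Set.range R) ⊔ constRows Tet := by
  have := Fintype.ofFinite T.Edge
  refine le_antisymm (sup_le (Submodule.span_le.2 ?_) le_sup_right) (sup_le (sup_le ?_ ?_) le_sup_right)
  · rintro _ ⟨e | k, rfl⟩
    · exact Submodule.mem_sup_left (Submodule.mem_sup_left (edgeRow_mem_range _))
    · exact Submodule.mem_sup_left (Submodule.mem_sup_right (Submodule.subset_span ⟨k, rfl⟩))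
  · rintro _ ⟨c, rfl⟩
    change T.rowSum c ∈ _
    rw [rowSum_eq_sum]
    refine Submodule.sum_mem _ fun e _ => Submodule.smul_mem _ _ ?_
    refine (Submodule.span_le.2 ?_ : Submodule.span ℤ _ ≤ _) (hS e)
    rintro x (⟨e, he, rfl⟩ | ⟨t, ht⟩)
    · exact Submodule.mem_sup_left (Submodule.subset_span ⟨Sum.inl ⟨e, he⟩, rfl⟩)
    · refine Submodule.mem_sup_right fun s q q' => ?_
      by_cases h : s = t
      · rw [(ht s q).1 h, (ht s q').1 h]
      · rw [(ht s q).2 h, (ht s q').2 h]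
  · refine (Submodule.span_le.2 ?_).trans le_sup_left
    rintro _ ⟨k, rfl⟩
    exact Submodule.subset_span ⟨Sum.inr k, rfl⟩

theorem Homologous.row_sub_mem {p p' : CuspPath Tet} (h : T.Homologous p p') :
    p.row - p'.row ∈ LinearMap.range T.rowSumHom ⊔ constRows Tet := by
  obtain ⟨c, u, hc⟩ := h.exists_row_eq
  refine Submodule.mem_sup.2 ⟨T.rowSum c, ⟨c, rfl⟩, fun t _ => u t, fun _ _ _ => rfl, ?_⟩
  funext t q
  simp only [Pi.add_apply, Pi.sub_apply, hc]
  ring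

end span

theorem sum_mul_dual (x : Fin 3 → ℤ) (k : ℤ) (q : Fin 3) (hx1 : x q = x (q + 1) + k) (hx2 : x (q + 2) = x (q + 1)) (C : Fin 3 → ℤ) :
    ∑ r, x r * dual C r = k * (C (q + 2) - C (q + 1)) := by
  rw [Fin.sum_three_add _ q, hx1, hx2]
  have hq : ∀ q : Fin 3, q + 1 + 2 = q ∧ q + 1 + 1 = q + 2 ∧ q + 2 + 2 = q + 1 ∧ q + 2 + 1 = q := by decide
  obtain ⟨h1, h2, h3, h4⟩ := hq q
  simp only [dual, h1, h2, h3, h4]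
  ring

namespace NiceCusps.Filling
variable {Tet : Type*} {T : Gluing Tet} {l : ℕ} {N : T.NiceCusps l}
variable {Tet' : Type*} {T' : Gluing Tet'} {lab : Fin l → Fin 2 → Perm (Fin 4)} (F : N.Filling T')
variable [Fintype Tet] [Fintype Tet']

/-- Generation in the filled triangulation holds only modulo rows constant on tetrahedra, and such
an ambiguity must not survive on the removed pairs. Pairing `c` with the dual of a function
separating the identified edges at cusp `i` gives zero by involutivity. The remaining tetrahedra
contribute nothing, which forces equal values on all three outer edges of the pair. -/
theorem rowSum_mem_constRows (hT : T.IsIdealTriangulation) (hT' : T'.IsIdealTriangulation) (h : ∀ i, N.IsLabelling i (lab i))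
    {c : T.Edge → ℤ} (hc : ∀ i, c (N.blockEdge i (lab i) 2) = c (N.blockEdge i (lab i) 3))
    (hemb : (fun t => T.rowSum c (F.emb t)) ∈ constRows Tet') : T.rowSum c ∈ constRows Tet := by
  have hrow : ∀ i a, T.rowSum c (N.tet i a) (quad (lab i a 0) (lab i a 1)) =
      c (N.blockEdge i (lab i) 0) + c (N.blockEdge i (lab i) 1) ∧
      T.rowSum c (N.tet i a) (quad (lab i a 0) (lab i a 1) + 1) = c (N.blockEdge i (lab i) 0) + c (N.blockEdge i (lab i) 2) ∧
      T.rowSum c (N.tet i a) (quad (lab i a 0) (lab i a 1) + 2) = c (N.blockEdge i (lab i) 0) + c (N.blockEdge i (lab i) 2) := by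
    intro i a
    rw [← (h i).quad_two, ← (h i).quad_three, (h i).rowSum_eq c a (by decide), (h i).rowSum_eq c a (by decide),
      (h i).rowSum_eq c a (by decide), hc]
    exact ⟨rfl, rfl, rfl⟩
  have key : ∀ i, c (N.blockEdge i (lab i) 1) = c (N.blockEdge i (lab i) 2) := by
    intro i
    obtain ⟨C, hC⟩ := F.exists_dual hT hT' h (Pi.single i 1)
    have h1 := pairing_rowSum_dual (T := T) C c
    unfold pairing at h1
    rw [F.sum_tet h] at h1
    have h2 : ∑ t, ∑ q, T.rowSum c (F.emb t) q * dual (T.rowSum C (F.emb t)) q = 0 := by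
      refine Finset.sum_eq_zero fun t _ => ?_
      rw [sum_mul_dual _ 0 0 (by rw [add_zero]; exact hemb t _ _) (hemb t _ _), zero_mul]
    have h3 : ∀ j a, ∑ q, T.rowSum c (N.tet j a) q * dual (T.rowSum C (N.tet j a)) q =
        -(if j = i then c (N.blockEdge j (lab j) 1) - c (N.blockEdge j (lab j) 2) else 0) := by
      intro j a
      obtain ⟨e1, e2, e3⟩ := hrow j a
      rw [sum_mul_dual _ (c (N.blockEdge j (lab j) 1) - c (N.blockEdge j (lab j) 2)) (quad (lab j a 0) (lab j a 1))
        (by rw [e1, e2]; ring) (e3.trans e2.symm), ← (h j).quad_two, ← (h j).quad_three, (h j).rowSum_eq C a (by decide),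
        (h j).rowSum_eq C a (by decide), hC, Pi.single_apply]
      split_ifs <;> ring
    rw [h2, zero_add, Finset.sum_congr rfl fun j _ => by rw [h3, h3], Finset.sum_add_distrib, Finset.sum_neg_distrib,
      Finset.sum_ite_eq' Finset.univ i, if_pos (Finset.mem_univ _)] at h1
    linarith
  have hval : ∀ i a q, T.rowSum c (N.tet i a) q = c (N.blockEdge i (lab i) 0) + c (N.blockEdge i (lab i) 2) := by
    intro i a q
    obtain ⟨e1, e2, e3⟩ := hrow i a
    rw [key] at e1
    have hq : ∀ q p : Fin 3, q = p ∨ q = p + 1 ∨ q = p + 2 := by decide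
    rcases hq q (quad (lab i a 0) (lab i a 1)) with rfl | rfl | rfl
    exacts [e1, e2, e3]
  intro t q q'
  rcases F.tet_cases t with ⟨t', rfl⟩ | ⟨i, a, rfl⟩
  · exact hemb t' q q'
  · rw [hval, hval]

/-- The exponents of all the edges are generated by lifts of those of the filled triangulation and by functions that
separate the edges which are identified by the folding. -/
theorem rowSum_mem [DecidableEq T'.Edge] (hT : T.IsIdealTriangulation) (hT' : T'.IsIdealTriangulation)
    (h : ∀ i, N.IsLabelling i (lab i))
    {S : Set T'.Edge} (hS : T'.Generates S) {W : Submodule ℤ (Tet → Fin 3 → ℤ)} (hW : constRows Tet ≤ W)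
    {L : T'.Edge → T.Edge → ℤ} (hL : ∀ E i, L E (N.blockEdge i (lab i) 2) = L E (N.blockEdge i (lab i) 3))
    (hL' : ∀ E t a b, T'.edgeVal (Pi.single E 1) t a b = T.edgeVal (L E) (F.emb t) a b) (hLW : ∀ E ∈ S, T.rowSum (L E) ∈ W)
    {C : Fin l → T.Edge → ℤ}
    (hC : ∀ i j, C i (N.blockEdge j (lab j) 2) = C i (N.blockEdge j (lab j) 3) + (Pi.single i 1 : Fin l → ℤ) j)
    (hCW : ∀ i, T.rowSum (C i) ∈ W) (c : T.Edge → ℤ) : T.rowSum c ∈ W := by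
  have := Fintype.ofFinite T'.Edge
  have hadd : ∀ c c' : T.Edge → ℤ, T.rowSum (c + c') = T.rowSum c + T.rowSum c' := T.rowSum_add
  have hsub : ∀ c c' : T.Edge → ℤ, T.rowSum (c - c') = T.rowSum c - T.rowSum c' := map_sub T.rowSumHom
  have hspan : ∀ x ∈ Submodule.span ℤ (T'.edgeRow '' S ∪ {x | ∃ t : Tet', ∀ s q, (s = t → x s q = 1) ∧ (s ≠ t → x s q = 0)}),
      ∃ C : T.Edge → ℤ, (∀ i, C (N.blockEdge i (lab i) 2) = C (N.blockEdge i (lab i) 3)) ∧ T.rowSum C ∈ W ∧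
        (x - fun t => T.rowSum C (F.emb t)) ∈ constRows Tet' := by
    have h0 : T.rowSum 0 = 0 := map_zero T.rowSumHom
    intro x hx
    induction hx using Submodule.span_induction with
    | mem x hx =>
      rcases hx with ⟨E, hE, rfl⟩ | ⟨t, ht⟩
      · refine ⟨L E, hL E, hLW E hE, fun t q q' => ?_⟩
        simp only [Pi.sub_apply]
        rw [edgeRow_eq, edgeRow_eq, F.rowSum_emb (hL' E), sub_self, sub_self]
      · refine ⟨0, fun _ => rfl, by rw [h0]; exact W.zero_mem, fun s q q' => ?_⟩
        rw [h0]
        simp only [Pi.sub_apply, Pi.zero_apply]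
        by_cases h : s = t
        · rw [(ht s q).1 h, (ht s q').1 h]
        · rw [(ht s q).2 h, (ht s q').2 h]
    | zero => exact ⟨0, fun _ => rfl, by rw [h0]; exact W.zero_mem, by rw [h0]; exact fun _ _ _ => rfl⟩
    | add x y _ _ ihx ihy =>
      obtain ⟨C, h1, h2, h3⟩ := ihx
      obtain ⟨C', h1', h2', h3'⟩ := ihy
      refine ⟨C + C', fun i => by simp only [Pi.add_apply, h1, h1'], by rw [hadd]; exact W.add_mem h2 h2', ?_⟩
      rw [hadd]
      convert (constRows Tet').add_mem h3 h3' using 1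
      funext t q
      simp only [Pi.add_apply, Pi.sub_apply]
      ring
    | smul k x _ ih =>
      obtain ⟨C, h1, h2, h3⟩ := ih
      refine ⟨k • C, fun i => by simp only [Pi.smul_apply, h1], by rw [T.rowSum_smul]; exact W.smul_mem k h2, ?_⟩
      rw [T.rowSum_smul]
      convert (constRows Tet').smul_mem k h3 using 1
      funext t q
      simp only [Pi.smul_apply, Pi.sub_apply, smul_eq_mul]
      ring
  -- A compatible function descends, its row is generated by `S` modulo constant rows, and the
  -- generating combination lifts. The difference is constant on all tetrahedra.
  have hcompat : ∀ c : T.Edge → ℤ, (∀ i, c (N.blockEdge i (lab i) 2) = c (N.blockEdge i (lab i) 3)) → T.rowSum c ∈ W := by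
    intro c hc
    obtain ⟨c', hc'⟩ := F.exists_edgeVal_eq h hc
    have hx : T'.rowSum c' ∈ Submodule.span ℤ (T'.edgeRow '' S ∪
        {x | ∃ t : Tet', ∀ s q, (s = t → x s q = 1) ∧ (s ≠ t → x s q = 0)}) := by
      rw [rowSum_eq_sum]
      exact Submodule.sum_mem _ fun E _ => Submodule.smul_mem _ _ (hS E)
    obtain ⟨C, h1, h2, h3⟩ := hspan _ hx
    have h4 : T.rowSum (c - C) ∈ constRows Tet := by
      refine F.rowSum_mem_constRows hT hT' h (fun i => by simp only [Pi.sub_apply, hc, h1]) ?_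
      convert h3 using 1
      funext t q
      rw [hsub]
      simp only [Pi.sub_apply]
      rw [F.rowSum_emb hc']
    have h5 := W.add_mem (hW h4) h2
    rwa [hsub, sub_add_cancel] at h5
  -- Subtracting `m i` times the separating functions makes `c` compatible.
  let m : Fin l → ℤ := fun i => c (N.blockEdge i (lab i) 2) - c (N.blockEdge i (lab i) 3)
  have h1 : T.rowSum (∑ i, m i • C i) = ∑ i, m i • T.rowSum (C i) := by
    change T.rowSumHom _ = ∑ i, m i • T.rowSumHom (C i)
    simp only [map_sum, map_smul]
  have h2 : T.rowSum (∑ i, m i • C i) ∈ W := by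
    rw [h1]
    exact W.sum_mem fun i _ => W.smul_mem _ (hCW i)
  have h3 := hcompat (c - ∑ i, m i • C i) (fun j => by
    simp only [Pi.sub_apply, Finset.sum_apply, Pi.smul_apply, hC, smul_eq_mul, mul_add, Finset.sum_add_distrib, Pi.single_apply,
      mul_ite, mul_one, mul_zero, Finset.sum_ite_eq, Finset.mem_univ, if_true]
    simp only [m]
    ring)
  have h4 := W.add_mem h3 h2
  rwa [hsub, sub_add_cancel] at h4

end NiceCusps.Filling
end Gluing

/-! ### Comparison of the determinants -/

namespace Gluing.NiceCusps

section
variable {Tet : Type*} {T : Gluing Tet} {l : ℕ} {N : T.NiceCusps l} {i : Fin l} {lab : Fin 2 → Perm (Fin 4)}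

theorem IsLabelling.loopRow_tet (h : N.IsLabelling i lab) (z : Tet → ℂ) (x : Tet → Fin 3 → ℤ) (a : Fin 2) :
    loopRow z x (N.tet i a) = x (N.tet i a) (quad (lab a 0) (lab a 1)) * loopCoeff (z (N.tet i a)) (quad (lab a 0) (lab a 1)) +
      x (N.tet i a) (quad (lab a 0) (lab a 2)) * loopCoeff (z (N.tet i a)) (quad (lab a 0) (lab a 1) + 1) +
      x (N.tet i a) (quad (lab a 0) (lab a 3)) * loopCoeff (z (N.tet i a)) (quad (lab a 0) (lab a 1) + 2) := by
  rw [loopRow_apply, h.sum_quad a, h.quad_two, h.quad_three]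

theorem IsLabelling.loopRow_rowSum_tet (h : N.IsLabelling i lab) {z : Tet → ℂ} (hz : ∀ t, z t ≠ 0 ∧ z t ≠ 1) (c : T.Edge → ℤ)
    (a : Fin 2) : loopRow z (T.rowSum c) (N.tet i a) =
      ((c (N.blockEdge i lab 1) - c (N.blockEdge i lab 3) : ℤ) : ℂ) * loopCoeff (z (N.tet i a)) (quad (lab a 0) (lab a 1)) +
      ((c (N.blockEdge i lab 2) - c (N.blockEdge i lab 3) : ℤ) : ℂ) * loopCoeff (z (N.tet i a)) (quad (lab a 0) (lab a 1) + 1) := by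
  rw [h.loopRow_tet, h.rowSum_eq c a (by decide), h.rowSum_eq c a (by decide), h.rowSum_eq c a (by decide)]
  have := loopCoeff_sum (hz (N.tet i a)).1 (hz (N.tet i a)).2 (quad (lab a 0) (lab a 1))
  push_cast
  linear_combination ((c (N.blockEdge i lab 0) : ℂ) + c (N.blockEdge i lab 3)) * this

/-- The undetermined constant of each triangle drops out since the coefficients sum up to zero. The
alternating sign is that of the crossing numbers seen from the two triangles. -/
theorem IsLabelling.loopRow_meridian (h : N.IsLabelling i lab) {z : Tet → ℂ} (hz : ∀ t, z t ≠ 0 ∧ z t ≠ 1) {p : CuspPath Tet}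
    (hp : T.IsCurve p) (hi : T.IsOn p (N.cusp i)) (hm : N.IsMeridian i p) :
    ∃ ε : ℂ, ε ^ 2 = 1 ∧ ∀ a : Fin 2, loopRow z p.row (N.tet i a) = (-1) ^ (a : ℕ) * ε *
      (1 + shape (z (N.tet i a)) (quad (lab a 0) (lab a 1))) * loopCoeff (z (N.tet i a)) (quad (lab a 0) (lab a 1) + 2) := by
  obtain ⟨ε, hε, m2, m3⟩ := hm.crossing_eq h
  obtain ⟨u, -, -, h1⟩ := h.exists_row_eq hp hi
  refine ⟨ε, by rcases hε with rfl | rfl <;> simp, fun a => ?_⟩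
  rw [h.loopRow_tet, (h1 a).1, (h1 a).2.1, (h1 a).2.2, m2, m3]
  have e1 := loopCoeff_sum (hz (N.tet i a)).1 (hz (N.tet i a)).2 (quad (lab a 0) (lab a 1))
  have e2 := loopCoeff_add_one (hz (N.tet i a)).1 (hz (N.tet i a)).2 (quad (lab a 0) (lab a 1))
  push_cast
  linear_combination (u a : ℂ) * e1 - (-1) ^ (a : ℕ) * (ε : ℂ) * e2

theorem loopRow_eq_zero {z : Tet → ℂ} {x : Tet → Fin 3 → ℤ} {t : Tet} (hx : ∀ q, x t q = 0) : loopRow z x t = 0 := by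
  rw [loopRow_apply]
  exact Finset.sum_eq_zero fun q _ => by rw [hx]; simp

end

namespace Filling
variable {Tet : Type*} {T : Gluing Tet} {l : ℕ} {N : T.NiceCusps l}
variable {Tet' : Type*} {T' : Gluing Tet'} {lab : Fin l → Fin 2 → Perm (Fin 4)} (F : N.Filling T')
variable [Fintype Tet] [Fintype Tet'] [DecidableEq Tet] [DecidableEq Tet']

/-- The tetrahedra of the triangulation, as those of the filled one and two at every filled cusp. -/
noncomputable def tetEquiv (h : ∀ i, N.IsLabelling i (lab i)) : Fin l ⊕ (Tet' ⊕ Fin l) ≃ Tet :=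
  Equiv.ofBijective (Sum.elim (fun i => N.tet i 0) (Sum.elim F.emb fun i => N.tet i 1)) (by
    refine ⟨?_, fun t => ?_⟩
    · refine Function.Injective.sumElim (fun i j hij => (tet_injective h hij).1) (F.emb_injective.sumElim
        (fun i j hij => (tet_injective h hij).1) fun t i => F.emb_ne t i 1) ?_
      rintro i (t | j)
      · exact (F.emb_ne t i 0).symm
      · exact fun hij => absurd (tet_injective h hij).2 (by decide)
    · rcases F.tet_cases t with ⟨t', rfl⟩ | ⟨i, a, rfl⟩
      · exact ⟨Sum.inr (Sum.inl t'), rfl⟩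
      · fin_cases a
        · exact ⟨Sum.inl i, rfl⟩
        · exact ⟨Sum.inr (Sum.inr i), rfl⟩)

/-- The determinants of the matrices of the two triangulations. -/
theorem det_sq_eq (hT : T.IsIdealTriangulation) (hT' : T'.IsIdealTriangulation) (h : ∀ i, N.IsLabelling i (lab i))
    {α : T.Cusp → CuspPath Tet} (hα : T.IsCurveSystem α) (hfill : ∀ i, N.IsMeridian i (α (N.cusp i)))
    {α' : T'.Cusp → CuspPath Tet'} (hαα' : ∀ c, F.SameCurve (α (F.cuspMap c)) (α' c))
    {z : Tet → ℂ} (hz : ∀ t, z t ≠ 0 ∧ z t ≠ 1)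
    (hxy : ∀ i, shape (z (N.tet i 0)) (quad (lab i 0 0) (lab i 0 1)) * shape (z (N.tet i 1)) (quad (lab i 1 0) (lab i 1 1)) = 1)
    {S : Set T.Edge} (hS : T.Generates S) (r : Tet ≃ S ⊕ T.Cusp)
    {S' : Set T'.Edge} (hS' : T'.Generates S') (r' : Tet' ≃ S' ⊕ T'.Cusp) :
    (T.oneLoopMatrix α z S r).det ^ 2 = (T'.oneLoopMatrix α' (fun t => z (F.emb t)) S' r').det ^ 2 *
      ∏ i, (loopCoeff (z (N.tet i 0)) (quad (lab i 0 0) (lab i 0 1) + 2) * loopCoeff (z (N.tet i 1)) (quad (lab i 1 0) (lab i 1 1) + 2) *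
        ((1 + shape (z (N.tet i 0)) (quad (lab i 0 0) (lab i 0 1))) ^ 2 / shape (z (N.tet i 0)) (quad (lab i 0 0) (lab i 0 1)))) ^ 2 := by
  classical
  choose β hβ1 hβ2 hβ3 hβ4 using hαα'
  choose L hL1 hL2 hL3 using fun E : T'.Edge => F.exists_lift hT hT' h (Pi.single E 1)
  choose C hC using fun i : Fin l => F.exists_dual hT hT' h (Pi.single i 1)
  -- Rows adapted to the folding: separating functions, lifts of the chosen edges and curves of the
  -- filled triangulation, and meridians.
  let κ : Fin l ⊕ (Tet' ⊕ Fin l) → Tet → Fin 3 → ℤ := Sum.elim (fun i => T.rowSum (C i)) (Sum.elim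
    (fun t => Sum.elim (fun E : S' => T.rowSum (L E.1)) (fun c => ((β c).map F.emb).row) (r' t)) fun i => (α (N.cusp i)).row)
  let e := F.tetEquiv h
  -- the two systems of rows span the same module
  have hspan : Submodule.span ℤ (Set.range fun t => κ (e.symm t)) ⊔ constRows Tet =
      Submodule.span ℤ (Set.range fun t => T.nzRow α S (r t)) ⊔ constRows Tet := by
    have e1 : (Set.range fun t => κ (e.symm t)) = Set.range κ := e.symm.surjective.range_comp κ
    have e2 : (Set.range fun t => T.nzRow α S (r t)) = Set.range (T.nzRow α S) := r.surjective.range_comp _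
    rw [e1, e2, nzRow, hS.span_eq]
    have hedge : ∀ c, T.rowSum c ∈ LinearMap.range T.rowSumHom := fun c => ⟨c, rfl⟩
    refine le_antisymm (sup_le (Submodule.span_le.2 ?_) le_sup_right) ?_
    · rintro _ ⟨i | t | i, rfl⟩
      · exact Submodule.mem_sup_left (Submodule.mem_sup_left (hedge _))
      · change Sum.elim (fun E : S' => T.rowSum (L E.1)) (fun c => ((β c).map F.emb).row) (r' t) ∈ _
        rcases r' t with E | c
        · exact Submodule.mem_sup_left (Submodule.mem_sup_left (hedge _))
        · have h1 := (sup_le_sup_right le_sup_left _ :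
            _ ≤ LinearMap.range T.rowSumHom ⊔ Submodule.span ℤ (Set.range fun c => (α c).row) ⊔ constRows Tet) (hβ4 c).row_sub_mem
          have h2 : (α (F.cuspMap c)).row ∈ LinearMap.range T.rowSumHom ⊔ Submodule.span ℤ (Set.range fun c => (α c).row) ⊔ constRows Tet :=
            Submodule.mem_sup_left (Submodule.mem_sup_right (Submodule.subset_span ⟨_, rfl⟩))
          have h3 := Submodule.sub_mem _ h2 h1
          rwa [sub_sub_cancel] at h3
      · exact Submodule.mem_sup_left (Submodule.mem_sup_right (Submodule.subset_span ⟨_, rfl⟩))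
    · have hκ : ∀ x, κ x ∈ Submodule.span ℤ (Set.range κ) ⊔ constRows Tet := fun x =>
        Submodule.mem_sup_left (Submodule.subset_span ⟨x, rfl⟩)
      have hrow : LinearMap.range T.rowSumHom ≤ Submodule.span ℤ (Set.range κ) ⊔ constRows Tet := by
        rintro _ ⟨c, rfl⟩
        refine F.rowSum_mem hT hT' h hS' le_sup_right hL1 hL3 (fun E hE => ?_) hC (fun i => hκ (Sum.inl i)) c
        have := hκ (Sum.inr (Sum.inl (r'.symm (Sum.inl ⟨E, hE⟩))))
        simpa [κ] using this
      refine sup_le (sup_le hrow (Submodule.span_le.2 ?_)) le_sup_right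
      rintro _ ⟨c, rfl⟩
      by_cases hc : ∀ i, c ≠ N.cusp i
      · obtain ⟨c', rfl⟩ := (F.range_cuspMap c).2 hc
        have h1 := (sup_le hrow le_sup_right : _ ≤ Submodule.span ℤ (Set.range κ) ⊔ constRows Tet) (hβ4 c').row_sub_mem
        have h2 := hκ (Sum.inr (Sum.inl (r'.symm (Sum.inr c'))))
        have h3 : κ (Sum.inr (Sum.inl (r'.symm (Sum.inr c')))) = ((β c').map F.emb).row := by simp [κ]
        rw [h3] at h2
        have h4 := Submodule.add_mem _ h1 h2
        rwa [sub_add_cancel] at h4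
      · push Not at hc
        obtain ⟨i, rfl⟩ := hc
        exact hκ (Sum.inr (Sum.inr i))
  have hspan' : Submodule.span ℤ (Set.range fun t => T'.nzRow β S' (r' t)) ⊔ constRows Tet' =
      Submodule.span ℤ (Set.range fun t => T'.nzRow α' S' (r' t)) ⊔ constRows Tet' := by
    have e1 : (Set.range fun t => T'.nzRow β S' (r' t)) = Set.range (T'.nzRow β S') := r'.surjective.range_comp _
    have e2 : (Set.range fun t => T'.nzRow α' S' (r' t)) = Set.range (T'.nzRow α' S') := r'.surjective.range_comp _
    have key : ∀ p p' : T'.Cusp → CuspPath Tet', (∀ c, (p c).row - (p' c).row ∈ LinearMap.range T'.rowSumHom ⊔ constRows Tet') →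
        LinearMap.range T'.rowSumHom ⊔ Submodule.span ℤ (Set.range fun c => (p c).row) ⊔ constRows Tet' ≤
        LinearMap.range T'.rowSumHom ⊔ Submodule.span ℤ (Set.range fun c => (p' c).row) ⊔ constRows Tet' := by
      intro p p' hpp
      refine sup_le (sup_le (le_sup_left.trans le_sup_left) (Submodule.span_le.2 ?_)) le_sup_right
      rintro _ ⟨c, rfl⟩
      have h1 := (sup_le_sup_right le_sup_left _ : _ ≤ LinearMap.range T'.rowSumHom ⊔
        Submodule.span ℤ (Set.range fun c => (p' c).row) ⊔ constRows Tet') (hpp c)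
      have h2 : (p' c).row ∈ LinearMap.range T'.rowSumHom ⊔ Submodule.span ℤ (Set.range fun c => (p' c).row) ⊔ constRows Tet' :=
        Submodule.mem_sup_left (Submodule.mem_sup_right (Submodule.subset_span ⟨c, rfl⟩))
      have h4 := Submodule.add_mem _ h1 h2
      rwa [sub_add_cancel] at h4
    rw [e1, e2, nzRow, nzRow, hS'.span_eq, hS'.span_eq]
    exact le_antisymm (key _ _ fun c => by rw [← neg_sub]; exact Submodule.neg_mem _ (hβ3 c).row_sub_mem)
      (key _ _ fun c => (hβ3 c).row_sub_mem)
  have hz0 : ∀ t, z t ≠ 0 := fun t => (hz t).1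
  have hdet : (T.oneLoopMatrix α z S r).det ^ 2 = (Matrix.of fun i j => loopRow z (κ i) (e j)).det ^ 2 := by
    have h1 := Matrix.det_eq_or_eq_neg_of_span_eq (span_loopRow_eq hz0 hspan)
    rw [← sq_eq_sq_iff_eq_or_eq_neg, ← Matrix.det_submatrix_equiv_self e] at h1
    rw [oneLoopMatrix_eq T hz0, ← h1]
    congr 2
    ext i j
    simp
  have hdet' : (T'.oneLoopMatrix α' (fun t => z (F.emb t)) S' r').det ^ 2 =
      (Matrix.of fun s t => loopRow (fun t => z (F.emb t)) (T'.nzRow β S' (r' s)) t).det ^ 2 := by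
    have h1 := Matrix.det_eq_or_eq_neg_of_span_eq (span_loopRow_eq (fun t => hz0 (F.emb t)) hspan')
    rw [← sq_eq_sq_iff_eq_or_eq_neg] at h1
    rw [oneLoopMatrix_eq T' fun t => hz0 (F.emb t), ← h1]
  have hzero : ∀ i j a, i ≠ j → loopRow z (α (N.cusp i)).row (N.tet j a) = 0 := by
    intro i j a hij
    obtain ⟨u, -, h0, -⟩ := (h i).exists_row_eq (hα (N.cusp i)).1 (hα (N.cusp i)).2.1
    exact loopRow_eq_zero fun q => h0 _ (fun b hb => hij (tet_injective h hb).1.symm) q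
  have hβ0 : ∀ c j a, loopRow z ((β c).map F.emb).row (N.tet j a) = 0 := fun c j a =>
    loopRow_eq_zero fun q => CuspPath.map_row_eq_zero _ (fun t' => F.emb_ne t' j a) q
  choose ε hε hmer using fun i => (h i).loopRow_meridian hz (hα (N.cusp i)).1 (hα (N.cusp i)).2.1 (hfill i)
  let x : Fin l → Fin 2 → ℂ := fun i a => shape (z (N.tet i a)) (quad (lab i a 0) (lab i a 1))
  let g : Fin l → Fin 2 → ℂ := fun i a => loopCoeff (z (N.tet i a)) (quad (lab i a 0) (lab i a 1) + 2)
  have hh : ∀ i a, loopCoeff (z (N.tet i a)) (quad (lab i a 0) (lab i a 1)) = (x i a - 1) * g i a := fun i a =>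
    loopCoeff_self (hz _).1 (hz _).2 _
  have hf : ∀ i a, loopCoeff (z (N.tet i a)) (quad (lab i a 0) (lab i a 1) + 1) = -x i a * g i a := fun i a =>
    loopCoeff_add_one (hz _).1 (hz _).2 _
  have hx0 : ∀ i a, x i a ≠ 0 := fun i a => shape_ne_zero (hz _).1 (hz _).2 _
  have hx1 : ∀ i a, x i a - 1 ≠ 0 := fun i a => sub_ne_zero.2 (shape_ne_one (hz _).1 (hz _).2 _)
  have hg0 : ∀ i a, g i a ≠ 0 := fun i a => loopCoeff_ne_zero (hz _).1 (hz _).2 _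
  have hxy : ∀ i, x i 0 * x i 1 = 1 := hxy
  have hmer0 : ∀ i, loopRow z (α (N.cusp i)).row (N.tet i 0) = ε i * (1 + x i 0) * g i 0 := fun i => by
    rw [hmer i 0]; simp [x, g]
  have hmer1 : ∀ i, loopRow z (α (N.cusp i)).row (N.tet i 1) = -ε i * (1 + x i 1) * g i 1 := fun i => by
    rw [hmer i 1]; simp [x, g]
  -- On the two columns of a pair, a lifted edge row has entries in the ratio of the coefficients at
  -- the type of `h`, which are `a` and `b`; lifted curves vanish there. The meridian row has the
  -- same ratio exactly because `x i 0 * x i 1 = 1`. Only the separating row deviates, with defect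
  -- `ω`.
  have key := Matrix.det_mul_prod_eq_of_proportional (M := Matrix.of fun i j => loopRow z (κ i) (e j))
    (a := fun i => (x i 0 - 1) * g i 0) (b := fun i => (x i 1 - 1) * g i 1)
    (ω := fun i => -x i 0 * g i 0 * ((x i 1 - 1) * g i 1) - -x i 1 * g i 1 * ((x i 0 - 1) * g i 0))
    (v := fun i => -ε i * (1 + x i 1) * g i 1) ?_ ?_ ?_ ?_
  · have hin : (Matrix.of fun s t => (Matrix.of fun i j => loopRow z (κ i) (e j)) (Sum.inr (Sum.inl s)) (Sum.inr (Sum.inl t))) =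
        Matrix.of fun s t => loopRow (fun t => z (F.emb t)) (T'.nzRow β S' (r' s)) t := by
      ext s t
      change loopRow z (Sum.elim (fun E : S' => T.rowSum (L E.1)) (fun c => ((β c).map F.emb).row) (r' s)) (F.emb t) =
        loopRow (fun t => z (F.emb t)) (T'.nzRow β S' (r' s)) t
      rw [loopRow_apply, loopRow_apply]
      refine Finset.sum_congr rfl fun q _ => ?_
      congr 2
      rcases r' s with E | c
      · change T.rowSum _ _ _ = T'.edgeRow _ _ _
        rw [edgeRow_eq, F.rowSum_emb (hL3 E.1)]
      · exact CuspPath.map_row F.emb_injective _ _ _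
    rw [hin] at key
    have hb : (∏ i, (x i 1 - 1) * g i 1) ^ 2 ≠ 0 :=
      pow_ne_zero 2 (Finset.prod_ne_zero_iff.2 fun i _ => mul_ne_zero (hx1 i 1) (hg0 i 1))
    refine mul_right_cancel₀ hb ?_
    rw [hdet, ← mul_pow, key, hdet', mul_pow, mul_pow, mul_comm _ ((Matrix.det _) ^ 2), mul_assoc, mul_assoc, ← Finset.prod_pow,
      ← Finset.prod_pow, ← Finset.prod_pow, ← Finset.prod_mul_distrib, ← Finset.prod_mul_distrib]
    congr 1
    refine Finset.prod_congr rfl fun i _ => ?_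
    change _ = (g i 0 * g i 1 * ((1 + x i 0) ^ 2 / x i 0)) ^ 2 * _
    have e1 : x i 1 = (x i 0)⁻¹ := eq_inv_of_mul_eq_one_right (hxy i)
    have e2 := hx0 i 0
    have e3 := hε i
    rw [e1]
    field_simp
    rw [e3]
    ring
  · rintro (t | j) i
    · change loopRow z (Sum.elim (fun E : S' => T.rowSum (L E.1)) (fun c => ((β c).map F.emb).row) (r' t)) (N.tet i 0) * _ =
        loopRow z (Sum.elim (fun E : S' => T.rowSum (L E.1)) (fun c => ((β c).map F.emb).row) (r' t)) (N.tet i 1) * _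
      rcases r' t with E | c
      · change loopRow z (T.rowSum (L E.1)) _ * _ = loopRow z (T.rowSum (L E.1)) _ * _
        rw [(h i).loopRow_rowSum_tet hz, (h i).loopRow_rowSum_tet hz, hL1, hh, hh, hf, hf]
        push_cast
        ring
      · change loopRow z ((β c).map F.emb).row _ * _ = loopRow z ((β c).map F.emb).row _ * _
        rw [hβ0, hβ0, zero_mul, zero_mul]
    · change loopRow z (α (N.cusp j)).row (N.tet i 0) * _ = loopRow z (α (N.cusp j)).row (N.tet i 1) * _
      by_cases hij : j = i
      · subst hij
        rw [hmer0, hmer1]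
        linear_combination (2 * ε j * g j 0 * g j 1) * hxy j
      · rw [hzero j i 0 hij, hzero j i 1 hij, zero_mul, zero_mul]
  · intro i j
    change loopRow z (T.rowSum (C i)) (N.tet j 0) * _ - loopRow z (T.rowSum (C i)) (N.tet j 1) * _ = _
    rw [(h j).loopRow_rowSum_tet hz, (h j).loopRow_rowSum_tet hz, hC, hh, hh, hf, hf, add_sub_cancel_left, Pi.single_apply]
    by_cases hij : i = j
    · subst hij
      rw [if_pos rfl, if_pos rfl]
      push_cast
      ring
    · rw [if_neg hij, if_neg (Ne.symm hij)]
      push_cast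
      ring
  · intro i t
    change loopRow z (α (N.cusp i)).row (F.emb t) = 0
    obtain ⟨u, -, h0, -⟩ := (h i).exists_row_eq (hα (N.cusp i)).1 (hα (N.cusp i)).2.1
    exact loopRow_eq_zero fun q => h0 _ (fun b => F.emb_ne t i b) q
  · intro i j
    change loopRow z (α (N.cusp i)).row (N.tet j 1) = _
    by_cases hij : i = j
    · subst hij
      rw [if_pos rfl, hmer1]
    · rw [if_neg hij, hzero i j 1 hij]

end Filling
end Gluing.NiceCusps

namespace Gluing.NiceCusps
variable {Tet : Type*} [Fintype Tet] {T : Gluing Tet} {l : ℕ} {N : T.NiceCusps l}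

/-- The contribution of the two tetrahedra at a filled cusp to the flattening product. -/
theorem IsLabelling.flattening_sq_eq {i : Fin l} {lab : Fin 2 → Perm (Fin 4)} (hT : T.IsIdealTriangulation)
    (h : N.IsLabelling i lab) {z : Tet → ℂ} (hz : ∀ t, z t ≠ 0 ∧ z t ≠ 1)
    (hxy : shape (z (N.tet i 0)) (quad (lab 0 0) (lab 0 1)) * shape (z (N.tet i 1)) (quad (lab 1 0) (lab 1 1)) = 1)
    {f : Tet → Fin 3 → ℤ} (hf : T.IsStrongFlattening f) (h0 : ∀ a, f (N.tet i a) (quad (lab a 0) (lab a 1)) = 0) :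
    (loopCoeff (z (N.tet i 0)) (quad (lab 0 0) (lab 0 1) + 2) * loopCoeff (z (N.tet i 1)) (quad (lab 1 0) (lab 1 1) + 2)) ^ 2 *
      (shape (z (N.tet i 0)) 0 ^ f (N.tet i 0) 2 * shape (z (N.tet i 0)) 2 ^ (-f (N.tet i 0) 0) *
        (shape (z (N.tet i 1)) 0 ^ f (N.tet i 1) 2 * shape (z (N.tet i 1)) 2 ^ (-f (N.tet i 1) 0))) ^ 2 = 1 := by
  obtain ⟨n, hn⟩ := loopCoeff_mul_flattening (hz (N.tet i 0)).1 (hz (N.tet i 0)).2 (hf.1 _) (h0 0)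
  obtain ⟨m, hm⟩ := loopCoeff_mul_flattening (hz (N.tet i 1)).1 (hz (N.tet i 1)).2 (hf.1 _) (h0 1)
  -- Up to sign each tetrahedron contributes the same power of its inverse parameter at `h`, and
  -- these two parameters have product 1.
  have h1 := hf.apply_tet_eq hT h (r := 2) (by decide)
  rw [h.quad_two, h.quad_two] at h1
  rw [← mul_pow, mul_mul_mul_comm, hn, hm, ← h1, mul_mul_mul_comm, ← mul_zpow, ← mul_inv, hxy, inv_one, one_zpow, mul_one, mul_pow,
    ← zpow_natCast, ← zpow_natCast, ← zpow_mul, ← zpow_mul, mul_comm n, mul_comm m, zpow_mul, zpow_mul]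
  simp

end Gluing.NiceCusps

/-! ### Comparison of the two invariants -/

theorem theorem1p9 {Tet Tet' : Type*} [Fintype Tet] [DecidableEq Tet]
    [Fintype Tet'] [DecidableEq Tet'] {l : ℕ}
    (T : Gluing Tet) (hT : T.IsIdealTriangulation)
    (T' : Gluing Tet') (hT' : T'.IsIdealTriangulation)
    (N : T.NiceCusps l) (F : N.Filling T')
    -- the systems of curves: `α` kills the filled cusps, and `α'` is its restriction
    (α : T.Cusp → CuspPath Tet) (hα : T.IsCurveSystem α)
    (hfill : ∀ i, N.IsMeridian i (α (N.cusp i)))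
    (α' : T'.Cusp → CuspPath Tet') (hα' : T'.IsCurveSystem α')
    (hαα' : ∀ c, F.SameCurve (α (F.cuspMap c)) (α' c))
    -- the shape parameters
    (z : Tet → ℂ) (hz : z ∈ T.gluingVariety)
    (hz' : (fun t => z (F.emb t)) ∈ T'.gluingVariety)
    (hρ : ∀ i, T.HolonomyTrivial z (α (N.cusp i)))
    -- the core curves and their logarithmic holonomies
    (γ : Fin l → CuspPath Tet) (hγ : ∀ i, T.IsSimpleClosedCurve (γ i) (N.cusp i))
    (hcore : ∀ i, N.IntersectOnce i (α (N.cusp i)) (γ i))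
    (H : Fin l → ℂ) (hH : ∀ i, Complex.exp (H i) = (γ i).holonomy z)
    -- the values of the two invariants, each defined up to sign
    (τ τ' : ℂ) (hτ : T.IsOneLoopInvariant α z τ)
    (hτ' : T'.IsOneLoopInvariant α' (fun t => z (F.emb t)) τ') :
    (τ' * ∏ i, 4 * Complex.sinh (H i / 2) ^ 2 = τ ∨
      τ' * ∏ i, 4 * Complex.sinh (H i / 2) ^ 2 = -τ) ∧
    ((∀ i, Complex.sinh (H i / 2) ≠ 0) →
      τ' = τ * (1 / ∏ i, 4 * Complex.sinh (H i / 2) ^ 2) ∨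
      τ' = -(τ * (1 / ∏ i, 4 * Complex.sinh (H i / 2) ^ 2))) := by
  choose lab h using fun i => N.exists_isLabelling hT i
  have hxy := fun i => (h i).shape_mul_eq_one hz.1 (hα (N.cusp i)).1 (hα (N.cusp i)).2.1 (hfill i) (hρ i)
  have hsinh : ∀ i, 4 * Complex.sinh (H i / 2) ^ 2 =
      -((1 + shape (z (N.tet i 0)) (quad (lab i 0 0) (lab i 0 1))) ^ 2 / shape (z (N.tet i 0)) (quad (lab i 0 0) (lab i 0 1))) := by
    intro i
    have h0 := Gluing.shape_ne_zero (hz.1 (N.tet i 0)).1 (hz.1 (N.tet i 0)).2 (quad (lab i 0 0) (lab i 0 1))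
    rw [four_mul_sinh_half_sq, hH, (h i).holonomy_eq hz.1 (hxy i) (hfill i) (hγ i).1 (hγ i).2.1 (hcore i)]
    field_simp
    ring
  have main : (τ' * ∏ i, 4 * Complex.sinh (H i / 2) ^ 2) ^ 2 = τ ^ 2 := by
    obtain ⟨S, r, f, hS, hf, hτ⟩ := hτ
    obtain ⟨S', r', f', hS', hf', hτ'⟩ := hτ'
    rw [← sq_eq_sq_iff_eq_or_eq_neg] at hτ hτ'
    -- The given flattening is replaced by one that vanishes at the folding edges, at the cost of a
    -- sign.
    obtain ⟨g, hg, hg0⟩ := F.exists_isStrongFlattening hT hT' h hf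
    have e1 := hf.flatteningProd_eq hz hg.1 hg.2.1 fun p c hp _ => hg.2.2 p c hp
    have e2 := F.flatteningProd_eq hT hT' h hz' hg hg0 hf'
    rw [← sq_eq_sq_iff_eq_or_eq_neg] at e1 e2
    have e3 := F.det_sq_eq hT hT' h hα hfill hαα' hz.1 hxy hS r hS' r'
    have e4 : Gluing.flatteningProd z g = Gluing.flatteningProd (fun t => z (F.emb t)) (fun t => g (F.emb t)) * _ := F.prod_tet h _
    have e5 : (∏ i, 4 * Complex.sinh (H i / 2) ^ 2) ^ 2 = ∏ i, ((1 + shape (z (N.tet i 0)) (quad (lab i 0 0) (lab i 0 1))) ^ 2 /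
        shape (z (N.tet i 0)) (quad (lab i 0 0) (lab i 0 1))) ^ 2 := by
      rw [← Finset.prod_pow]
      exact Finset.prod_congr rfl fun i _ => by rw [hsinh, neg_sq]
    change τ ^ 2 = (1 / 2 * _ * Gluing.flatteningProd z f) ^ 2 at hτ
    change τ' ^ 2 = (1 / 2 * _ * Gluing.flatteningProd (fun t => z (F.emb t)) f') ^ 2 at hτ'
    rw [mul_pow, hτ, hτ', e5, mul_pow, mul_pow, mul_pow, mul_pow, e3, ← e1, ← e2, e4, mul_pow _ (∏ i, _)]
    -- The coefficients left over from the determinant cancel against the flattening factors of the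
    -- removed tetrahedra, leaving the hyperbolic sines.
    have e6 := Finset.prod_congr (rfl : Finset.univ = Finset.univ) fun i _ => (h i).flattening_sq_eq hT hz.1 (hxy i) hg (hg0 i)
    rw [Finset.prod_mul_distrib, Finset.prod_const_one, Finset.prod_pow _ _ fun i => _ * _] at e6
    simp only [mul_pow (_ * _) (_ / _), Finset.prod_mul_distrib, Finset.prod_pow] at e6 ⊢
    linear_combination -((1 / 2) ^ 2 * (T'.oneLoopMatrix α' (fun t => z (F.emb t)) S' r').det ^ 2 *
      Gluing.flatteningProd (fun t => z (F.emb t)) (fun t => g (F.emb t)) ^ 2 *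
      (∏ i, ((1 + shape (z (N.tet i 0)) (quad (lab i 0 0) (lab i 0 1))) ^ 2 /
        shape (z (N.tet i 0)) (quad (lab i 0 0) (lab i 0 1)))) ^ 2) * e6
  rw [sq_eq_sq_iff_eq_or_eq_neg] at main
  refine ⟨main, fun hne => ?_⟩
  have hP : (∏ i, 4 * Complex.sinh (H i / 2) ^ 2) ≠ 0 :=
    Finset.prod_ne_zero_iff.2 fun i _ => mul_ne_zero (by norm_num) (pow_ne_zero 2 (hne i))
  rcases main with h | h
  · left; rw [← h]; field_simp
  · right; rw [← neg_mul, ← h]; field_simp
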